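/- **Setting.** Let $N, I_1, I_2\ge 1$, and let observation $n\in\{1,\dots,N\}$ be taken at level $i_1[n]\in\{1,\dots,I_1\}$ of a first factor and level $i_2[n]\in\{1,\dots,I_2\}$ of a second factor. Put $n_{ij}=\#\{n: i_1[n]=i,\ i_2[n]=j\}$, $p=I_1+I_2$ and $\bar n=2N/p$. The design has *balanced levels*: every level of factor $k$ carries exactly $N/I_k$ observations ($k=1,2$). Consider the Gaussian crossed effect model with parameters $\theta=(a^{(0)},a^{(1)},a^{(2)})\in\mathbb R\times\mathbb R^{I_1}\times\mathbb R^{I_2}$: independently $a^{(0)}\sim\mathcal N(\mu_{pr},\tau_{pr}^{-1})$ (the improper flat prior if $\tau_{pr}=0$), $a^{(k)}_i\sim\mathcal N(0,\tau_k^{-1})$, and, given $\theta$, independently $y_n\sim\mathcal N(a^{(0)}+a^{(1)}_{i_1[n]}+a^{(2)}_{i_2[n]},\tau^{-1})$, where $\gamma=(\tau,\tau_1,\tau_2)\in(0,\infty)^3$, $\mu_{pr}\in\mathbb R$ and $\tau_{pr}\in[0,\infty)$. For a Markov kernel $P$ with stationary law $\pi$, the *rate of convergence* is the infimum $\rho$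 of all $r\ge0$ such that $\|P^tf-\pi(f)\|_{L^2(\pi)}=O(r^t)$ for every $f\in L^2(\pi)$, and the *relaxation time* is $(1-\rho)^{-1}\in[1,\infty]$. Let $T_{aux}$ be the relaxation time of the two-component deterministic-scan Gibbs sampler on $\{1,\dots,I_1\}\times\{1,\dots,I_2\}$ whose target has probability mass function proportional to $n_{ij}$. Let $T_{cgs}$ be the relaxation time of the collapsed Gibbs sampler for the posterior $\mathcal L(\theta\mid y,\gamma)$, one iteration of which draws $(a^{(0)},a^{(1)})$ from its conditional posterior law given $a^{(2)}$ and then $(a^{(0)},a^{(2)})$ from its conditional posterior law given $a^{(1)}$. Each update is carried out exactly by the program that passes once through the $N$ observations to form, for each level of the factor being updated, the number of its observations and the sum of their residuals, then draws $a^{(0)}$ from its conditional law given the effects of the other factor, and then draws the effects of the updated factor independently, each from its full conditional law; the cost per iteration is the number of arithmetic operations, square roots, constant loads and standard normal draws that this program makes. Let $Cost(Gibbs)=(\text{cost per iteration})\times T_{cgs}$. **Theorem.** For every $\gamma$ there are constants $0<c,C<\infty$ depending only on $\gamma$ such that, for all $N,I_1,I_2\ge1$, all designs with balanced levels, all data $y\in\mathbb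 R^N$, and all $\mu_{pr}\in\mathbb R$, $\tau_{pr}\ge0$: the posterior is a proper probability distribution; for almost every current state $\theta$ under it, one run of the program from $\theta$ returns a draw from the transition law of the collapsed Gibbs sampler at $\theta$; and $$c\,\min\{\bar n,T_{aux}\}\le T_{cgs}\le C(1+\tau_{pr})\min\{\bar n,T_{aux}\},$$ $$c\,(2N+p)\min\{\bar n,T_{aux}\}\le Cost(Gibbs)\le C(1+\tau_{pr})\,(2N+p)\min\{\bar n,T_{aux}\}.$$ In particular, for the flat prior, or for any fixed $\tau_{pr}$, $Cost(Gibbs)=\Theta\big((2N+p)\min\{\bar n,T_{aux}\}\big)$. -/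

import Mathlib

open MeasureTheory ProbabilityTheory
open scoped NNReal ENNReal

noncomputable section

namespace CrossedEffects

/-! ### Markov chains: rate of convergence, relaxation time, Gibbs sampling -/

/-- The `L²(π)` rate of convergence of a Markov chain with transition kernel `P` and stationary
law `π`: the infimum of all `r` such that, for every square-integrable `f`,
`‖Pᵗ f - π(f)‖_{L²(π)} = O(rᵗ)`. -/
def l2Rate {Ω : Type*} [MeasurableSpace Ω] (P : Kernel Ω Ω) (π : Measure Ω) : ℝ≥0∞ :=
  sInf {r : ℝ≥0∞ | ∀ f : Ω → ℝ, MemLp f 2 π → ∃ C : ℝ≥0, ∀ t : ℕ,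
    eLpNorm (fun x => (∫ z, f z ∂((P ^ t) x)) - ∫ z, f z ∂π) 2 π ≤ C * r ^ t}

/-- The relaxation time: the reciprocal of one minus the rate of convergence. It is `∞` when the
rate is `1`. -/
def relaxationTime {Ω : Type*} [MeasurableSpace Ω] (P : Kernel Ω Ω) (π : Measure Ω) : ℝ≥0∞ :=
  (1 - l2Rate P π)⁻¹

/-- One exact block update of a Gibbs sampler targeting `π`: from the current state `ω`, draw a
new state from the conditional law under `π` of the state given the retained coordinates `X`,
at the value `X ω`. -/
def blockUpdate {Ω β : Type*} [MeasurableSpace Ω] [StandardBorelSpace Ω] [Nonempty Ω]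
    [MeasurableSpace β] (π : Measure Ω) [IsFiniteMeasure π] (X : Ω → β) (hX : Measurable X) :
    Kernel Ω Ω :=
  (condDistrib id X π).comap X hX

/-- Two-block deterministic-scan Gibbs sampler: one iteration first updates everything but `X`,
then everything but `Y`. -/
def twoBlockGibbs {Ω β β' : Type*} [MeasurableSpace Ω] [StandardBorelSpace Ω] [Nonempty Ω]
    [MeasurableSpace β] [MeasurableSpace β'] (π : Measure Ω) [IsFiniteMeasure π]
    (X : Ω → β) (hX : Measurable X) (Y : Ω → β') (hY : Measurable Y) : Kernel Ω Ω :=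
  blockUpdate π Y hY ∘ₖ blockUpdate π X hX

/-! ### The design -/

/-- A two-factor design: observation `n` is taken at level `lev₁ n` of the first factor and at
level `lev₂ n` of the second. -/
structure Design (N I₁ I₂ : ℕ) where
  lev₁ : Fin N → Fin I₁
  lev₂ : Fin N → Fin I₂

variable {N I₁ I₂ : ℕ}

/-- Number of observations at level `i` of the first factor. -/
def Design.occ₁ (D : Design N I₁ I₂) (i : Fin I₁) : ℕ := ∑ n : Fin N, if D.lev₁ n = i then 1 else 0

/-- Number of observations at level `j` of the second factor. -/
def Design.occ₂ (D : Design N I₁ I₂) (j : Fin I₂) : ℕ := ∑ n : Fin N, if D.lev₂ n = j then 1 else 0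

/-- Co-occurrence counts: the number of observations in cell `(i, j)`. -/
def Design.cooc (D : Design N I₁ I₂) (i : Fin I₁) (j : Fin I₂) : ℕ :=
  ∑ n : Fin N, if D.lev₁ n = i ∧ D.lev₂ n = j then 1 else 0

/-- Balanced levels. -/
def Design.Balanced (D : Design N I₁ I₂) : Prop :=
  (∀ i, (D.occ₁ i : ℝ) = (N : ℝ) / I₁) ∧ (∀ j, (D.occ₂ j : ℝ) = (N : ℝ) / I₂)

/-- The average number of observations per factor level, `K N / p` with `K = 2`, `p = I₁ + I₂`. -/
def nbar (N I₁ I₂ : ℕ) : ℝ≥0 := 2 * N / (I₁ + I₂)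

/-! ### The auxiliary Gibbs sampler -/

/-- The law on cells with probability mass function proportional to the co-occurrence counts. -/
def Design.auxTarget (D : Design N I₁ I₂) : Measure (Fin I₁ × Fin I₂) :=
  cond (Measure.count.withDensity fun x => (D.cooc x.1 x.2 : ℝ≥0∞)) Set.univ

instance (D : Design N I₁ I₂) : IsFiniteMeasure D.auxTarget := by
  unfold Design.auxTarget; infer_instance

/-- The auxiliary sampler: update the first component given the second, then the second given
the first. -/
def Design.auxGibbs [NeZero I₁] [NeZero I₂] (D : Design N I₁ I₂) :
    Kernel (Fin I₁ × Fin I₂) (Fin I₁ × Fin I₂) :=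
  twoBlockGibbs D.auxTarget Prod.snd measurable_snd Prod.fst measurable_fst

/-- Relaxation time of the auxiliary sampler. -/
def Design.Taux [NeZero I₁] [NeZero I₂] (D : Design N I₁ I₂) : ℝ≥0∞ :=
  relaxationTime D.auxGibbs D.auxTarget

/-! ### The crossed effect model with Gaussian likelihood -/

/-- The variance parameters `γ`, as precisions: `τ` of the likelihood, `τ₁`, `τ₂` of the
effects of the two factors. -/
structure Precisions where
  τ : ℝ≥0
  τ₁ : ℝ≥0
  τ₂ : ℝ≥0

/-- The regression parameters `(a⁰, a¹, a²)`. -/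
abbrev Param (I₁ I₂ : ℕ) : Type := ℝ × (Fin I₁ → ℝ) × (Fin I₂ → ℝ)

/-- Prior of the global effect: normal with mean `μpr` and precision `τpr`, where `τpr = 0` is
the improper flat prior. -/
def globalPrior (μpr : ℝ) (τpr : ℝ≥0) : Measure ℝ :=
  if τpr = 0 then volume else gaussianReal μpr τpr⁻¹

/-- Prior of all parameters: independent, with `aᵏᵢ` normal with mean zero and precision `τₖ`. -/
def prior (I₁ I₂ : ℕ) (γ : Precisions) (μpr : ℝ) (τpr : ℝ≥0) : Measure (Param I₁ I₂) :=
  (globalPrior μpr τpr).prod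
    ((Measure.pi fun _ => gaussianReal 0 γ.τ₁⁻¹).prod (Measure.pi fun _ => gaussianReal 0 γ.τ₂⁻¹))

/-- Linear predictor of observation `n`. -/
def Design.predictor (D : Design N I₁ I₂) (θ : Param I₁ I₂) (n : Fin N) : ℝ :=
  θ.1 + θ.2.1 (D.lev₁ n) + θ.2.2 (D.lev₂ n)

/-- Likelihood: given `θ`, the observations are independent and normal with mean the linear
predictor and precision `τ`. -/
def Design.likelihood (D : Design N I₁ I₂) (γ : Precisions) (y : Fin N → ℝ)
    (θ : Param I₁ I₂) : ℝ≥0∞ :=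
  ∏ n, gaussianPDF (D.predictor θ n) γ.τ⁻¹ (y n)

/-- Posterior of `θ` given the data `y` and the precisions (Bayes' rule). -/
def Design.posterior (D : Design N I₁ I₂) (γ : Precisions) (μpr : ℝ) (τpr : ℝ≥0)
    (y : Fin N → ℝ) : Measure (Param I₁ I₂) :=
  cond ((prior I₁ I₂ γ μpr τpr).withDensity (D.likelihood γ y)) Set.univ

instance (D : Design N I₁ I₂) (γ : Precisions) (μpr : ℝ) (τpr : ℝ≥0) (y : Fin N → ℝ) :
    IsFiniteMeasure (D.posterior γ μpr τpr y) := by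
  unfold Design.posterior; infer_instance

/-- The collapsed Gibbs sampler: update `(a⁰, a¹)` given `a²`, then `(a⁰, a²)` given `a¹`, each
from its exact conditional posterior law. -/
def Design.collapsedGibbs (D : Design N I₁ I₂) (γ : Precisions) (μpr : ℝ) (τpr : ℝ≥0)
    (y : Fin N → ℝ) : Kernel (Param I₁ I₂) (Param I₁ I₂) :=
  twoBlockGibbs (D.posterior γ μpr τpr y)
    (fun θ => θ.2.2) (measurable_snd.comp measurable_snd)
    (fun θ => θ.2.1) (measurable_fst.comp measurable_snd)

/-- Relaxation time of the collapsed Gibbs sampler. -/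
def Design.Tcgs (D : Design N I₁ I₂) (γ : Precisions) (μpr : ℝ) (τpr : ℝ≥0)
    (y : Fin N → ℝ) : ℝ≥0∞ :=
  relaxationTime (D.collapsedGibbs γ μpr τpr y) (D.posterior γ μpr τpr y)

/-! ### Cost model: straight-line programs over real registers

Every instruction costs one step: an arithmetic operation, a square root, loading a constant, or
a draw of an independent standard normal variable. -/

/-- Instructions with registers in `R`; the first argument is the target register. -/
inductive Instr (R : Type) where
  | const (d : R) (c : ℝ)
  | add (d a b : R)
  | sub (d a b : R)
  | mul (d a b : R)
  | div (d a b : R)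
  | sqrt (d a : R)
  | gauss (d : R)

section Semantics

variable {R : Type} [DecidableEq R]

/-- Assign to register `d` the value `g s` computed from the current memory `s`. -/
def assign (d : R) (g : (R → ℝ) → ℝ) (hg : Measurable g) : Kernel (R → ℝ) (R → ℝ) :=
  Kernel.deterministic (fun s => Function.update s d (g s)) (by
    refine measurable_pi_iff.2 fun r => ?_
    by_cases h : r = d
    · subst h; simpa using hg
    · simpa [Function.update_of_ne h] using measurable_pi_apply r)

/-- The random effect of one instruction on the memory. -/
def Instr.step : Instr R → Kernel (R → ℝ) (R → ℝ)
  | .const d c => assign d (fun _ => c) measurable_const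
  | .add d a b => assign d (fun s => s a + s b) (by fun_prop)
  | .sub d a b => assign d (fun s => s a - s b) (by fun_prop)
  | .mul d a b => assign d (fun s => s a * s b) (by fun_prop)
  | .div d a b => assign d (fun s => s a / s b) (by fun_prop)
  | .sqrt d a => assign d (fun s => √(s a)) (by fun_prop)
  | .gauss d => (Kernel.id ×ₖ Kernel.const _ (gaussianReal 0 1)).map
      fun x : (R → ℝ) × ℝ => Function.update x.1 d x.2

/-- The random effect of a program: its instructions are executed from left to right. -/
def exec : List (Instr R) → Kernel (R → ℝ) (R → ℝ)
  | [] => Kernel.id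
  | i :: p => exec p ∘ₖ i.step

/-- The number of steps of a program. -/
def steps (p : List (Instr R)) : ℕ := p.length

end Semantics

/-! ### One iteration of the collapsed Gibbs sampler as a program -/

/-- The registers: the data, the parameters, for each level a residual sum and an observation
count, and finitely many scalars. -/
inductive Reg (N I₁ I₂ : ℕ) where
  | data (n : Fin N)
  | a₀
  | a₁ (i : Fin I₁)
  | a₂ (j : Fin I₂)
  | sum₁ (i : Fin I₁)
  | sum₂ (j : Fin I₂)
  | cnt₁ (i : Fin I₁)
  | cnt₂ (j : Fin I₂)
  | lik
  | fac
  | one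
  | prec
  | lin
  | u
  | v
  | z
  deriving DecidableEq

open Instr Reg in
/-- Program for the joint update of `a⁰` and the effects `a` of one factor (levels `lev`, prior
precision `τk`), given the effects `b` of the other factor (levels `lev'`). With `cᵢ` the number
of observations at level `i` and `sᵢ` the sum of their values of `y - b`, it draws `a⁰` from the
normal law with precision `τpr + ∑ᵢ cᵢ wᵢ` and mean `(τpr μpr + ∑ᵢ wᵢ sᵢ) / (τpr + ∑ᵢ cᵢ wᵢ)`,
where `wᵢ = τ τk / (τk + cᵢ τ)`, and then, independently over `i`, draws `aᵢ` from the normal law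
with precision `τk + cᵢ τ` and mean `τ (sᵢ - cᵢ a⁰) / (τk + cᵢ τ)`. -/
def blockProgram {I J : ℕ} (lev : Fin N → Fin I) (lev' : Fin N → Fin J)
    (a sum cnt : Fin I → Reg N I₁ I₂) (b : Fin J → Reg N I₁ I₂)
    (τ τk μpr τpr : ℝ) : List (Instr (Reg N I₁ I₂)) :=
  -- load the hyperparameters, reset the accumulators
  [const lik τ, const fac τk, const one 1, const prec τpr, const lin μpr, mul lin lin prec]
  ++ (List.finRange I).flatMap (fun i => [const (sum i) 0, const (cnt i) 0])
  -- one pass through the data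
  ++ (List.finRange N).flatMap (fun n =>
      [sub v (data n) (b (lev' n)),
       add (sum (lev n)) (sum (lev n)) v,
       add (cnt (lev n)) (cnt (lev n)) one])
  -- accumulate precision and linear coefficient of the global effect
  ++ (List.finRange I).flatMap (fun i =>
      [mul u (cnt i) lik, add u u fac, div u fac u, mul u u lik,
       mul v u (sum i), add lin lin v,
       mul v u (cnt i), add prec prec v])
  -- draw the global effect
  ++ [gauss z, sqrt u prec, div z z u, div v lin prec, add a₀ v z]
  -- draw the effects of the factor
  ++ (List.finRange I).flatMap (fun i =>
      [mul u (cnt i) lik, add u u fac,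
       mul v (cnt i) a₀, sub v (sum i) v, mul v v lik, div v v u,
       gauss z, sqrt u u, div z z u, add (a i) v z])

/-- Program for one iteration of the collapsed Gibbs sampler. -/
def Design.iteration (D : Design N I₁ I₂) (γ : Precisions) (μpr : ℝ) (τpr : ℝ≥0) :
    List (Instr (Reg N I₁ I₂)) :=
  blockProgram D.lev₁ D.lev₂ Reg.a₁ Reg.sum₁ Reg.cnt₁ Reg.a₂ γ.τ γ.τ₁ μpr τpr
  ++ blockProgram D.lev₂ D.lev₁ Reg.a₂ Reg.sum₂ Reg.cnt₂ Reg.a₁ γ.τ γ.τ₂ μpr τpr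

/-- Initial memory: data and current parameters, every other register zero. -/
def loadMem (y : Fin N → ℝ) (θ : Param I₁ I₂) : Reg N I₁ I₂ → ℝ
  | .data n => y n
  | .a₀ => θ.1
  | .a₁ i => θ.2.1 i
  | .a₂ j => θ.2.2 j
  | _ => 0

/-- The parameters held in memory. -/
def readParam (s : Reg N I₁ I₂ → ℝ) : Param I₁ I₂ :=
  (s .a₀, fun i => s (.a₁ i), fun j => s (.a₂ j))

/-- The law of the new parameters after running the program for one iteration from `θ`. -/
def Design.iterationLaw (D : Design N I₁ I₂) (γ : Precisions) (μpr : ℝ) (τpr : ℝ≥0)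
    (y : Fin N → ℝ) (θ : Param I₁ I₂) : Measure (Param I₁ I₂) :=
  (exec (D.iteration γ μpr τpr) (loadMem y θ)).map readParam

/-- Complexity of the collapsed Gibbs sampler: cost per iteration times relaxation time. -/
def Design.costGibbs (D : Design N I₁ I₂) (γ : Precisions) (μpr : ℝ) (τpr : ℝ≥0)
    (y : Fin N → ℝ) : ℝ≥0∞ :=
  (steps (D.iteration γ μpr τpr) : ℝ≥0∞) * D.Tcgs γ μpr τpr y

end CrossedEffects

end

open CrossedEffects

open MeasureTheory ProbabilityTheory
open scoped NNReal ENNReal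

noncomputable section

namespace CrossedEffects

set_option linter.unusedSectionVars false

/-! ### Alternating projections in a Hilbert space -/

section Hilbert

open scoped InnerProductSpace

/-! Run the collapsed sampler from two states with the same Gaussian noise. The noise cancels, and
the difference δ of the second factor's effects evolves by a deterministic linear map, explicit
under balanced levels (`Design.Balanced.iterate_sub`). Write K = avg₂ ∘ avg₁; balance makes K
symmetric and positive for the usual inner product. Let l be its norm on vectors of sum zero
(`Design.Balanced.exists_second_eigenvalue`). On centered δ the map is x₁x₂K, where xₖ is the
shrinkage factor of factor k. On constant δ it is multiplication by x₁x₂t₁t₂, where tₖ is the share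
of the prior in the conditional precision of a⁰, which is zero for the flat prior. The auxiliary
sampler acts through K itself, so its rate is l (`Design.Balanced.l2Rate_auxGibbs`).

The gap 1 - x₁x₂l is comparable to the largest of 1 - x₁, 1 - x₂ and 1 - l. Since 1 - xₖ is of order
Iₖ/N, its inverse is comparable to the minimum of `nbar` and `Taux`. The gap on constants is at
least of order 1/(1 + τpr), uniformly in the design, which accounts for the factor 1 + τpr in the
upper bound.

It remains to identify L² rates with these factors. From below, an eigenvector g of K gives the
statistic ∑ gⱼa²ⱼ, which the sampler maps to an affine image of itself with slope x₁x₂l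
(`le_l2Rate_of_affine`). From above, the coupling contracts at rate ρ, the larger of the two
factors, so Pᵗf converges at rate ρ for smooth compactly supported f, with a constant depending on
f. A two-block Gibbs sampler is a product of two orthogonal projections; for such products,
geometric decay on a dense set implies the same rate on all of L² (`norm_alternating_pow_le`,
`l2Rate_twoBlockGibbs_le`).

The explicit maps rest on Gaussian conjugacy, including the flat prior (`lintegral_block`), and on
an abstract characterization of conditional laws (`blockUpdate_ae_eq_noiseKernel`). The program is
shown to apply the same maps to independent normal draws. Conditional laws are determined only
almost everywhere, and invariance propagates these identifications along the chain. -/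

theorem le_of_forall_mul_pow_le {a k r C : ℝ} (ha : 0 < a) (hr : 0 ≤ r)
    (h : ∀ t : ℕ, a * k ^ t ≤ C * r ^ t) : k ≤ r := by
  by_contra! hk
  have hk0 : 0 < k := hr.trans_lt hk
  have hlim := (tendsto_pow_atTop_nhds_zero_of_lt_one (div_nonneg hr hk0.le)
    ((div_lt_one hk0).2 hk)).const_mul C
  rw [mul_zero] at hlim
  obtain ⟨t, ht⟩ := (hlim.eventually (gt_mem_nhds ha)).exists
  have hkt : 0 < k ^ t := pow_pos hk0 t
  rw [div_pow, ← mul_div_assoc, div_lt_iff₀ hkt] at ht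
  exact absurd (h t) (not_le.2 ht)

variable {H : Type*} [NormedAddCommGroup H] [InnerProductSpace ℝ H]

/-- For a symmetric operator, the geometric rate at which an orbit decays bounds the first step. -/
theorem norm_apply_le_of_norm_pow_le {A : H →L[ℝ] H} (hA : ∀ x y, ⟪A x, y⟫_ℝ = ⟪x, A y⟫_ℝ)
    {r C : ℝ} (hr : 0 ≤ r) {x : H} (h : ∀ t : ℕ, ‖(A ^ t) x‖ ≤ C * r ^ t) :
    ‖A x‖ ≤ r * ‖x‖ := by
  rcases eq_or_ne (A x) 0 with h0 | h0
  · rw [h0, norm_zero]; positivity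
  have hx : x ≠ 0 := fun hx => h0 (by rw [hx, map_zero])
  have hx' : 0 < ‖x‖ := norm_pos_iff.2 hx
  have hAx : 0 < ‖A x‖ := norm_pos_iff.2 h0
  set k := ‖A x‖ / ‖x‖ with hk
  have hk0 : 0 < k := div_pos hAx hx'
  -- Log-convexity of the norms along the orbit: symmetry moves one `A` across the inner product,
  -- then Cauchy–Schwarz. Successive ratios therefore never drop below the first one, `k`.
  have hconv : ∀ t : ℕ, ‖(A ^ (t + 1)) x‖ ^ 2 ≤ ‖(A ^ t) x‖ * ‖(A ^ (t + 2)) x‖ := by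
    intro t
    have h1 : (A ^ (t + 1)) x = A ((A ^ t) x) := by rw [pow_succ']; rfl
    have h2 : (A ^ (t + 2)) x = A ((A ^ (t + 1)) x) := by rw [pow_succ' A (t + 1)]; rfl
    rw [← real_inner_self_eq_norm_sq]
    nth_rewrite 1 [h1]
    rw [hA, ← h2]
    exact real_inner_le_norm _ _
  have hstep : ∀ t : ℕ, 0 < ‖(A ^ t) x‖ ∧ k * ‖(A ^ t) x‖ ≤ ‖(A ^ (t + 1)) x‖ := by
    intro t
    induction t with
    | zero =>
      refine ⟨by simpa using hx', ?_⟩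
      simp [hk, div_mul_cancel₀ _ hx'.ne']
    | succ t ih =>
      have hpos : 0 < ‖(A ^ (t + 1)) x‖ := lt_of_lt_of_le (mul_pos hk0 ih.1) ih.2
      refine ⟨hpos, ?_⟩
      have h1 := hconv t
      refine le_of_mul_le_mul_left ?_ ih.1
      calc ‖(A ^ t) x‖ * (k * ‖(A ^ (t + 1)) x‖)
          = (k * ‖(A ^ t) x‖) * ‖(A ^ (t + 1)) x‖ := by ring
        _ ≤ ‖(A ^ (t + 1)) x‖ * ‖(A ^ (t + 1)) x‖ := by gcongr; exact ih.2
        _ ≤ _ := by rw [← sq]; exact h1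
  have hpow : ∀ t : ℕ, ‖x‖ * k ^ t ≤ ‖(A ^ t) x‖ := by
    intro t
    induction t with
    | zero => simp
    | succ t ih =>
      calc ‖x‖ * k ^ (t + 1) = k * (‖x‖ * k ^ t) := by ring
        _ ≤ k * ‖(A ^ t) x‖ := by gcongr
        _ ≤ _ := (hstep t).2
  have := le_of_forall_mul_pow_le hx' hr fun t => (hpow t).trans (h t)
  rwa [hk, div_le_iff₀ hx'] at this

/-- If the alternating projections `(p q)ᵗ` contract at rate `r` on a dense set of vectors, then
they do so on every vector. -/
theorem norm_alternating_pow_le {p q : H →L[ℝ] H}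
    (hp : ∀ x y, ⟪p x, y⟫_ℝ = ⟪x, p y⟫_ℝ) (hq : ∀ x y, ⟪q x, y⟫_ℝ = ⟪x, q y⟫_ℝ)
    (hqq : ∀ x, q (q x) = q x) (hp1 : ∀ x, ‖p x‖ ≤ ‖x‖) (hq1 : ∀ x, ‖q x‖ ≤ ‖x‖)
    {e : H} (he : ⟪e, e⟫_ℝ = 1) (hpe : p e = e) (hqe : q e = e) {r : ℝ} (hr : 0 ≤ r)
    {D : Set H} (hD : Dense D)
    (hb : ∀ g ∈ D, ∃ C : ℝ, ∀ t : ℕ, ‖((p * q) ^ t) (g - ⟪e, g⟫_ℝ • e)‖ ≤ C * r ^ t)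
    (f : H) (t : ℕ) :
    ‖((p * q) ^ (t + 1)) (f - ⟪e, f⟫_ℝ • e)‖ ≤ r ^ t * ‖f - ⟪e, f⟫_ℝ • e‖ := by
  -- `p * q` is not symmetric, but `q * p * q` is, and its powers differ from those of `p * q` only
  -- by an outer `q`.
  set A : H →L[ℝ] H := q * p * q with hAdef
  have hAap : ∀ x, A x = q (p (q x)) := fun x => rfl
  have hA : ∀ x y, ⟪A x, y⟫_ℝ = ⟪x, A y⟫_ℝ := fun x y => by
    rw [hAap, hAap, hq, hp, hq]
  have hAe : A e = e := by rw [hAap, hqe, hpe, hqe]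
  have hAT : ∀ (t : ℕ) x, (A ^ (t + 1)) x = q (((p * q) ^ (t + 1)) x) := by
    intro t x
    induction t with
    | zero => simp [hAap]
    | succ t ih =>
      rw [pow_succ' A (t + 1), mul_apply_eq_comp, ih, hAap, hqq,
        pow_succ' (p * q) (t + 1)]
      rfl
  -- The one-step bound no longer contains the constant that depended on `g`, so it is a closed
  -- condition and passes from `D` to its closure.
  have hcontr : ∀ g : H, ‖A (g - ⟪e, g⟫_ℝ • e)‖ ≤ r * ‖g - ⟪e, g⟫_ℝ • e‖ := by
    intro g
    have hcl : IsClosed {g : H | ‖A (g - ⟪e, g⟫_ℝ • e)‖ ≤ r * ‖g - ⟪e, g⟫_ℝ • e‖} :=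
      isClosed_le (by fun_prop) (by fun_prop)
    refine hcl.closure_subset_iff.2 (fun g hg => ?_) (hD g)
    obtain ⟨C, hC⟩ := hb g hg
    refine norm_apply_le_of_norm_pow_le hA hr (C := C) fun t => ?_
    cases t with
    | zero => simpa using hC 0
    | succ t => rw [hAT]; exact (hq1 _).trans (hC _)
  have hcontr' : ∀ x : H, ⟪e, x⟫_ℝ = 0 → ‖A x‖ ≤ r * ‖x‖ := fun x hx => by
    simpa [hx] using hcontr x
  have hApow : ∀ (t : ℕ) (x : H), ⟪e, x⟫_ℝ = 0 →
      ⟪e, (A ^ t) x⟫_ℝ = 0 ∧ ‖(A ^ t) x‖ ≤ r ^ t * ‖x‖ := by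
    intro t x hx
    induction t with
    | zero => simpa using hx
    | succ t ih =>
      rw [pow_succ', mul_apply_eq_comp]
      refine ⟨by rw [← hA, hAe, ih.1], (hcontr' _ ih.1).trans ?_⟩
      rw [pow_succ', mul_assoc]
      gcongr
      exact ih.2
  set x := f - ⟪e, f⟫_ℝ • e with hxdef
  have hx : ⟪e, x⟫_ℝ = 0 := by rw [hxdef, inner_sub_right, inner_smul_right, he]; ring
  have hqx : ⟪e, q x⟫_ℝ = 0 := by rw [← hq, hqe, hx]
  -- Regrouping `t + 1` factors `p q` leaves an outer `p` and an inner `q` around `A ^ t`; hence the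
  -- exponent `t` in the bound.
  have hT : ∀ t : ℕ, ((p * q) ^ (t + 1)) x = p ((A ^ t) (q x)) := by
    intro t
    induction t with
    | zero => simp
    | succ t ih =>
      have hAt : q ((A ^ t) (q x)) = (A ^ t) (q x) := by
        cases t with
        | zero => simp [hqq]
        | succ t => rw [pow_succ' A t, mul_apply_eq_comp, hAap, hqq]
      rw [pow_succ' (p * q) (t + 1), mul_apply_eq_comp, ih,
        pow_succ' A t, mul_apply_eq_comp, mul_apply_eq_comp, hAap, hAt]
  rw [hT]
  calc ‖p ((A ^ t) (q x))‖ ≤ ‖(A ^ t) (q x)‖ := hp1 _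
    _ ≤ r ^ t * ‖q x‖ := (hApow t _ hqx).2
    _ ≤ _ := by gcongr; exact hq1 _

end Hilbert

/-! ### Kernels with an invariant measure -/

section Invariant

variable {Ω : Type*} [MeasurableSpace Ω] {π : Measure Ω}

/-- A chain started in its stationary law does not enter a null set at the next step. This is how
statements known only almost everywhere are carried along the chain. -/
theorem ae_ae_of_invariant {κ : Kernel Ω Ω} (h : κ.Invariant π) {p : Ω → Prop}
    (hp : ∀ᵐ x ∂π, p x) : ∀ᵐ x ∂π, ∀ᵐ z ∂(κ x), p z := by
  refine Measure.ae_ae_of_ae_comp (κ := κ) ?_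
  rwa [h.def]

theorem invariant_pow_zero {κ : Kernel Ω Ω} : (κ ^ 0).Invariant π :=
  Measure.id_comp

theorem invariant_pow {κ : Kernel Ω Ω} (h : κ.Invariant π) (t : ℕ) : (κ ^ t).Invariant π := by
  induction t with
  | zero => exact invariant_pow_zero
  | succ t ih =>
    rw [pow_succ]
    exact Kernel.Invariant.comp ih h

instance isMarkovKernel_pow (κ : Kernel Ω Ω) [IsMarkovKernel κ] (t : ℕ) :
    IsMarkovKernel (κ ^ t) := by
  induction t with
  | zero => exact inferInstanceAs (IsMarkovKernel Kernel.id)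
  | succ t ih =>
    rw [pow_succ]
    exact inferInstanceAs (IsMarkovKernel ((κ ^ t) ∘ₖ κ))

theorem invariant_congr {κ η : Kernel Ω Ω} (h : κ.Invariant π) (hκη : ∀ᵐ x ∂π, κ x = η x) :
    η.Invariant π := by
  have := Measure.comp_congr hκη
  rw [Kernel.Invariant, ← this]
  exact h

/-- Conditional distributions are unique only up to null sets; by invariance the chain avoids the
exceptional set at each step. -/
theorem pow_ae_eq {κ η : Kernel Ω Ω} (h : κ.Invariant π) (hκη : ∀ᵐ x ∂π, κ x = η x) (t : ℕ) :
    ∀ᵐ x ∂π, (κ ^ t) x = (η ^ t) x := by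
  induction t with
  | zero => simp
  | succ t ih =>
    filter_upwards [hκη, ae_ae_of_invariant h ih] with x hx hx'
    change ((κ ^ t) ∘ₖ κ) x = ((η ^ t) ∘ₖ η) x
    rw [Kernel.comp_apply, Kernel.comp_apply, ← hx]
    exact Measure.comp_congr hx'

theorem integrable_of_invariant {κ : Kernel Ω Ω} (h : κ.Invariant π) {f : Ω → ℝ}
    (hf : Integrable f π) : ∀ᵐ x ∂π, Integrable f (κ x) := by
  refine Measure.ae_integrable_of_integrable_comp (κ := κ) ?_
  rwa [h.def]

/-- As `f` is only a.e. strongly measurable, its integral against a Dirac mass need not equal its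
value at every point; passing to a measurable representative costs a null set. -/
theorem integral_pow_zero {κ : Kernel Ω Ω} {f : Ω → ℝ} (hf : AEStronglyMeasurable f π) :
    ∀ᵐ x ∂π, ∫ z, f z ∂((κ ^ 0) x) = f x := by
  have h := ae_ae_of_invariant (invariant_pow_zero (π := π) (κ := κ)) hf.ae_eq_mk
  filter_upwards [h, hf.ae_eq_mk] with x hx hx'
  rw [integral_congr_ae hx, hx']
  change ∫ z, hf.mk f z ∂(Kernel.id x) = _
  rw [Kernel.id_apply, integral_dirac' _ _ hf.stronglyMeasurable_mk]

theorem integral_pow_succ {κ : Kernel Ω Ω} (h : κ.Invariant π) {f : Ω → ℝ}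
    (hf : Integrable f π) (t : ℕ) :
    ∀ᵐ x ∂π, ∫ z, f z ∂((κ ^ (t + 1)) x) = ∫ w, ∫ z, f z ∂((κ ^ t) w) ∂(κ x) := by
  filter_upwards [integrable_of_invariant (invariant_pow h (t + 1)) hf] with x hx
  rw [pow_succ] at hx ⊢
  exact Kernel.integral_comp hx

theorem l2Rate_congr {κ η : Kernel Ω Ω} (h : κ.Invariant π) (hκη : ∀ᵐ x ∂π, κ x = η x) :
    l2Rate κ π = l2Rate η π := by
  have key : ∀ (f : Ω → ℝ) (t : ℕ),
      eLpNorm (fun x => (∫ z, f z ∂((κ ^ t) x)) - ∫ z, f z ∂π) 2 π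
        = eLpNorm (fun x => (∫ z, f z ∂((η ^ t) x)) - ∫ z, f z ∂π) 2 π := by
    intro f t
    refine eLpNorm_congr_ae ?_
    filter_upwards [pow_ae_eq h hκη t] with x hx
    rw [hx]
  simp only [l2Rate, key]

/-- A nonconstant function that the kernel maps to an affine image of itself with slope `m` bounds
the rate of convergence from below. -/
theorem le_l2Rate_of_affine [IsProbabilityMeasure π] {κ : Kernel Ω Ω} [IsMarkovKernel κ]
    (h : κ.Invariant π) {f : Ω → ℝ}
    (hf : MemLp f 2 π) {m : ℝ≥0} {c : ℝ} (hκ : ∀ᵐ x ∂π, ∫ z, f z ∂(κ x) = m * f x + c)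
    (hne : ¬ ∀ᵐ x ∂π, f x = ∫ z, f z ∂π) : (m : ℝ≥0∞) ≤ l2Rate κ π := by
  have hfInt : Integrable f π := hf.integrable (by norm_num)
  set M := ∫ z, f z ∂π with hM
  -- Stationarity determines the intercept, so `f - M` is an eigenfunction with eigenvalue `m`.
  have hmean : M = m * M + c := by
    have h1 : M = ∫ x, ∫ z, f z ∂(κ x) ∂π := by
      rw [hM]
      nth_rewrite 1 [← h.def]
      have := Kernel.integral_comp (κ := Kernel.const Unit π) (η := κ) (a := ()) (f := f)
        (by rw [← Measure.comp_eq_comp_const_apply, h.def]; exact hfInt)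
      rwa [← Measure.comp_eq_comp_const_apply, Kernel.const_apply] at this
    have h2 : ∫ x, ∫ z, f z ∂(κ x) ∂π = ∫ x, (m * f x + c) ∂π := integral_congr_ae hκ
    rw [integral_add (hfInt.const_mul _) (integrable_const _), integral_const_mul, ← h1] at h2
    simpa using h2
  have hpow : ∀ t : ℕ, ∀ᵐ x ∂π, ∫ z, f z ∂((κ ^ t) x) - M = (m : ℝ) ^ t * (f x - M) := by
    intro t
    induction t with
    | zero =>
      filter_upwards [integral_pow_zero hf.aestronglyMeasurable (κ := κ)] with x hx
      rw [hx, pow_zero, one_mul]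
    | succ t ih =>
      filter_upwards [hκ, integral_pow_succ h hfInt t, ae_ae_of_invariant h ih,
        integrable_of_invariant h hfInt] with x h1 h2 h3 h4
      have h5 : ∫ w, ∫ z, f z ∂((κ ^ t) w) ∂(κ x) = ∫ w, ((m : ℝ) ^ t * (f w - M) + M) ∂(κ x) := by
        refine integral_congr_ae ?_
        filter_upwards [h3] with w hw
        linarith
      have h6 : Integrable (fun w => f w - M) (κ x) := h4.sub (integrable_const _)
      rw [h2, h5, integral_add (h6.const_mul _) (integrable_const _),
        integral_const_mul, integral_sub h4 (integrable_const _), h1]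
      simp
      linear_combination (-(m : ℝ) ^ t) * hmean
  refine le_sInf fun r hr => ?_
  obtain ⟨C, hC⟩ := hr f hf
  rcases eq_or_ne r ∞ with rfl | hr'
  · exact le_top
  lift r to ℝ≥0 using hr'
  rw [ENNReal.coe_le_coe]
  have hfM : MemLp (fun x => f x - M) 2 π := hf.sub (memLp_const M)
  have hnorm : ∀ t : ℕ, eLpNorm (fun x => f x - M) 2 π * (m : ℝ≥0∞) ^ t ≤ C * (r : ℝ≥0∞) ^ t := by
    intro t
    refine le_trans (le_of_eq ?_) (hC t)
    rw [eLpNorm_congr_ae (hpow t)]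
    have := eLpNorm_const_smul ((m : ℝ) ^ t) (fun x => f x - M) 2 π
    simp only [Pi.smul_def, smul_eq_mul] at this
    rw [this, mul_comm]
    congr 1
    simp [enorm_pow]
  have hpos : 0 < (eLpNorm (fun x => f x - M) 2 π).toReal := by
    refine ENNReal.toReal_pos (fun h0 => hne ?_) hfM.eLpNorm_ne_top
    rw [eLpNorm_eq_zero_iff hfM.aestronglyMeasurable (by norm_num)] at h0
    filter_upwards [h0] with x hx
    simpa [sub_eq_zero] using hx
  refine le_of_forall_mul_pow_le (C := C) hpos r.2 fun t => ?_
  have := ENNReal.toReal_mono (by finiteness) (hnorm t)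
  simpa using this

end Invariant

/-! ### The two-block Gibbs sampler as a product of conditional expectations -/

section CondProj

variable {Ω β : Type*} [mΩ : MeasurableSpace Ω] [mβ : MeasurableSpace β] {π : Measure Ω}
  {X : Ω → β} {hX : Measurable X}

variable (π) in
/-- Conditional expectation given `X`, as an operator on `L²`. -/
def condProj (hX : Measurable X) : Lp ℝ 2 π →L[ℝ] Lp ℝ 2 π :=
  (lpMeas ℝ ℝ (mβ.comap X) 2 π).subtypeL ∘L condExpL2 ℝ ℝ hX.comap_le

theorem inner_condProj (f g : Lp ℝ 2 π) :
    inner ℝ (condProj π hX f) g = inner ℝ f (condProj π hX g) :=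
  inner_condExpL2_left_eq_right (𝕜 := ℝ) hX.comap_le

theorem norm_condProj_le (f : Lp ℝ 2 π) : ‖condProj π hX f‖ ≤ ‖f‖ :=
  norm_condExpL2_coe_le (𝕜 := ℝ) hX.comap_le f

theorem condProj_condProj (f : Lp ℝ 2 π) : condProj π hX (condProj π hX f) = condProj π hX f := by
  have : Fact (mβ.comap X ≤ mΩ) := ⟨hX.comap_le⟩
  exact congrArg Subtype.val (Submodule.orthogonalProjectionOnto_mem_subspace_eq_self
    (K := lpMeas ℝ ℝ (mβ.comap X) 2 π) (condExpL2 ℝ ℝ hX.comap_le f))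

end CondProj

section Gibbs

variable {Ω β β' : Type*} [mΩ : MeasurableSpace Ω] [StandardBorelSpace Ω] [Nonempty Ω]
    [mβ : MeasurableSpace β] [mβ' : MeasurableSpace β'] {π : Measure Ω} [IsFiniteMeasure π]
    {X : Ω → β} {hX : Measurable X} {Y : Ω → β'} {hY : Measurable Y}

instance : IsMarkovKernel (blockUpdate π X hX) := by unfold blockUpdate; infer_instance

instance : IsMarkovKernel (twoBlockGibbs π X hX Y hY) := by unfold twoBlockGibbs; infer_instance

/-- The law of `X` composed with the conditional distribution is the joint law of `X` and the state,
whose second marginal is `π`. -/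
theorem invariant_blockUpdate : (blockUpdate π X hX).Invariant π := by
  have h := compProd_map_condDistrib (mβ := mβ) (μ := π) (X := X) (Y := id) aemeasurable_id
  have h2 := congrArg Measure.snd h
  rw [Measure.snd_compProd, Measure.snd_map_prodMk hX, Measure.map_id] at h2
  rw [Kernel.Invariant, blockUpdate, ← Kernel.comp_deterministic_eq_comap, ← Measure.comp_assoc,
    Measure.deterministic_comp_eq_map, h2]

theorem invariant_twoBlockGibbs : (twoBlockGibbs π X hX Y hY).Invariant π :=
  invariant_blockUpdate.comp invariant_blockUpdate

theorem condProj_ae_eq (f : Lp ℝ 2 π) :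
    condProj π hX f =ᵐ[π] fun ω => ∫ z, f z ∂(blockUpdate π X hX ω) := by
  have h1 := (Lp.memLp f).condExpL2_ae_eq_condExp (𝕜 := ℝ) hX.comap_le
  rw [Lp.toLp_coeFn] at h1
  exact h1.trans (condExp_ae_eq_integral_condDistrib_id hX ((Lp.memLp f).integrable (by norm_num)))

/-- Kernels act on functions in the reverse order of their action on states: the update that retains
`Y` runs last, so its conditional expectation is applied first. -/
theorem twoBlockGibbs_pow_ae_eq {f : Ω → ℝ} (hf : MemLp f 2 π) (t : ℕ) :
    (fun x => ∫ z, f z ∂((twoBlockGibbs π X hX Y hY ^ t) x)) =ᵐ[π]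
      ((condProj π hX * condProj π hY) ^ t) (hf.toLp f) := by
  induction t with
  | zero =>
    filter_upwards [integral_pow_zero hf.aestronglyMeasurable
      (κ := twoBlockGibbs π X hX Y hY), hf.coeFn_toLp] with x hx hx'
    rw [hx, pow_zero]
    exact hx'.symm
  | succ t ih =>
    set G := ((condProj π hX * condProj π hY) ^ t) (hf.toLp f) with hG
    have hGint : Integrable G π := (Lp.memLp G).integrable (by norm_num)
    have hinv : (twoBlockGibbs π X hX Y hY).Invariant π := invariant_twoBlockGibbs
    have h1 := condProj_ae_eq (hX := hY) G
    have h2 := condProj_ae_eq (hX := hX) (condProj π hY G)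
    filter_upwards [integral_pow_succ hinv (hf.integrable (by norm_num)) t,
      ae_ae_of_invariant hinv ih, integrable_of_invariant hinv hGint, h2,
      ae_ae_of_invariant (invariant_blockUpdate (hX := hX)) h1] with x e1 e2 e3 e4 e5
    rw [e1, integral_congr_ae e2, pow_succ', mul_apply_eq_comp, ← hG]
    change _ = (condProj π hX (condProj π hY G)) x
    rw [e4, integral_congr_ae e5]
    exact Kernel.integral_comp e3

theorem condProj_const (c : ℝ) :
    condProj π hX ((memLp_const c).toLp fun _ => c) = (memLp_const c).toLp fun _ => c := by
  refine Lp.ext ?_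
  have h := (memLp_const c : MemLp (fun _ : Ω => c) 2 π).coeFn_toLp
  filter_upwards [condProj_ae_eq (hX := hX) ((memLp_const c : MemLp _ 2 π).toLp fun _ => c), h,
    ae_ae_of_invariant (invariant_blockUpdate (hX := hX)) h] with x h1 h2 h3
  rw [h1, integral_congr_ae h3, h2]
  simp

/-- The constants `C` may depend on `f` in an uncontrolled way, so density alone would not suffice;
the projection structure in `norm_alternating_pow_le` makes the rate uniform. Centering amounts to
removing the component along the constant function `e`. -/
theorem l2Rate_twoBlockGibbs_le [IsProbabilityMeasure π] {r : ℝ≥0} (hr : 0 < r) (D : Set (Ω → ℝ))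
    (hD : ∀ f ∈ D, MemLp f 2 π)
    (hdense : ∀ f : Ω → ℝ, MemLp f 2 π → ∀ ε : ℝ, 0 < ε →
      ∃ g ∈ D, eLpNorm (f - g) 2 π ≤ ENNReal.ofReal ε)
    (hb : ∀ f ∈ D, ∃ C : ℝ≥0, ∀ t : ℕ,
      eLpNorm (fun x => (∫ z, f z ∂((twoBlockGibbs π X hX Y hY ^ t) x)) - ∫ z, f z ∂π) 2 π
        ≤ C * (r : ℝ≥0∞) ^ t) :
    l2Rate (twoBlockGibbs π X hX Y hY) π ≤ r := by
  set e : Lp ℝ 2 π := (memLp_const 1).toLp fun _ => 1 with he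
  have hcoe : e =ᵐ[π] fun _ => 1 := (memLp_const 1 : MemLp (fun _ : Ω => (1 : ℝ)) 2 π).coeFn_toLp
  have hinner : ∀ F : Lp ℝ 2 π, inner ℝ e F = ∫ x, F x ∂π := by
    intro F
    rw [L2.inner_def]
    refine integral_congr_ae ?_
    filter_upwards [hcoe] with x hx
    rw [hx]; simp
  have hee : inner ℝ e e = 1 := by
    rw [hinner, integral_congr_ae hcoe]; simp
  set T : Lp ℝ 2 π →L[ℝ] Lp ℝ 2 π := condProj π hX * condProj π hY with hT
  have hTe : ∀ t : ℕ, (T ^ t) e = e := by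
    intro t
    induction t with
    | zero => rfl
    | succ t ih =>
      rw [pow_succ', mul_apply_eq_comp, ih, hT, mul_apply_eq_comp, he, condProj_const,
        condProj_const]
  have key : ∀ (f : Ω → ℝ) (hf : MemLp f 2 π) (t : ℕ),
      eLpNorm (fun x => (∫ z, f z ∂((twoBlockGibbs π X hX Y hY ^ t) x)) - ∫ z, f z ∂π) 2 π
        = ‖(T ^ t) (hf.toLp f - inner ℝ e (hf.toLp f) • e)‖ₑ := by
    intro f hf t
    rw [Lp.enorm_def]
    refine eLpNorm_congr_ae ?_
    rw [map_sub, map_smul, hTe, hinner, integral_congr_ae hf.coeFn_toLp]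
    filter_upwards [twoBlockGibbs_pow_ae_eq (hX := hX) (hY := hY) hf t,
      Lp.coeFn_sub ((T ^ t) (hf.toLp f)) ((∫ x, f x ∂π) • e),
      Lp.coeFn_smul (∫ x, f x ∂π) e, hcoe] with x h1 h2 h3 h4
    rw [h1, h2, Pi.sub_apply, h3, Pi.smul_apply, h4, smul_eq_mul, mul_one]
  have hdense' : Dense {F : Lp ℝ 2 π | ∃ g, ∃ hg : MemLp g 2 π, g ∈ D ∧ F = hg.toLp g} := by
    intro F
    refine (mem_closure_iff_nhds_basis Metric.nhds_basis_closedBall).2 fun ε hε => ?_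
    obtain ⟨g, hgD, hg⟩ := hdense F (Lp.memLp F) ε hε
    refine ⟨(hD g hgD).toLp g, ⟨g, hD g hgD, hgD, rfl⟩, ?_⟩
    rw [Metric.mem_closedBall, dist_comm, Lp.dist_def]
    refine ENNReal.toReal_le_of_le_ofReal hε.le (le_trans (le_of_eq ?_) hg)
    refine eLpNorm_congr_ae ?_
    filter_upwards [(hD g hgD).coeFn_toLp] with x hx
    simp [hx]
  have hmain := norm_alternating_pow_le (p := condProj π hX) (q := condProj π hY) (e := e)
    (r := r) inner_condProj inner_condProj condProj_condProj norm_condProj_le norm_condProj_le hee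
    (condProj_const 1) (condProj_const 1) r.2 hdense' (by
      rintro F ⟨g, hg, hgD, rfl⟩
      obtain ⟨C, hC⟩ := hb g hgD
      refine ⟨C, fun t => ?_⟩
      have h1 := hC t
      rw [key g hg t] at h1
      have h2 := ENNReal.toReal_mono (by finiteness) h1
      rw [ENNReal.toReal_mul, ENNReal.toReal_pow, toReal_enorm] at h2
      exact h2)
  refine sInf_le fun f hf => ?_
  set x := hf.toLp f - inner ℝ e (hf.toLp f) • e with hx
  -- The first summand covers `t = 0`; the second pays for the power of `r` lost in
  -- `norm_alternating_pow_le`, which is where `0 < r` is needed.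
  refine ⟨‖x‖₊ + ‖x‖₊ / r, fun t => ?_⟩
  rw [key f hf t, ← hx, enorm_eq_nnnorm]
  norm_cast
  rw [← NNReal.coe_le_coe]
  have hr' : (0 : ℝ) < r := hr
  cases t with
  | zero =>
    have : (0 : ℝ) ≤ ‖x‖ / r := by positivity
    simpa using this
  | succ t =>
    have h := hmain (hf.toLp f) t
    simp only [NNReal.coe_mul, NNReal.coe_add, NNReal.coe_div, NNReal.coe_pow, coe_nnnorm]
    refine h.trans ?_
    rw [← hx]
    have h3 : (‖x‖ + ‖x‖ / r) * (r : ℝ) ^ (t + 1) = r ^ t * ‖x‖ + ‖x‖ * r ^ (t + 1) := by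
      field_simp
      ring
    rw [h3]
    have : 0 ≤ ‖x‖ * (r : ℝ) ^ (t + 1) := by positivity
    linarith

end Gibbs

/-! ### Averaging operators of a design -/

section Averages

/-- In an orthonormal eigenbasis a positive operator has as norm its largest eigenvalue. The
alternative `l = 0` covers the zero-dimensional space, which has no eigenvector. -/
theorem exists_max_eigenvalue {E : Type*} [NormedAddCommGroup E] [InnerProductSpace ℝ E]
    [FiniteDimensional ℝ E] {T : E →ₗ[ℝ] E} (hT : T.IsSymmetric) (hpos : ∀ x, 0 ≤ inner ℝ (T x) x) :
    ∃ l : ℝ≥0, (∀ x, ‖T x‖ ≤ l * ‖x‖) ∧ (l = 0 ∨ ∃ x, x ≠ 0 ∧ T x = (l : ℝ) • x) := by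
  rcases subsingleton_or_nontrivial E with h | h
  · exact ⟨0, fun x => by simp [Subsingleton.elim (T x) 0], Or.inl rfl⟩
  set b := hT.eigenvectorBasis rfl with hb
  set ev := hT.eigenvalues rfl with hev
  have hTb : ∀ i, T (b i) = ev i • b i := fun i => hT.apply_eigenvectorBasis rfl i
  have hev0 : ∀ i, 0 ≤ ev i := fun i => by
    have := hpos (b i)
    rw [hTb, inner_smul_left] at this
    simpa [b.orthonormal.1 i] using this
  have : Nonempty (Fin (Module.finrank ℝ E)) := ⟨⟨0, Module.finrank_pos⟩⟩
  obtain ⟨k, -, hk⟩ := Finset.exists_max_image Finset.univ ev Finset.univ_nonempty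
  refine ⟨⟨ev k, hev0 k⟩, fun x => ?_, Or.inr ⟨b k, b.orthonormal.ne_zero k, hTb k⟩⟩
  refine le_of_sq_le_sq ?_ (by have := hev0 k; positivity)
  rw [mul_pow, ← b.sum_sq_norm_inner_right (T x), ← b.sum_sq_norm_inner_right x, Finset.mul_sum]
  refine Finset.sum_le_sum fun i _ => ?_
  rw [← hT, hTb, inner_smul_left, norm_mul, mul_pow]
  have h1 := hk i (Finset.mem_univ i)
  have h2 : ‖(starRingEnd ℝ) (ev i)‖ = ev i := by simp [abs_of_nonneg (hev0 i)]
  rw [h2]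
  gcongr
  · exact hev0 i
  · exact h1

variable {N I₁ I₂ : ℕ} (D : Design N I₁ I₂)

theorem Design.occ₁_eq_sum_cooc (i : Fin I₁) : D.occ₁ i = ∑ j, D.cooc i j := by
  simp only [Design.occ₁, Design.cooc]
  rw [Finset.sum_comm]
  refine Finset.sum_congr rfl fun n _ => ?_
  by_cases h : D.lev₁ n = i <;> simp [h]

theorem Design.occ₂_eq_sum_cooc (j : Fin I₂) : D.occ₂ j = ∑ i, D.cooc i j := by
  simp only [Design.occ₂, Design.cooc]
  rw [Finset.sum_comm]
  refine Finset.sum_congr rfl fun n _ => ?_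
  by_cases h : D.lev₂ n = j <;> simp [h]

theorem Design.sum_occ₁ : ∑ i, D.occ₁ i = N := by
  simp only [Design.occ₁]
  rw [Finset.sum_comm]
  simp

/-- Average over the observations at each level of the first factor of a function of the level of
the second factor. -/
def Design.avg₁ : (Fin I₂ → ℝ) →ₗ[ℝ] (Fin I₁ → ℝ) where
  toFun g i := (∑ j, (D.cooc i j : ℝ) * g j) / D.occ₁ i
  map_add' f g := by
    ext i; simp only [Pi.add_apply, mul_add, Finset.sum_add_distrib, add_div]
  map_smul' c g := by
    ext i
    simp only [Pi.smul_apply, smul_eq_mul, RingHom.id_apply, mul_left_comm _ c, ← Finset.mul_sum,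
      mul_div_assoc]

/-- Average over the observations at each level of the second factor of a function of the level of
the first factor. -/
def Design.avg₂ : (Fin I₁ → ℝ) →ₗ[ℝ] (Fin I₂ → ℝ) where
  toFun h j := (∑ i, (D.cooc i j : ℝ) * h i) / D.occ₂ j
  map_add' f g := by
    ext i; simp only [Pi.add_apply, mul_add, Finset.sum_add_distrib, add_div]
  map_smul' c g := by
    ext i
    simp only [Pi.smul_apply, smul_eq_mul, RingHom.id_apply, mul_left_comm _ c, ← Finset.mul_sum,
      mul_div_assoc]

theorem Design.avg₁_apply (g : Fin I₂ → ℝ) (i : Fin I₁) :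
    D.avg₁ g i = (∑ j, (D.cooc i j : ℝ) * g j) / D.occ₁ i := rfl

theorem Design.avg₂_apply (h : Fin I₁ → ℝ) (j : Fin I₂) :
    D.avg₂ h j = (∑ i, (D.cooc i j : ℝ) * h i) / D.occ₂ j := rfl

variable {D} [NeZero N] [NeZero I₁] [NeZero I₂]

theorem Design.Balanced.occ₁_pos (hB : D.Balanced) (i : Fin I₁) : 0 < (D.occ₁ i : ℝ) := by
  rw [hB.1 i]
  have := NeZero.pos N
  have := NeZero.pos I₁
  positivity

theorem Design.Balanced.occ₂_pos (hB : D.Balanced) (j : Fin I₂) : 0 < (D.occ₂ j : ℝ) := by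
  rw [hB.2 j]
  have := NeZero.pos N
  have := NeZero.pos I₂
  positivity

theorem Design.Balanced.avg₁_const (hB : D.Balanced) (c : ℝ) : D.avg₁ (fun _ => c) = fun _ => c := by
  ext i
  rw [avg₁_apply, ← Finset.sum_mul, ← Nat.cast_sum, ← occ₁_eq_sum_cooc,
    mul_div_cancel_left₀ _ (hB.occ₁_pos i).ne']

theorem Design.Balanced.avg₂_const (hB : D.Balanced) (c : ℝ) : D.avg₂ (fun _ => c) = fun _ => c := by
  ext i
  rw [avg₂_apply, ← Finset.sum_mul, ← Nat.cast_sum, ← occ₂_eq_sum_cooc,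
    mul_div_cancel_left₀ _ (hB.occ₂_pos i).ne']

/-- Balance makes the denominators constant, so the two averaging operators are adjoint for
unweighted sums up to the scalars `N / I₁` and `N / I₂`. The same double sum appears in
`sum_mul_avg₂`. -/
theorem Design.Balanced.sum_mul_avg₁ (hB : D.Balanced) (g : Fin I₂ → ℝ) (h : Fin I₁ → ℝ) :
    (N : ℝ) / I₁ * ∑ i, h i * D.avg₁ g i = ∑ i, ∑ j, D.cooc i j * h i * g j := by
  rw [Finset.mul_sum]
  refine Finset.sum_congr rfl fun i _ => ?_
  have h1 := (hB.occ₁_pos i).ne'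
  rw [avg₁_apply, ← hB.1 i]
  field_simp
  rw [Finset.mul_sum]
  refine Finset.sum_congr rfl fun j _ => by ring

theorem Design.Balanced.sum_mul_avg₂ (hB : D.Balanced) (g : Fin I₂ → ℝ) (h : Fin I₁ → ℝ) :
    (N : ℝ) / I₂ * ∑ j, g j * D.avg₂ h j = ∑ i, ∑ j, D.cooc i j * h i * g j := by
  rw [Finset.mul_sum, Finset.sum_comm]
  refine Finset.sum_congr rfl fun j _ => ?_
  have h1 := (hB.occ₂_pos j).ne'
  rw [avg₂_apply, ← hB.2 j]
  field_simp
  rw [Finset.mul_sum]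
  refine Finset.sum_congr rfl fun i _ => by ring

theorem Design.Balanced.sum_avg₁ (hB : D.Balanced) (g : Fin I₂ → ℝ) :
    (∑ i, D.avg₁ g i) / I₁ = (∑ j, g j) / I₂ := by
  have h1 := hB.sum_mul_avg₁ g fun _ => 1
  have h2 := hB.sum_mul_avg₂ g fun _ => 1
  rw [hB.avg₂_const] at h2
  simp only [one_mul, mul_one] at h1 h2
  have hN : (N : ℝ) ≠ 0 := Nat.cast_ne_zero.2 (NeZero.ne N)
  have := h1.trans h2.symm
  rw [div_mul_eq_mul_div, div_mul_eq_mul_div, mul_div_assoc, mul_div_assoc] at this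
  exact mul_left_cancel₀ hN this

theorem Design.Balanced.sum_avg₂ (hB : D.Balanced) (h : Fin I₁ → ℝ) :
    (∑ j, D.avg₂ h j) / I₂ = (∑ i, h i) / I₁ := by
  have h1 := hB.sum_mul_avg₁ (fun _ => 1) h
  have h2 := hB.sum_mul_avg₂ (fun _ => 1) h
  rw [hB.avg₁_const] at h1
  simp only [one_mul, mul_one] at h1 h2
  have hN : (N : ℝ) ≠ 0 := Nat.cast_ne_zero.2 (NeZero.ne N)
  have := h2.trans h1.symm
  rw [div_mul_eq_mul_div, div_mul_eq_mul_div, mul_div_assoc, mul_div_assoc] at this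
  exact mul_left_cancel₀ hN this

theorem Design.Balanced.sum_avg_avg (hB : D.Balanced) (g : Fin I₂ → ℝ) :
    ∑ j, D.avg₂ (D.avg₁ g) j = ∑ j, g j := by
  have h := (hB.sum_avg₂ (D.avg₁ g)).trans (hB.sum_avg₁ g)
  have hI : (I₂ : ℝ) ≠ 0 := Nat.cast_ne_zero.2 (NeZero.ne I₂)
  exact (div_left_inj' hI).1 h

/-- Up to scaling, the alternating average is the product of `avg₁` with its adjoint; its symmetry
and positivity follow. -/
theorem Design.Balanced.sum_avg_avg_mul (hB : D.Balanced) (f g : Fin I₂ → ℝ) :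
    (N : ℝ) / I₂ * ∑ j, f j * D.avg₂ (D.avg₁ g) j
      = (N : ℝ) / I₁ * ∑ i, D.avg₁ f i * D.avg₁ g i := by
  rw [hB.sum_mul_avg₂ f, ← hB.sum_mul_avg₁ f]
  simp only [mul_comm]

theorem Design.Balanced.abs_avg₁_le (hB : D.Balanced) {g : Fin I₂ → ℝ} {c : ℝ} (hg : ∀ j, |g j| ≤ c) (i : Fin I₁) :
    |D.avg₁ g i| ≤ c := by
  rw [avg₁_apply, abs_div, abs_of_pos (hB.occ₁_pos i), div_le_iff₀ (hB.occ₁_pos i)]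
  refine (Finset.abs_sum_le_sum_abs _ _).trans ?_
  rw [occ₁_eq_sum_cooc, Nat.cast_sum, Finset.mul_sum]
  refine Finset.sum_le_sum fun j _ => ?_
  rw [abs_mul, Nat.abs_cast, mul_comm]
  gcongr
  exact hg j

theorem Design.Balanced.abs_avg₂_le (hB : D.Balanced) {h : Fin I₁ → ℝ} {c : ℝ} (hh : ∀ i, |h i| ≤ c) (j : Fin I₂) :
    |D.avg₂ h j| ≤ c := by
  rw [avg₂_apply, abs_div, abs_of_pos (hB.occ₂_pos j), div_le_iff₀ (hB.occ₂_pos j)]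
  refine (Finset.abs_sum_le_sum_abs _ _).trans ?_
  rw [occ₂_eq_sum_cooc, Nat.cast_sum, Finset.mul_sum]
  refine Finset.sum_le_sum fun i _ => ?_
  rw [abs_mul, Nat.abs_cast, mul_comm]
  gcongr
  exact hh i

/-- The second largest eigenvalue `l` of the alternating averages. -/
theorem Design.Balanced.exists_second_eigenvalue (hB : D.Balanced) : ∃ l : ℝ≥0, l ≤ 1 ∧
    (∀ g : Fin I₂ → ℝ, ∑ j, g j = 0 →
      ∑ j, D.avg₂ (D.avg₁ g) j ^ 2 ≤ (l : ℝ) ^ 2 * ∑ j, g j ^ 2) ∧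
    (l = 0 ∨ ∃ g : Fin I₂ → ℝ, g ≠ 0 ∧ ∑ j, g j = 0 ∧ D.avg₂ (D.avg₁ g) = (l : ℝ) • g) := by
  have hI : (I₂ : ℝ) ≠ 0 := Nat.cast_ne_zero.2 (NeZero.ne I₂)
  have hN : (0 : ℝ) < N := Nat.cast_pos.2 (NeZero.pos N)
  have hI1 : (0 : ℝ) < I₁ := Nat.cast_pos.2 (NeZero.pos I₁)
  have hI2 : (0 : ℝ) < I₂ := Nat.cast_pos.2 (NeZero.pos I₂)
  -- Constants are fixed by the alternating averages. Subtracting the mean sends them to zero and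
  -- leaves vectors of sum zero unaffected, so the top eigenvalue of the difference is the second
  -- one sought.
  let mean : (Fin I₂ → ℝ) →ₗ[ℝ] (Fin I₂ → ℝ) :=
    { toFun := fun g _ => (∑ j, g j) / I₂
      map_add' := fun f g => by ext; simp [Finset.sum_add_distrib, add_div]
      map_smul' := fun c g => by ext; simp [← Finset.mul_sum, mul_div_assoc] }
  let K : (Fin I₂ → ℝ) →ₗ[ℝ] (Fin I₂ → ℝ) := D.avg₂ ∘ₗ D.avg₁ - mean
  have hK : ∀ g j, K g j = D.avg₂ (D.avg₁ g) j - (∑ j, g j) / I₂ := fun g j => rfl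
  let e := WithLp.linearEquiv 2 ℝ (Fin I₂ → ℝ)
  let T : EuclideanSpace ℝ (Fin I₂) →ₗ[ℝ] EuclideanSpace ℝ (Fin I₂) :=
    e.symm.toLinearMap ∘ₗ K ∘ₗ e.toLinearMap
  have hT : ∀ x j, T x j = K (fun j => x j) j := fun x j => rfl
  have hin : ∀ x y : EuclideanSpace ℝ (Fin I₂), inner ℝ (T x) y
      = (I₂ : ℝ) / N * ((N : ℝ) / I₁ * ∑ i, D.avg₁ (fun j => x j) i * D.avg₁ (fun j => y j) i)
        - (∑ j, x j) * (∑ j, y j) / I₂ := by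
    intro x y
    have h1 := hB.sum_avg_avg_mul (fun j => y j) (fun j => x j)
    have h2 : ∑ j, y j * D.avg₂ (D.avg₁ fun j => x j) j
        = (I₂ : ℝ) / N * ((N : ℝ) / I₁ * ∑ i, D.avg₁ (fun j => x j) i * D.avg₁ (fun j => y j) i) := by
      simp only [mul_comm (D.avg₁ (fun j => x j) _)]
      rw [← h1]
      field_simp
    rw [← h2, PiLp.inner_apply]
    simp only [hT, hK, RCLike.inner_apply, conj_trivial, mul_sub, Finset.sum_sub_distrib]
    congr 1
    rw [← Finset.sum_mul]; ring
  obtain ⟨l, hl, hl'⟩ := exists_max_eigenvalue (T := T)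
    (fun x y => by
      rw [real_inner_comm (T y) x, hin, hin]
      simp only [mul_comm])
    -- Positivity survives the subtraction: `avg₁` preserves means, and the squared mean is at most
    -- the mean square.
    (fun x => by
      rw [hin, sub_nonneg]
      have h1 := hB.sum_avg₁ fun j => x j
      have h2 : (∑ i, D.avg₁ (fun j => x j) i) ^ 2
          ≤ I₁ * ∑ i, D.avg₁ (fun j => x j) i * D.avg₁ (fun j => x j) i := by
        have := sq_sum_le_card_mul_sum_sq (s := Finset.univ) (f := D.avg₁ (fun j => x j))
        simpa only [sq, Finset.card_univ, Fintype.card_fin] using this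
      have h3 : (∑ j, x j) * (∑ j, x j) / I₂ = I₂ * ((∑ j, x j) / I₂) ^ 2 := by
        field_simp
      rw [h3, ← h1, div_pow]
      calc (I₂ : ℝ) * ((∑ i, D.avg₁ (fun j => x j) i) ^ 2 / (I₁ : ℝ) ^ 2)
          ≤ I₂ * ((I₁ * ∑ i, D.avg₁ (fun j => x j) i * D.avg₁ (fun j => x j) i) / (I₁ : ℝ) ^ 2) := by
            gcongr
        _ = _ := by field_simp)
  have heig : l = 0 ∨ ∃ g : Fin I₂ → ℝ, g ≠ 0 ∧ ∑ j, g j = 0 ∧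
      D.avg₂ (D.avg₁ g) = (l : ℝ) • g := by
    rcases eq_or_ne l 0 with h0 | h0
    · exact Or.inl h0
    obtain ⟨x, hx, hTx⟩ := hl'.resolve_left h0
    have hj : ∀ j, D.avg₂ (D.avg₁ fun j => x j) j - (∑ j, x j) / I₂ = l * x j := fun j => by
      rw [← hK, ← hT, hTx]; rfl
    -- Summing the eigenvalue equation makes its left side vanish, since the averages preserve sums;
    -- as `l ≠ 0`, the sum of `x` is zero.
    have hsum : ∑ j, x j = 0 := by
      have h1 := Finset.sum_congr rfl fun j (_ : j ∈ Finset.univ) => hj j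
      rw [Finset.sum_sub_distrib, hB.sum_avg_avg, ← Finset.mul_sum, Finset.sum_const,
        Finset.card_univ, Fintype.card_fin, nsmul_eq_mul, mul_div_cancel₀ _ hI, sub_self] at h1
      exact (mul_eq_zero.1 h1.symm).resolve_left (NNReal.coe_ne_zero.2 h0)
    refine Or.inr ⟨fun j => x j, fun h => hx ?_, hsum, ?_⟩
    · ext j; exact congrFun h j
    · ext j
      have := hj j
      rw [hsum, zero_div, sub_zero] at this
      exact this
  refine ⟨l, ?_, fun g hg => ?_, heig⟩
  · rcases heig with h0 | ⟨g, hg, -, hKg⟩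
    · rw [h0]; exact zero_le_one
    -- Averages contract the supremum norm; evaluating the eigenvalue equation where `|g|` is
    -- largest bounds the eigenvalue by one.
    obtain ⟨k, -, hk⟩ := Finset.exists_max_image Finset.univ (fun j => |g j|)
      ⟨⟨0, NeZero.pos I₂⟩, Finset.mem_univ _⟩
    have hk0 : 0 < |g k| := by
      obtain ⟨j, hj⟩ := Function.ne_iff.1 hg
      exact (abs_pos.2 hj).trans_le (hk j (Finset.mem_univ j))
    have h1 : |D.avg₂ (D.avg₁ g) k| ≤ |g k| :=
      hB.abs_avg₂_le (fun i => hB.abs_avg₁_le (fun j => hk j (Finset.mem_univ j)) i) k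
    rw [hKg, Pi.smul_apply, smul_eq_mul, abs_mul, NNReal.abs_eq] at h1
    exact_mod_cast le_of_mul_le_mul_right (h1.trans_eq (one_mul _).symm) hk0
  · have h1 := pow_le_pow_left₀ (norm_nonneg _) (hl (WithLp.toLp 2 g)) 2
    rw [mul_pow, EuclideanSpace.real_norm_sq_eq, EuclideanSpace.real_norm_sq_eq] at h1
    have h2 : ∀ j, T (WithLp.toLp 2 g) j = D.avg₂ (D.avg₁ g) j := fun j => by
      rw [hT, hK]; simp [hg]
    simpa only [h2] using h1

end Averages

/-! ### The auxiliary sampler -/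

section Aux

/-- On atoms of the conditioning variable the conditional law is elementary conditioning. In a
balanced design every level has positive mass, so the auxiliary updates are known at every state. -/
theorem condDistrib_id_of_ne_zero {Ω β : Type*} [MeasurableSpace Ω] [StandardBorelSpace Ω]
    [Nonempty Ω] [MeasurableSpace β] [MeasurableSingletonClass β] {π : Measure Ω}
    [IsFiniteMeasure π] {X : Ω → β} (hX : Measurable X) {b : β} (hb : π (X ⁻¹' {b}) ≠ 0) :
    condDistrib id X π b = π[|X ⁻¹' {b}] := by
  ext s hs
  have hm := measurableSet_singleton b
  rw [condDistrib_apply_of_ne_zero measurable_id b (by rwa [Measure.map_apply hX hm]),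
    cond_apply (hX hm), Measure.map_apply hX hm,
    Measure.map_apply (hX.prodMk measurable_id) (hm.prod hs)]
  rfl

variable {N I₁ I₂ : ℕ} {D : Design N I₁ I₂}

theorem Design.sum_cooc (D : Design N I₁ I₂) :
    ∑ x : Fin I₁ × Fin I₂, D.cooc x.1 x.2 = N := by
  rw [Fintype.sum_prod_type]
  simp only [← occ₁_eq_sum_cooc, sum_occ₁]

theorem Design.auxTarget_singleton (x : Fin I₁ × Fin I₂) :
    D.auxTarget {x} = (N : ℝ≥0∞)⁻¹ * D.cooc x.1 x.2 := by
  rw [Design.auxTarget, cond_apply MeasurableSet.univ, Set.univ_inter,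
    withDensity_apply _ MeasurableSet.univ, withDensity_apply _ (measurableSet_singleton x),
    Measure.restrict_univ, Measure.restrict_singleton, lintegral_smul_measure, lintegral_dirac,
    lintegral_fintype]
  simp only [Measure.count_singleton, mul_one, smul_eq_mul, one_mul, ← Nat.cast_sum, sum_cooc]

variable [NeZero N]

instance : IsProbabilityMeasure D.auxTarget := by
  refine cond_isProbabilityMeasure_of_finite ?_ ?_
  · rw [withDensity_apply _ MeasurableSet.univ, Measure.restrict_univ, lintegral_fintype]
    simp only [Measure.count_singleton, mul_one, ← Nat.cast_sum, Design.sum_cooc]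
    exact Nat.cast_ne_zero.2 (NeZero.ne N)
  · rw [withDensity_apply _ MeasurableSet.univ, Measure.restrict_univ, lintegral_fintype]
    simp only [Measure.count_singleton, mul_one, ← Nat.cast_sum, Design.sum_cooc]
    exact ENNReal.natCast_ne_top N

theorem Design.integral_auxTarget (f : Fin I₁ × Fin I₂ → ℝ) :
    ∫ x, f x ∂D.auxTarget = (∑ x, D.cooc x.1 x.2 * f x) / N := by
  rw [integral_fintype Integrable.of_finite, Finset.sum_div]
  refine Finset.sum_congr rfl fun x _ => ?_
  rw [measureReal_def, auxTarget_singleton]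
  simp
  ring

variable [NeZero I₁] [NeZero I₂]

theorem Design.Balanced.integral_blockUpdate_snd (hB : D.Balanced) (f : Fin I₁ × Fin I₂ → ℝ)
    (x : Fin I₁ × Fin I₂) :
    ∫ z, f z ∂(blockUpdate D.auxTarget Prod.snd measurable_snd x)
      = D.avg₂ (fun i => f (i, x.2)) x.2 := by
  have hN : (0 : ℝ) < N := Nat.cast_pos.2 (NeZero.pos N)
  have hset : D.auxTarget.real (Prod.snd ⁻¹' {x.2}) = (D.occ₂ x.2 : ℝ) / N := by
    have h := D.integral_auxTarget (Set.indicator (Prod.snd ⁻¹' {x.2}) 1)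
    rw [integral_indicator_one (measurable_snd (measurableSet_singleton _))] at h
    rw [h, occ₂_eq_sum_cooc, Fintype.sum_prod_type]
    classical simp [Set.indicator_apply]
  have hne : D.auxTarget (Prod.snd ⁻¹' {x.2}) ≠ 0 := by
    intro h0
    rw [measureReal_def, h0, ENNReal.toReal_zero] at hset
    exact (div_pos (hB.occ₂_pos x.2) hN).ne hset
  have hfInt : ∫ z in Prod.snd ⁻¹' {x.2}, f z ∂D.auxTarget
      = (∑ i, D.cooc i x.2 * f (i, x.2)) / N := by
    rw [← integral_indicator (measurable_snd (measurableSet_singleton _)), integral_auxTarget,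
      Fintype.sum_prod_type]
    classical simp [Set.indicator_apply]
  rw [blockUpdate, Kernel.comap_apply, condDistrib_id_of_ne_zero measurable_snd hne, ProbabilityTheory.cond,
    integral_smul_measure, hfInt, ENNReal.toReal_inv, ← measureReal_def, hset, avg₂_apply]
  have := (hB.occ₂_pos x.2).ne'
  rw [smul_eq_mul]
  field_simp

theorem Design.Balanced.integral_blockUpdate_fst (hB : D.Balanced) (f : Fin I₁ × Fin I₂ → ℝ)
    (x : Fin I₁ × Fin I₂) :
    ∫ z, f z ∂(blockUpdate D.auxTarget Prod.fst measurable_fst x)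
      = D.avg₁ (fun j => f (x.1, j)) x.1 := by
  have hN : (0 : ℝ) < N := Nat.cast_pos.2 (NeZero.pos N)
  have hset : D.auxTarget.real (Prod.fst ⁻¹' {x.1}) = (D.occ₁ x.1 : ℝ) / N := by
    have h := D.integral_auxTarget (Set.indicator (Prod.fst ⁻¹' {x.1}) 1)
    rw [integral_indicator_one (measurable_fst (measurableSet_singleton _))] at h
    rw [h, occ₁_eq_sum_cooc, Fintype.sum_prod_type_right]
    classical simp [Set.indicator_apply]
  have hne : D.auxTarget (Prod.fst ⁻¹' {x.1}) ≠ 0 := by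
    intro h0
    rw [measureReal_def, h0, ENNReal.toReal_zero] at hset
    exact (div_pos (hB.occ₁_pos x.1) hN).ne hset
  have hfInt : ∫ z in Prod.fst ⁻¹' {x.1}, f z ∂D.auxTarget
      = (∑ j, D.cooc x.1 j * f (x.1, j)) / N := by
    rw [← integral_indicator (measurable_fst (measurableSet_singleton _)), integral_auxTarget,
      Fintype.sum_prod_type_right]
    classical simp [Set.indicator_apply]
  rw [blockUpdate, Kernel.comap_apply, condDistrib_id_of_ne_zero measurable_fst hne, ProbabilityTheory.cond,
    integral_smul_measure, hfInt, ENNReal.toReal_inv, ← measureReal_def, hset, avg₁_apply]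
  have := (hB.occ₁_pos x.1).ne'
  rw [smul_eq_mul]
  field_simp

theorem Design.Balanced.integral_auxGibbs (hB : D.Balanced) (f : Fin I₁ × Fin I₂ → ℝ)
    (x : Fin I₁ × Fin I₂) :
    ∫ z, f z ∂(D.auxGibbs x) = D.avg₂ (fun i => D.avg₁ (fun j => f (i, j)) i) x.2 := by
  rw [auxGibbs, twoBlockGibbs, Kernel.integral_comp Integrable.of_finite]
  simp only [hB.integral_blockUpdate_fst, hB.integral_blockUpdate_snd]

instance : IsMarkovKernel D.auxGibbs := by unfold Design.auxGibbs; infer_instance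

/-- One iteration already yields a function of the second component alone, on which further
iterations act by alternating averages; hence `t` powers for `t + 1` iterations. -/
theorem Design.Balanced.integral_auxGibbs_pow (hB : D.Balanced) (f : Fin I₁ × Fin I₂ → ℝ)
    (t : ℕ) (x : Fin I₁ × Fin I₂) :
    ∫ z, f z ∂((D.auxGibbs ^ (t + 1)) x)
      = ((D.avg₂ ∘ₗ D.avg₁) ^ t) (D.avg₂ fun i => D.avg₁ (fun j => f (i, j)) i) x.2 := by
  induction t generalizing x with
  | zero => rw [zero_add, pow_one, pow_zero, hB.integral_auxGibbs]; rfl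
  | succ t ih =>
    have h : D.auxGibbs ^ (t + 1 + 1) = (D.auxGibbs ^ (t + 1)) ∘ₖ D.auxGibbs := pow_succ _ _
    rw [h, Kernel.integral_comp Integrable.of_finite]
    simp only [ih, hB.integral_auxGibbs]
    rw [pow_succ']
    rfl

/-- The rate of convergence of the auxiliary sampler is the second largest eigenvalue of the
alternating averages. -/
theorem Design.Balanced.l2Rate_auxGibbs (hB : D.Balanced) {l : ℝ≥0}
    (hl : ∀ g : Fin I₂ → ℝ, ∑ j, g j = 0 →
      ∑ j, D.avg₂ (D.avg₁ g) j ^ 2 ≤ (l : ℝ) ^ 2 * ∑ j, g j ^ 2)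
    (hl' : l = 0 ∨ ∃ g : Fin I₂ → ℝ, g ≠ 0 ∧ ∑ j, g j = 0 ∧ D.avg₂ (D.avg₁ g) = (l : ℝ) • g) :
    l2Rate D.auxGibbs D.auxTarget = l := by
  have hN : (0 : ℝ) < N := Nat.cast_pos.2 (NeZero.pos N)
  have hI2 : (0 : ℝ) < I₂ := Nat.cast_pos.2 (NeZero.pos I₂)
  refine le_antisymm ?_ ?_
  · refine ENNReal.le_of_forall_pos_le_add fun ε hε _ => ?_
    rw [← ENNReal.coe_add]
    -- The slack keeps `r` positive even when `l = 0`: the decay `l ^ t` after `t + 1` steps is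
    -- converted to `r ^ (t + 1)` through division by `r`.
    set r : ℝ≥0 := l + ε with hr
    have hr0 : (0 : ℝ) < r := by rw [hr]; push_cast; positivity
    refine sInf_le fun f hf => ?_
    set h := D.avg₂ fun i => D.avg₁ (fun j => f (i, j)) i with hh
    set M := ∫ z, f z ∂D.auxTarget with hM
    have hmean : ∑ j, (h j - M) = 0 := by
      have h1 := hB.sum_mul_avg₂ (fun _ => 1) fun i => D.avg₁ (fun j => f (i, j)) i
      have h2 : ∑ i, ∑ j, (D.cooc i j : ℝ) * D.avg₁ (fun j => f (i, j)) i * 1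
          = ∑ x : Fin I₁ × Fin I₂, D.cooc x.1 x.2 * f x := by
        rw [Fintype.sum_prod_type]
        refine Finset.sum_congr rfl fun i _ => ?_
        simp only [mul_one]
        rw [← Finset.sum_mul, ← Nat.cast_sum, ← occ₁_eq_sum_cooc, avg₁_apply,
          mul_div_cancel₀ _ (hB.occ₁_pos i).ne']
      rw [h2] at h1
      simp only [one_mul, ← hh] at h1
      rw [Finset.sum_sub_distrib, hM, integral_auxTarget, ← h1]
      simp
      field_simp
      ring
    have hpow : ∀ t : ℕ, ∑ j, (((D.avg₂ ∘ₗ D.avg₁) ^ t) (fun j => h j - M)) j = 0 ∧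
        ∑ j, (((D.avg₂ ∘ₗ D.avg₁) ^ t) (fun j => h j - M)) j ^ 2
          ≤ ((l : ℝ) ^ t) ^ 2 * ∑ j, (h j - M) ^ 2 := by
      intro t
      induction t with
      | zero => simp [hmean]
      | succ t ih =>
        rw [pow_succ' (D.avg₂ ∘ₗ D.avg₁)]
        refine ⟨(hB.sum_avg_avg _).trans ih.1, (hl _ ih.1).trans ?_⟩
        rw [pow_succ' (l : ℝ) t, mul_pow, mul_assoc]
        gcongr
        exact ih.2
    have hconst : ∀ t : ℕ, ((D.avg₂ ∘ₗ D.avg₁) ^ t) (fun j => h j - M)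
        = ((D.avg₂ ∘ₗ D.avg₁) ^ t) h - fun _ => M := by
      intro t
      have h1 : ((D.avg₂ ∘ₗ D.avg₁) ^ t) (fun _ => M) = fun _ => M := by
        induction t with
        | zero => rfl
        | succ t ih =>
          rw [pow_succ', Module.End.mul_apply, ih, LinearMap.comp_apply, hB.avg₁_const,
            hB.avg₂_const]
      have h2 : (fun j => h j - M) = h - fun _ => M := rfl
      rw [h2, map_sub, h1]
    set S := √(∑ j, (h j - M) ^ 2) with hS
    have hptw : ∀ (t : ℕ) x, |(∫ z, f z ∂((D.auxGibbs ^ (t + 1)) x)) - M| ≤ (l : ℝ) ^ t * S := by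
      intro t x
      have h1 : (∫ z, f z ∂((D.auxGibbs ^ (t + 1)) x)) - M
          = ((D.avg₂ ∘ₗ D.avg₁) ^ t) (fun j => h j - M) x.2 := by
        rw [hconst, hB.integral_auxGibbs_pow]
        rfl
      rw [h1]
      refine abs_le_of_sq_le_sq ?_ (by positivity)
      rw [mul_pow, hS, Real.sq_sqrt (by positivity)]
      exact (Finset.single_le_sum (f := fun j =>
        (((D.avg₂ ∘ₗ D.avg₁) ^ t) (fun j => h j - M)) j ^ 2) (fun j _ => sq_nonneg _)
        (Finset.mem_univ x.2)).trans (hpow t).2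
    obtain ⟨C₀, hC₀⟩ : ∃ C₀ : ℝ≥0,
        eLpNorm (fun x => (∫ z, f z ∂((D.auxGibbs ^ 0) x)) - M) 2 D.auxTarget ≤ C₀ := by
      refine ⟨_, (ENNReal.coe_toNNReal (MemLp.eLpNorm_ne_top ?_)).ge⟩
      exact MemLp.of_discrete
    have hS0 : 0 ≤ S := Real.sqrt_nonneg _
    refine ⟨C₀ + ⟨S / r, by positivity⟩, fun t => ?_⟩
    cases t with
    | zero =>
      refine hC₀.trans ?_
      rw [pow_zero, mul_one]
      exact ENNReal.coe_le_coe.2 le_self_add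
    | succ t =>
      have h1 := eLpNorm_le_of_ae_bound (p := 2) (μ := D.auxTarget)
        (f := fun x => (∫ z, f z ∂((D.auxGibbs ^ (t + 1)) x)) - M)
        (Filter.Eventually.of_forall (hptw t))
      refine h1.trans ?_
      simp only [measure_univ, ENNReal.one_rpow, one_mul]
      rw [← ENNReal.coe_pow, ← ENNReal.coe_mul, ← ENNReal.ofReal_coe_nnreal]
      refine ENNReal.ofReal_le_ofReal ?_
      push_cast
      have h3 : (l : ℝ) ^ t ≤ (r : ℝ) ^ t := by
        gcongr
        rw [hr]; linarith [ε.2]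
      calc (l : ℝ) ^ t * S ≤ (r : ℝ) ^ t * S := by gcongr
        _ = S / r * r ^ (t + 1) := by field_simp; ring
        _ ≤ (C₀ + S / r) * r ^ (t + 1) := by
          gcongr
          exact le_add_of_nonneg_left C₀.2
  · rcases hl' with rfl | ⟨g, hg, hsum, hKg⟩
    · simp
    have hM : ∫ z : Fin I₁ × Fin I₂, g z.2 ∂D.auxTarget = 0 := by
      rw [integral_auxTarget, Fintype.sum_prod_type_right]
      simp only [← Finset.sum_mul, ← Nat.cast_sum, ← occ₂_eq_sum_cooc, hB.2, ← Finset.mul_sum,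
        hsum, mul_zero, zero_div]
    -- The eigenvector, read as a function of the second component, is an eigenfunction of the
    -- sampler. It is not a.e. constant, since every level has positive mass.
    refine le_l2Rate_of_affine (f := fun x => g x.2) (c := 0) invariant_twoBlockGibbs
      MemLp.of_discrete (Filter.Eventually.of_forall fun x => ?_) fun hae => ?_
    · refine (hB.integral_auxGibbs _ x).trans ?_
      have := congrFun hKg x.2
      rw [Pi.smul_apply, smul_eq_mul] at this
      rw [add_zero, ← this]
    · rw [hM] at hae
      have h1 : ∫ z : Fin I₁ × Fin I₂, g z.2 ^ 2 ∂D.auxTarget = 0 := by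
        rw [integral_eq_zero_of_ae]
        filter_upwards [hae] with x hx
        simp [hx]
      rw [integral_auxTarget, Fintype.sum_prod_type_right] at h1
      simp only [← Finset.sum_mul, ← Nat.cast_sum, ← occ₂_eq_sum_cooc, hB.2, ← Finset.mul_sum] at h1
      have h2 : ∑ j, g j ^ 2 = 0 := by
        by_contra h0
        have : (N : ℝ) / I₂ * (∑ j, g j ^ 2) / N ≠ 0 := by positivity
        exact this h1
      rw [Finset.sum_eq_zero_iff_of_nonneg fun j _ => sq_nonneg _] at h2
      exact hg (funext fun j => pow_eq_zero_iff two_ne_zero |>.1 (h2 j (Finset.mem_univ j)))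

end Aux

/-! ### Gaussian conjugacy -/

section Conjugacy

/-- The measure on the line with density `A exp (-p x² / 2 + l x)`. -/
def gaussDensity (A p l : ℝ) : Measure ℝ :=
  volume.withDensity fun x => ENNReal.ofReal (A * Real.exp (-p * x ^ 2 / 2 + l * x))

/-- Completing the square. The exponential factor in the mass records the linear coefficient, which
matters when that coefficient depends on an outer variable. -/
theorem gaussDensity_eq {A p : ℝ} (hA : 0 ≤ A) (hp : 0 < p) (l : ℝ) :
    gaussDensity A p l = ENNReal.ofReal (A * √(2 * Real.pi / p) * Real.exp (l ^ 2 / (2 * p))) •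
      gaussianReal (l / p) (p⁻¹).toNNReal := by
  have hv : (p⁻¹).toNNReal ≠ 0 := by simpa using hp
  have hpdf : Measurable (gaussianPDF (l / p) (p⁻¹).toNNReal) := measurable_gaussianPDF _ _
  rw [gaussDensity, gaussianReal_of_var_ne_zero _ hv, ← withDensity_smul _ hpdf]
  congr 1
  ext x
  have hs : 0 < √(2 * Real.pi / p) := Real.sqrt_pos.2 (by positivity)
  rw [Pi.smul_apply, smul_eq_mul, gaussianPDF, ← ENNReal.ofReal_mul (by positivity),
    gaussianPDFReal, Real.coe_toNNReal _ (by positivity), ← div_eq_mul_inv]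
  congr 1
  have h2 : A * √(2 * Real.pi / p) * Real.exp (l ^ 2 / (2 * p)) *
      ((√(2 * Real.pi / p))⁻¹ * Real.exp (-(x - l / p) ^ 2 / (2 * p⁻¹)))
      = A * (Real.exp (l ^ 2 / (2 * p)) * Real.exp (-(x - l / p) ^ 2 / (2 * p⁻¹))) := by
    field_simp
  rw [h2, ← Real.exp_add]
  congr 2
  field_simp
  ring

/-- Conjugacy is addition of precisions and linear coefficients. No positivity of `p` or `q` is
required, so an improper factor is allowed. -/
theorem gaussDensity_withDensity {A : ℝ} (hA : 0 ≤ A) {B : ℝ} (p l q m : ℝ) :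
    (gaussDensity A p l).withDensity
      (fun x => ENNReal.ofReal (B * Real.exp (-q * x ^ 2 / 2 + m * x)))
      = gaussDensity (A * B) (p + q) (l + m) := by
  rw [gaussDensity, ← withDensity_mul _ (by fun_prop) (by fun_prop), gaussDensity]
  congr 1
  ext x
  rw [Pi.mul_apply, ← ENNReal.ofReal_mul (by positivity)]
  congr 1
  rw [mul_mul_mul_comm, ← Real.exp_add]
  congr 2
  ring

theorem gaussianReal_eq_gaussDensity (m : ℝ) {p : ℝ≥0} (hp : 0 < p) :
    ∃ A : ℝ, 0 < A ∧ gaussianReal m p⁻¹ = gaussDensity A p (p * m) := by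
  have hp' : (0 : ℝ) < p := hp
  refine ⟨(√(2 * Real.pi / p) * Real.exp ((p * m) ^ 2 / (2 * p)))⁻¹, by positivity, ?_⟩
  have hs : 0 < √(2 * Real.pi / p) := Real.sqrt_pos.2 (by positivity)
  rw [gaussDensity_eq (by positivity) hp', mul_assoc, inv_mul_cancel₀ (by positivity),
    ENNReal.ofReal_one, one_smul, mul_div_cancel_left₀ _ hp'.ne']
  congr 1
  rw [← NNReal.coe_inv, Real.toNNReal_coe]

/-- The flat prior is the case of zero precision and zero linear coefficient, so proper and improper
priors are treated together. -/
theorem globalPrior_eq_gaussDensity (μpr : ℝ) (τpr : ℝ≥0) :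
    ∃ A : ℝ, 0 < A ∧ globalPrior μpr τpr = gaussDensity A τpr (τpr * μpr) := by
  rw [globalPrior]
  split_ifs with h
  · refine ⟨1, one_pos, ?_⟩
    simp [gaussDensity, h]
  · exact gaussianReal_eq_gaussDensity μpr (pos_iff_ne_zero.2 h)

instance (μpr : ℝ) (τpr : ℝ≥0) : SFinite (globalPrior μpr τpr) := by
  rw [globalPrior]
  split_ifs <;> infer_instance

theorem gaussianReal_eq_map (m : ℝ) {p : ℝ} (hp : 0 < p) :
    gaussianReal m (p⁻¹).toNNReal = (gaussianReal 0 1).map fun z => m + z / √p := by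
  have h : (fun z : ℝ => m + z / √p) = (fun z => m + z) ∘ fun z => z / √p := rfl
  rw [h, ← Measure.map_map (by fun_prop) (by fun_prop), gaussianReal_map_div_const,
    gaussianReal_map_const_add]
  congr 1
  · simp
  · ext
    simp [Real.sq_sqrt hp.le, hp.le]

/-- A product density acts coordinate by coordinate. On boxes the integral factors by independence
of the coordinates, and boxes determine the product measure. -/
theorem pi_withDensity_prod {ι : Type*} [Fintype ι] {μ ν : ι → Measure ℝ}
    [∀ i, IsProbabilityMeasure (μ i)] [∀ i, IsProbabilityMeasure (ν i)] {g : ι → ℝ → ℝ≥0∞}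
    (hg : ∀ i, Measurable (g i)) {c : ι → ℝ≥0∞} (hc : ∀ i, c i ≠ 0) (hc' : ∀ i, c i ≠ ∞)
    (h : ∀ i, (μ i).withDensity (g i) = c i • ν i) :
    (Measure.pi μ).withDensity (fun x => ∏ i, g i (x i)) = (∏ i, c i) • Measure.pi ν := by
  have hC : ∏ i, c i ≠ 0 := Finset.prod_ne_zero_iff.2 fun i _ => hc i
  have hC' : ∏ i, c i ≠ ∞ := ENNReal.prod_ne_top fun i _ => hc' i
  have key : Measure.pi ν
      = (∏ i, c i)⁻¹ • (Measure.pi μ).withDensity (fun x => ∏ i, g i (x i)) := by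
    refine Measure.pi_eq fun s hs => ?_
    have hbox : MeasurableSet (Set.univ.pi s) := MeasurableSet.univ_pi hs
    rw [Measure.smul_apply, withDensity_apply _ hbox, ← lintegral_indicator hbox]
    have hind : ∀ x : ι → ℝ, (Set.univ.pi s).indicator (fun x => ∏ i, g i (x i)) x
        = ∏ i, (s i).indicator (g i) (x i) := by
      intro x
      classical
      by_cases hx : x ∈ Set.univ.pi s
      · rw [Set.indicator_of_mem hx]
        refine Finset.prod_congr rfl fun i _ => ?_
        rw [Set.indicator_of_mem (hx i (Set.mem_univ i))]
      · rw [Set.indicator_of_notMem hx]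
        simp only [Set.mem_pi, Set.mem_univ, true_implies, not_forall] at hx
        obtain ⟨i, hi⟩ := hx
        exact (Finset.prod_eq_zero (Finset.mem_univ i) (Set.indicator_of_notMem hi _)).symm
    have hmeas : ∀ i, Measurable ((s i).indicator (g i)) := fun i => (hg i).indicator (hs i)
    simp only [hind]
    rw [lintegral_prod_eq_prod_lintegral_of_indepFun Finset.univ
      (fun i (x : ι → ℝ) => (s i).indicator (g i) (x i))
      (iIndepFun_pi fun i => (hmeas i).aemeasurable)
      (fun i => (hmeas i).comp (measurable_pi_apply i))]
    have h1 : ∀ i, ∫⁻ x : ι → ℝ, (s i).indicator (g i) (x i) ∂Measure.pi μ = c i * ν i (s i) := by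
      intro i
      rw [(measurePreserving_eval μ i).lintegral_comp (hmeas i), lintegral_indicator (hs i),
        ← withDensity_apply _ (hs i), h i, Measure.smul_apply, smul_eq_mul]
    simp only [h1]
    rw [Finset.prod_mul_distrib, smul_eq_mul, ← mul_assoc, ENNReal.inv_mul_cancel hC hC', one_mul]
  rw [key, smul_smul, ENNReal.mul_inv_cancel hC hC', one_smul]

end Conjugacy

/-! ### The exact joint update of the global effect and the effects of one factor -/

section Block

variable {N I : ℕ} (lev : Fin N → Fin I) (τ τk μpr τpr : ℝ) (r : Fin N → ℝ)

/-- Number of observations at level `i`. -/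
def levelCount (i : Fin I) : ℝ := ∑ n, if lev n = i then 1 else 0

/-- Sum of the residuals `r` at level `i`. -/
def levelSum (i : Fin I) : ℝ := ∑ n, if lev n = i then r n else 0

/-- Conditional precision of the effect of level `i`. -/
def levelPrec (i : Fin I) : ℝ := levelCount lev i * τ + τk

/-- Weight of level `i` in the marginal law of the global effect. -/
def levelWeight (i : Fin I) : ℝ := τk / levelPrec lev τ τk i * τ

/-- Conditional precision of the global effect. -/
def globalPrec : ℝ := τpr + ∑ i, levelWeight lev τ τk i * levelCount lev i

/-- Linear coefficient in the conditional law of the global effect. -/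
def globalLin : ℝ := μpr * τpr + ∑ i, levelWeight lev τ τk i * levelSum lev r i

/-- The global effect as a function of a standard normal variable. -/
def globalDraw (z : ℝ) : ℝ :=
  globalLin lev τ τk μpr τpr r / globalPrec lev τ τk τpr + z / √(globalPrec lev τ τk τpr)

/-- Conditional mean of the effect of level `i` given the global effect `a`. -/
def effectMean (a : ℝ) (i : Fin I) : ℝ :=
  (levelSum lev r i - levelCount lev i * a) * τ / levelPrec lev τ τk i

/-- The effects given the global effect `a`, as a function of standard normal variables. -/
def effectDraw (a : ℝ) (z : Fin I → ℝ) (i : Fin I) : ℝ :=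
  effectMean lev τ τk r a i + z i / √(levelPrec lev τ τk i)

/-- The joint update as a function of standard normal variables. -/
def blockDraw (z : ℝ × (Fin I → ℝ)) : ℝ × (Fin I → ℝ) :=
  (globalDraw lev τ τk μpr τpr r z.1,
    effectDraw lev τ τk r (globalDraw lev τ τk μpr τpr r z.1) z.2)

/-- Independent standard normal variables. -/
def blockNoise (I : ℕ) : Measure (ℝ × (Fin I → ℝ)) :=
  (gaussianReal 0 1).prod (Measure.pi fun _ => gaussianReal 0 1)

instance : IsProbabilityMeasure (blockNoise I) := by unfold blockNoise; infer_instance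

theorem measurable_blockDraw_uncurry :
    Measurable fun x : (Fin N → ℝ) × (ℝ × (Fin I → ℝ)) =>
      blockDraw lev τ τk μpr τpr x.1 x.2 := by
  have hs : ∀ i, Measurable fun x : (Fin N → ℝ) × (ℝ × (Fin I → ℝ)) => levelSum lev x.1 i := by
    intro i
    unfold levelSum
    refine Finset.measurable_sum _ fun n _ => ?_
    split_ifs <;> fun_prop
  have hg : Measurable fun x : (Fin N → ℝ) × (ℝ × (Fin I → ℝ)) =>
      globalDraw lev τ τk μpr τpr x.1 x.2.1 := by
    unfold globalDraw globalLin
    fun_prop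
  refine hg.prodMk (measurable_pi_iff.2 fun i => ?_)
  unfold effectDraw effectMean
  fun_prop

theorem measurable_blockDraw : Measurable (blockDraw lev τ τk μpr τpr r) := by
  have hg : Measurable fun z : ℝ × (Fin I → ℝ) => globalDraw lev τ τk μpr τpr r z.1 := by
    unfold globalDraw
    fun_prop
  refine hg.prodMk (measurable_pi_iff.2 fun i => ?_)
  unfold effectDraw effectMean
  fun_prop

theorem sum_mul_comp_level (f : Fin I → ℝ) (h : Fin N → ℝ) :
    ∑ n, f (lev n) * h n = ∑ i, f i * levelSum lev h i := by
  simp only [levelSum, Finset.mul_sum]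
  rw [Finset.sum_comm]
  refine Finset.sum_congr rfl fun n _ => ?_
  simp

theorem levelCount_nonneg (i : Fin I) : 0 ≤ levelCount lev i :=
  Finset.sum_nonneg fun n _ => by split_ifs <;> norm_num

theorem sum_levelCount : ∑ i, levelCount lev i = N := by
  simp only [levelCount]
  rw [Finset.sum_comm]
  simp

variable {τ τk μpr τpr}

theorem levelPrec_pos (hτ : 0 < τ) (hτk : 0 < τk) (i : Fin I) : 0 < levelPrec lev τ τk i := by
  have := levelCount_nonneg lev i
  unfold levelPrec
  positivity

theorem globalPrec_pos [NeZero N] (hτ : 0 < τ) (hτk : 0 < τk) (hτpr : 0 ≤ τpr) :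
    0 < globalPrec lev τ τk τpr := by
  have h1 : ∀ i, 0 ≤ levelWeight lev τ τk i * levelCount lev i := fun i => by
    have := levelCount_nonneg lev i
    have := levelPrec_pos lev hτ hτk i
    unfold levelWeight
    positivity
  have h2 : 0 < ∑ i, levelWeight lev τ τk i * levelCount lev i := by
    refine Finset.sum_pos' (fun i _ => h1 i) ?_
    -- If no level contributed, all counts would vanish, contradicting that they sum to `N`. This
    -- keeps the conditional precision positive under the flat prior.
    by_contra! h
    have h0 : ∀ i, levelCount lev i = 0 := fun i => by
      have h3 := h i (Finset.mem_univ i)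
      have h4 := levelPrec_pos lev hτ hτk i
      have h5 : 0 < levelWeight lev τ τk i := by unfold levelWeight; positivity
      exact le_antisymm (nonpos_of_mul_nonpos_right h3 h5) (levelCount_nonneg lev i)
    have h6 := sum_levelCount lev
    simp only [h0, Finset.sum_const_zero] at h6
    exact NeZero.ne N (by exact_mod_cast h6.symm)
  unfold globalPrec
  linarith

/-- Expanding the squares and grouping observations by level separates the effects once the global
effect is fixed. The constant depends on neither of them. -/
theorem prod_gaussianPDF_eq {τ : ℝ≥0} (hτ : 0 < τ) : ∃ C : ℝ, 0 < C ∧ ∀ (a : ℝ) (x : Fin I → ℝ),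
    ∏ n, gaussianPDF (a + x (lev n)) τ⁻¹ (r n)
      = ENNReal.ofReal (C * Real.exp (-τ / 2 * ∑ n, (r n - a) ^ 2)) *
        ∏ i, ENNReal.ofReal (1 * Real.exp (-(levelCount lev i * τ) * x i ^ 2 / 2
          + (levelSum lev r i - levelCount lev i * a) * τ * x i)) := by
  have hτ' : (0 : ℝ) < τ := hτ
  refine ⟨((√(2 * Real.pi * (τ⁻¹ : ℝ≥0)))⁻¹) ^ N, by push_cast; positivity, fun a x => ?_⟩
  simp only [gaussianPDF, gaussianPDFReal]
  rw [← ENNReal.ofReal_prod_of_nonneg fun n _ => by positivity, Finset.prod_mul_distrib,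
    ← Real.exp_sum, ← ENNReal.ofReal_prod_of_nonneg fun i _ => by positivity,
    Finset.prod_mul_distrib, ← Real.exp_sum, ← ENNReal.ofReal_mul (by positivity)]
  simp only [Finset.prod_const, Finset.card_univ, Fintype.card_fin, one_pow, one_mul]
  congr 1
  rw [mul_assoc (_ ^ N), ← Real.exp_add]
  congr 2
  have h1 := sum_mul_comp_level lev (fun i => -τ * x i ^ 2 / 2) fun _ => 1
  have h2 := sum_mul_comp_level lev (fun i => τ * x i) r
  have h3 := sum_mul_comp_level lev (fun i => -(τ * x i * a)) fun _ => 1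
  have h4 : ∀ i, levelSum lev (fun _ => 1) i = levelCount lev i := fun i => rfl
  simp only [h4] at h1 h3
  have h5 : ∑ n, -(r n - (a + x (lev n))) ^ 2 / (2 * ((τ⁻¹ : ℝ≥0) : ℝ))
      = -τ / 2 * ∑ n, (r n - a) ^ 2 + (∑ n, -τ * x (lev n) ^ 2 / 2 * 1
        + ∑ n, τ * x (lev n) * r n + ∑ n, -(τ * x (lev n) * a) * 1) := by
    rw [Finset.mul_sum, ← Finset.sum_add_distrib, ← Finset.sum_add_distrib,
      ← Finset.sum_add_distrib]
    refine Finset.sum_congr rfl fun n _ => ?_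
    push_cast
    field_simp
    ring
  rw [h5, h1, h2, h3, ← Finset.sum_add_distrib, ← Finset.sum_add_distrib]
  congr 1
  refine Finset.sum_congr rfl fun i _ => ?_
  ring

/-- With the global effect `a` fixed, conjugacy applies level by level. The normalizing constant
still depends on `a`; this dependence is what `sum_sq_exponent` turns into the marginal law of `a`.
-/
theorem lintegral_effects {τ τk : ℝ≥0} (hτ : 0 < τ) (hτk : 0 < τk) : ∃ C : ℝ, 0 < C ∧
    ∀ (a : ℝ) (F : (Fin I → ℝ) → ℝ≥0∞), Measurable F →
    ∫⁻ x, (∏ i, ENNReal.ofReal (1 * Real.exp (-(levelCount lev i * τ) * x i ^ 2 / 2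
          + (levelSum lev r i - levelCount lev i * a) * τ * x i))) * F x
        ∂(Measure.pi fun _ => gaussianReal 0 τk⁻¹)
      = ENNReal.ofReal (C * Real.exp (∑ i, ((levelSum lev r i - levelCount lev i * a) * τ) ^ 2
          / (2 * levelPrec lev τ τk i))) *
        ∫⁻ z, F (effectDraw lev τ τk r a z) ∂(Measure.pi fun _ => gaussianReal 0 1) := by
  obtain ⟨A, hA, hprior⟩ := gaussianReal_eq_gaussDensity 0 hτk
  have hp := levelPrec_pos lev (τ := τ) (τk := τk) hτ hτk
  refine ⟨∏ i, A * √(2 * Real.pi / levelPrec lev τ τk i), Finset.prod_pos fun i _ => by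
    have := hp i
    positivity, fun a F hF => ?_⟩
  have hconj := pi_withDensity_prod (μ := fun _ : Fin I => gaussianReal 0 τk⁻¹)
    (ν := fun i => gaussianReal (effectMean lev τ τk r a i) ((levelPrec lev τ τk i)⁻¹).toNNReal)
    (g := fun i x => ENNReal.ofReal (1 * Real.exp (-(levelCount lev i * τ) * x ^ 2 / 2
          + (levelSum lev r i - levelCount lev i * a) * τ * x)))
    (c := fun i => ENNReal.ofReal (A * √(2 * Real.pi / levelPrec lev τ τk i) *
      Real.exp (((levelSum lev r i - levelCount lev i * a) * τ) ^ 2 / (2 * levelPrec lev τ τk i))))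
    (fun i => by fun_prop)
    (fun i => by
      have := hp i
      rw [Ne, ENNReal.ofReal_eq_zero, not_le]
      positivity)
    (fun i => ENNReal.ofReal_ne_top)
    (fun i => by
      have h1 : (τk : ℝ) + levelCount lev i * τ = levelPrec lev τ τk i := by
        rw [levelPrec, add_comm]
      rw [hprior, gaussDensity_withDensity hA.le, h1, gaussDensity_eq (by positivity) (hp i),
        mul_zero, zero_add, mul_one]
      rfl)
  have hmap : (Measure.pi fun i =>
      gaussianReal (effectMean lev τ τk r a i) ((levelPrec lev τ τk i)⁻¹).toNNReal)
      = (Measure.pi fun _ => gaussianReal 0 1).map (effectDraw lev τ τk r a) := by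
    have h1 : ∀ i, gaussianReal (effectMean lev τ τk r a i) ((levelPrec lev τ τk i)⁻¹).toNNReal
        = (gaussianReal 0 1).map
          fun z => effectMean lev τ τk r a i + z / √(levelPrec lev τ τk i) :=
      fun i => gaussianReal_eq_map _ (hp i)
    simp only [h1]
    have : ∀ i, IsProbabilityMeasure ((gaussianReal 0 1).map
          fun z => effectMean lev τ τk r a i + z / √(levelPrec lev τ τk i)) := fun i => by
      rw [← h1]; infer_instance
    exact (Measure.pi_map_pi fun i => by fun_prop).symm
  have hmeas : Measurable (effectDraw lev τ τk r a) := by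
    refine measurable_pi_iff.2 fun i => ?_
    unfold effectDraw
    fun_prop
  have h1 := lintegral_withDensity_eq_lintegral_mul (Measure.pi fun _ : Fin I => gaussianReal 0 τk⁻¹)
    (f := fun x => ∏ i, ENNReal.ofReal (1 * Real.exp (-(levelCount lev i * τ) * x i ^ 2 / 2
          + (levelSum lev r i - levelCount lev i * a) * τ * x i))) (by fun_prop) hF
  rw [hconj, hmap, lintegral_smul_measure, lintegral_map hF hmeas] at h1
  simp only [Pi.mul_apply] at h1
  rw [← h1, ← ENNReal.ofReal_prod_of_nonneg fun i _ => by positivity, Finset.prod_mul_distrib,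
    ← Real.exp_sum, smul_eq_mul]

/-- Integrating out a level with count `c` and precision `P = cτ + τk` turns its precision
contribution `cτ` for `a` into `cτ - (cτ)²/P = cττk/P`, which is `levelWeight` times the count. -/
theorem sum_sq_exponent {τ τk : ℝ} (hp : ∀ i, 0 < levelPrec lev τ τk i) (a : ℝ) :
    -τ / 2 * ∑ n, (r n - a) ^ 2
      + ∑ i, ((levelSum lev r i - levelCount lev i * a) * τ) ^ 2 / (2 * levelPrec lev τ τk i)
    = -τ / 2 * ∑ n, r n ^ 2 + ∑ i, (levelSum lev r i * τ) ^ 2 / (2 * levelPrec lev τ τk i)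
      + (-(∑ i, levelWeight lev τ τk i * levelCount lev i) * a ^ 2 / 2
        + (∑ i, levelWeight lev τ τk i * levelSum lev r i) * a) := by
  have h1 : ∑ n, (r n - a) ^ 2 = ∑ n, r n ^ 2 - 2 * a * ∑ i, levelSum lev r i
      + a ^ 2 * ∑ i, levelCount lev i := by
    have h2 := sum_mul_comp_level lev (fun _ => 1) r
    simp only [one_mul] at h2
    rw [← h2, sum_levelCount, Finset.mul_sum]
    simp only [sub_sq, Finset.sum_add_distrib, Finset.sum_sub_distrib]
    simp only [Finset.sum_const, Finset.card_univ, Fintype.card_fin, nsmul_eq_mul]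
    rw [mul_comm (a ^ 2)]
    congr 2
    exact Finset.sum_congr rfl fun n _ => by ring
  have h3 : ∑ i, ((levelSum lev r i - levelCount lev i * a) * τ) ^ 2
        / (2 * levelPrec lev τ τk i)
      = ∑ i, (levelSum lev r i * τ) ^ 2 / (2 * levelPrec lev τ τk i)
        - τ * a * ∑ i, levelSum lev r i + τ / 2 * a ^ 2 * ∑ i, levelCount lev i
        + (-(∑ i, levelWeight lev τ τk i * levelCount lev i) * a ^ 2 / 2
          + (∑ i, levelWeight lev τ τk i * levelSum lev r i) * a) := by
    have h4 : ∀ Q M : ℝ, -Q * a ^ 2 / 2 + M * a = (-a ^ 2 / 2) * Q + a * M := fun Q M => by ring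
    rw [h4, Finset.mul_sum, Finset.mul_sum, Finset.mul_sum, Finset.mul_sum,
      ← Finset.sum_sub_distrib, ← Finset.sum_add_distrib, ← Finset.sum_add_distrib,
      ← Finset.sum_add_distrib]
    refine Finset.sum_congr rfl fun i _ => ?_
    have h5 := (hp i).ne'
    have h6 : τk = levelPrec lev τ τk i - levelCount lev i * τ := by rw [levelPrec]; ring
    rw [levelWeight]
    generalize levelPrec lev τ τk i = P at h5 h6
    rw [h6]
    field_simp
    ring
  rw [h1, h3]
  ring

/-- Conjugacy: integrating a function against likelihood times prior, with the other factor fixed,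
amounts to averaging it over the exact joint update, up to a normalizing constant. -/
theorem lintegral_block [NeZero N] {τ τk : ℝ≥0} (hτ : 0 < τ) (hτk : 0 < τk) (μpr : ℝ) (τpr : ℝ≥0) :
    ∃ Z : ℝ≥0∞, ∀ F : ℝ × (Fin I → ℝ) → ℝ≥0∞, Measurable F →
      ∫⁻ a, ∫⁻ x, (∏ n, gaussianPDF (a + x (lev n)) τ⁻¹ (r n)) * F (a, x)
        ∂(Measure.pi fun _ => gaussianReal 0 τk⁻¹) ∂(globalPrior μpr τpr)
      = Z * ∫⁻ z, F (blockDraw lev τ τk μpr τpr r z) ∂(blockNoise I) := by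
  obtain ⟨A, hA, hprior⟩ := globalPrior_eq_gaussDensity μpr τpr
  obtain ⟨C, hC, hlik⟩ := prod_gaussianPDF_eq lev r hτ
  obtain ⟨C', hC', heff⟩ := lintegral_effects lev r hτ hτk
  have hp := levelPrec_pos lev (τ := τ) (τk := τk) hτ hτk
  have hP := globalPrec_pos lev (τ := τ) (τk := τk) (τpr := τpr) hτ hτk τpr.2
  obtain ⟨B, hB⟩ : ∃ B : ℝ, B = C * C' * Real.exp (-τ / 2 * ∑ n, r n ^ 2
    + ∑ i, (levelSum lev r i * τ) ^ 2 / (2 * levelPrec lev τ τk i)) := ⟨_, rfl⟩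
  have hB0 : 0 < B := by rw [hB]; positivity
  obtain ⟨Q, hQ⟩ : ∃ Q : ℝ, Q = ∑ i, levelWeight lev τ τk i * levelCount lev i := ⟨_, rfl⟩
  obtain ⟨M, hM⟩ : ∃ M : ℝ, M = ∑ i, levelWeight lev τ τk i * levelSum lev r i := ⟨_, rfl⟩
  have hexp : ∀ a : ℝ, ENNReal.ofReal (C * Real.exp (-τ / 2 * ∑ n, (r n - a) ^ 2)) *
      ENNReal.ofReal (C' * Real.exp (∑ i, ((levelSum lev r i - levelCount lev i * a) * τ) ^ 2
          / (2 * levelPrec lev τ τk i)))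
      = ENNReal.ofReal (B * Real.exp (-Q * a ^ 2 / 2 + M * a)) := by
    intro a
    rw [← ENNReal.ofReal_mul (by positivity)]
    congr 1
    rw [mul_mul_mul_comm, ← Real.exp_add, hB, mul_assoc (C * C'), ← Real.exp_add]
    rw [hQ, hM, sum_sq_exponent lev r hp a]
  refine ⟨ENNReal.ofReal (A * B * √(2 * Real.pi / globalPrec lev τ τk τpr) *
    Real.exp (globalLin lev τ τk μpr τpr r ^ 2 / (2 * globalPrec lev τ τk τpr))), fun F hF => ?_⟩
  have hdraw : Measurable fun x : ℝ × (Fin I → ℝ) => effectDraw lev τ τk r x.1 x.2 := by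
    refine measurable_pi_iff.2 fun i => ?_
    unfold effectDraw effectMean
    fun_prop
  set H : ℝ → ℝ≥0∞ := fun a => ∫⁻ z, F (a, effectDraw lev τ τk r a z)
    ∂(Measure.pi fun _ => gaussianReal 0 1) with hH
  have hHm : Measurable H := by
    refine Measurable.lintegral_prod_right'
      (f := fun x : ℝ × (Fin I → ℝ) => F (x.1, effectDraw lev τ τk r x.1 x.2)) ?_
    exact hF.comp (measurable_fst.prodMk hdraw)
  have hinner : ∀ a, ∫⁻ x, (∏ n, gaussianPDF (a + x (lev n)) τ⁻¹ (r n)) * F (a, x)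
        ∂(Measure.pi fun _ => gaussianReal 0 τk⁻¹)
      = ENNReal.ofReal (B * Real.exp (-Q * a ^ 2 / 2 + M * a)) * H a := by
    intro a
    have hFa : Measurable fun x => F (a, x) := hF.comp measurable_prodMk_left
    simp only [hlik, mul_assoc (ENNReal.ofReal _)]
    rw [lintegral_const_mul _ (by fun_prop), heff a _ hFa, ← mul_assoc, hexp]
  simp only [hinner]
  have h1 := lintegral_withDensity_eq_lintegral_mul (globalPrior μpr τpr)
    (f := fun a => ENNReal.ofReal (B * Real.exp (-Q * a ^ 2 / 2 + M * a))) (by fun_prop) hHm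
  simp only [Pi.mul_apply] at h1
  have h2 : (τpr : ℝ) * μpr + M = globalLin lev τ τk μpr τpr r := by
    rw [globalLin, mul_comm, hM]
  have h3 : (τpr : ℝ) + Q = globalPrec lev τ τk τpr := by rw [hQ, globalPrec]
  have h4 : Measurable fun z => F (blockDraw lev τ τk μpr τpr r z) :=
    hF.comp (measurable_blockDraw lev τ τk μpr τpr r)
  have h5 : ∫⁻ z, F (blockDraw lev τ τk μpr τpr r z) ∂(blockNoise I)
      = ∫⁻ z, H (globalDraw lev τ τk μpr τpr r z) ∂(gaussianReal 0 1) := by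
    exact lintegral_prod _ h4.aemeasurable
  have h6 : Measurable (globalDraw lev τ τk μpr τpr r) := by
    unfold globalDraw
    fun_prop
  have h7 : gaussianReal (globalLin lev τ τk μpr τpr r / globalPrec lev τ τk τpr)
      ((globalPrec lev τ τk τpr)⁻¹).toNNReal
      = (gaussianReal 0 1).map (globalDraw lev τ τk μpr τpr r) := gaussianReal_eq_map _ hP
  rw [← h1, hprior, gaussDensity_withDensity hA.le, h2, h3, gaussDensity_eq (by positivity) hP,
    lintegral_smul_measure, smul_eq_mul, h5, h7, lintegral_map hHm h6]

end Block

/-! ### Kernels driven by independent noise -/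

section NoiseKernel

variable {E S Ω : Type*} [MeasurableSpace E] [MeasurableSpace S] [MeasurableSpace Ω]

/-- The kernel that draws a noise variable from `ν` and applies `Φ` to it and the state. -/
def noiseKernel (ν : Measure S) (Φ : E × S → Ω) : Kernel E Ω :=
  (Kernel.id ×ₖ Kernel.const E ν).map Φ

variable {ν : Measure S} [IsProbabilityMeasure ν] {Φ : E × S → Ω}

theorem noiseKernel_apply (hΦ : Measurable Φ) (x : E) :
    noiseKernel ν Φ x = ν.map fun z => Φ (x, z) := by
  rw [noiseKernel, Kernel.map_apply _ hΦ, Kernel.prod_apply, Kernel.id_apply, Kernel.const_apply,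
    Measure.dirac_prod, Measure.map_map hΦ measurable_prodMk_left]
  rfl

theorem isMarkovKernel_noiseKernel (hΦ : Measurable Φ) : IsMarkovKernel (noiseKernel ν Φ) := by
  unfold noiseKernel
  exact Kernel.IsMarkovKernel.map _ hΦ

theorem lintegral_noiseKernel (hΦ : Measurable Φ) (x : E) {F : Ω → ℝ≥0∞} (hF : Measurable F) :
    ∫⁻ w, F w ∂(noiseKernel ν Φ x) = ∫⁻ z, F (Φ (x, z)) ∂ν := by
  have hm : Measurable fun z => Φ (x, z) := hΦ.comp measurable_prodMk_left
  rw [noiseKernel_apply hΦ, lintegral_map hF hm]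

theorem integral_noiseKernel (hΦ : Measurable Φ) (x : E) {f : Ω → ℝ} (hf : Measurable f) :
    ∫ w, f w ∂(noiseKernel ν Φ x) = ∫ z, f (Φ (x, z)) ∂ν := by
  have hm : Measurable fun z => Φ (x, z) := hΦ.comp measurable_prodMk_left
  rw [noiseKernel_apply hΦ, integral_map hm.aemeasurable hf.aestronglyMeasurable]

/-- A noise-driven kernel is the conditional law given `X` as soon as redrawing the state from it
does not change the joint law of `X` and the state. -/
theorem blockUpdate_ae_eq_noiseKernel [StandardBorelSpace Ω] [Nonempty Ω] {π : Measure Ω}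
    [IsFiniteMeasure π] {X : Ω → E} (hX : Measurable X) (hΦ : Measurable Φ)
    (h : ∀ F : E × Ω → ℝ≥0∞, Measurable F →
      ∫⁻ w, F (X w, w) ∂π = ∫⁻ w, ∫⁻ z, F (X w, Φ (X w, z)) ∂ν ∂π) :
    ∀ᵐ w ∂π, blockUpdate π X hX w = noiseKernel ν Φ (X w) := by
  have := isMarkovKernel_noiseKernel (ν := ν) hΦ
  refine ae_of_ae_map hX.aemeasurable
    (p := fun b => condDistrib id X π b = noiseKernel ν Φ b) ?_
  refine condDistrib_ae_eq_of_measure_eq_compProd X aemeasurable_id ?_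
  refine Measure.ext_of_lintegral _ fun F hF => ?_
  have hXid : Measurable fun w => (X w, id w) := hX.prodMk measurable_id
  rw [lintegral_map hF hXid, Measure.lintegral_compProd hF,
    lintegral_map (hF.lintegral_kernel_prod_right') hX]
  refine (h F hF).trans (lintegral_congr fun w => ?_)
  have hm : Measurable fun b => F (X w, b) := hF.comp measurable_prodMk_left
  rw [lintegral_noiseKernel hΦ _ hm]

end NoiseKernel

/-! ### The posterior -/

section Posterior

variable {N I₁ I₂ : ℕ} (D : Design N I₁ I₂) (γ : Precisions) (μpr : ℝ) (τpr : ℝ≥0) (y : Fin N → ℝ)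

/-- The exact draw of the global effect and the first factor's effects given those of the second. -/
def Design.draw₁ (x : (Fin I₂ → ℝ) × (ℝ × (Fin I₁ → ℝ))) : Param I₁ I₂ :=
  ((blockDraw D.lev₁ γ.τ γ.τ₁ μpr τpr (fun n => y n - x.1 (D.lev₂ n)) x.2).1,
    (blockDraw D.lev₁ γ.τ γ.τ₁ μpr τpr (fun n => y n - x.1 (D.lev₂ n)) x.2).2, x.1)

/-- The exact draw of the global effect and the second factor's effects given those of the first. -/
def Design.draw₂ (x : (Fin I₁ → ℝ) × (ℝ × (Fin I₂ → ℝ))) : Param I₁ I₂ :=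
  ((blockDraw D.lev₂ γ.τ γ.τ₂ μpr τpr (fun n => y n - x.1 (D.lev₁ n)) x.2).1, x.1,
    (blockDraw D.lev₂ γ.τ γ.τ₂ μpr τpr (fun n => y n - x.1 (D.lev₁ n)) x.2).2)

theorem Design.measurable_draw₁ : Measurable (D.draw₁ γ μpr τpr y) := by
  have h : Measurable fun x : (Fin I₂ → ℝ) × (ℝ × (Fin I₁ → ℝ)) =>
      ((fun n => y n - x.1 (D.lev₂ n), x.2) : (Fin N → ℝ) × (ℝ × (Fin I₁ → ℝ))) := by
    fun_prop
  have h' := (measurable_blockDraw_uncurry D.lev₁ γ.τ γ.τ₁ μpr τpr).comp h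
  exact h'.fst.prodMk (h'.snd.prodMk measurable_fst)

theorem Design.measurable_draw₂ : Measurable (D.draw₂ γ μpr τpr y) := by
  have h : Measurable fun x : (Fin I₁ → ℝ) × (ℝ × (Fin I₂ → ℝ)) =>
      ((fun n => y n - x.1 (D.lev₁ n), x.2) : (Fin N → ℝ) × (ℝ × (Fin I₂ → ℝ))) := by
    fun_prop
  have h' := (measurable_blockDraw_uncurry D.lev₂ γ.τ γ.τ₂ μpr τpr).comp h
  exact h'.fst.prodMk (measurable_fst.prodMk h'.snd)

theorem gaussianPDF_add_left (a b : ℝ) (v : ℝ≥0) (x : ℝ) :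
    gaussianPDF (a + b) v x = gaussianPDF a v (x - b) := by
  simp only [gaussianPDF, gaussianPDFReal]
  congr 4
  ring

theorem Design.measurable_likelihood : Measurable (D.likelihood γ y) := by
  unfold Design.likelihood Design.predictor gaussianPDF gaussianPDFReal
  fun_prop

theorem Design.likelihood_eq₁ (θ : Param I₁ I₂) : D.likelihood γ y θ
    = ∏ n, gaussianPDF (θ.1 + θ.2.1 (D.lev₁ n)) γ.τ⁻¹ (y n - θ.2.2 (D.lev₂ n)) :=
  Finset.prod_congr rfl fun _ _ => gaussianPDF_add_left _ _ _ _

theorem Design.likelihood_eq₂ (θ : Param I₁ I₂) : D.likelihood γ y θ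
    = ∏ n, gaussianPDF (θ.1 + θ.2.2 (D.lev₂ n)) γ.τ⁻¹ (y n - θ.2.1 (D.lev₁ n)) :=
  Finset.prod_congr rfl fun _ _ => by
    rw [← gaussianPDF_add_left]
    congr 1
    exact add_right_comm _ _ _

variable {D γ μpr τpr y} [NeZero N]

/-- Bayes' rule before normalization. -/
theorem Design.lintegral_unnormalized (D : Design N I₁ I₂) {F : Param I₁ I₂ → ℝ≥0∞}
    (hF : Measurable F) :
    ∫⁻ θ, F θ ∂((prior I₁ I₂ γ μpr τpr).withDensity (D.likelihood γ y))
      = ∫⁻ θ, D.likelihood γ y θ * F θ ∂(prior I₁ I₂ γ μpr τpr) :=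
  lintegral_withDensity_eq_lintegral_mul _ (D.measurable_likelihood γ y) hF

/-- Fubini with the second factor's effects outermost, and `lintegral_block` for each value `b`. The
weight `Z` is left implicit, as the conditional law does not depend on it. -/
theorem Design.lintegral_unnormalized₁ (hτ : 0 < γ.τ) (hτ₁ : 0 < γ.τ₁) :
    ∃ Z : (Fin I₂ → ℝ) → ℝ≥0∞, ∀ F : Param I₁ I₂ → ℝ≥0∞, Measurable F →
      ∫⁻ θ, F θ ∂((prior I₁ I₂ γ μpr τpr).withDensity (D.likelihood γ y))
        = ∫⁻ b, Z b * ∫⁻ z, F (D.draw₁ γ μpr τpr y (b, z)) ∂(blockNoise I₁)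
          ∂(Measure.pi fun _ => gaussianReal 0 γ.τ₂⁻¹) := by
  choose Z hZ using fun b : Fin I₂ → ℝ =>
    lintegral_block D.lev₁ (fun n => y n - b (D.lev₂ n)) hτ hτ₁ μpr τpr
  refine ⟨Z, fun F hF => ?_⟩
  have hL := D.measurable_likelihood γ y
  have hm : Measurable fun x : ℝ × (Fin I₁ → ℝ) × (Fin I₂ → ℝ) => D.likelihood γ y x * F x := hL.mul hF
  rw [D.lintegral_unnormalized hF, prior, lintegral_prod _ hm.aemeasurable]
  have h1 : ∀ a : ℝ, ∫⁻ x, D.likelihood γ y (a, x) * F (a, x)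
      ∂((Measure.pi fun _ => gaussianReal 0 γ.τ₁⁻¹).prod (Measure.pi fun _ => gaussianReal 0 γ.τ₂⁻¹))
      = ∫⁻ b, ∫⁻ x, D.likelihood γ y (a, x, b) * F (a, x, b)
        ∂(Measure.pi fun _ => gaussianReal 0 γ.τ₁⁻¹) ∂(Measure.pi fun _ => gaussianReal 0 γ.τ₂⁻¹) :=
    fun a => lintegral_prod_symm' _ (hm.comp measurable_prodMk_left)
  simp only [h1]
  have hm' : Measurable fun x : (ℝ × (Fin I₂ → ℝ)) × (Fin I₁ → ℝ) =>
      D.likelihood γ y (x.1.1, x.2, x.1.2) * F (x.1.1, x.2, x.1.2) := by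
    have hre : Measurable fun x : (ℝ × (Fin I₂ → ℝ)) × (Fin I₁ → ℝ) =>
      ((x.1.1, x.2, x.1.2) : Param I₁ I₂) := by fun_prop
    exact hm.comp hre
  rw [lintegral_lintegral_swap (by
    exact (Measurable.lintegral_prod_right' hm').aemeasurable)]
  refine lintegral_congr fun b => ?_
  have h2 := hZ b (fun x => F (x.1, x.2, b)) (hF.comp (by fun_prop))
  simp only [D.likelihood_eq₁]
  exact h2

theorem Design.lintegral_unnormalized₂ (hτ : 0 < γ.τ) (hτ₂ : 0 < γ.τ₂) :
    ∃ Z : (Fin I₁ → ℝ) → ℝ≥0∞, ∀ F : Param I₁ I₂ → ℝ≥0∞, Measurable F →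
      ∫⁻ θ, F θ ∂((prior I₁ I₂ γ μpr τpr).withDensity (D.likelihood γ y))
        = ∫⁻ b, Z b * ∫⁻ z, F (D.draw₂ γ μpr τpr y (b, z)) ∂(blockNoise I₂)
          ∂(Measure.pi fun _ => gaussianReal 0 γ.τ₁⁻¹) := by
  choose Z hZ using fun b : Fin I₁ → ℝ =>
    lintegral_block D.lev₂ (fun n => y n - b (D.lev₁ n)) hτ hτ₂ μpr τpr
  refine ⟨Z, fun F hF => ?_⟩
  have hL := D.measurable_likelihood γ y
  have hm : Measurable fun x : ℝ × (Fin I₁ → ℝ) × (Fin I₂ → ℝ) => D.likelihood γ y x * F x := hL.mul hF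
  rw [D.lintegral_unnormalized hF, prior, lintegral_prod _ hm.aemeasurable]
  have h1 : ∀ a : ℝ, ∫⁻ x, D.likelihood γ y (a, x) * F (a, x)
      ∂((Measure.pi fun _ => gaussianReal 0 γ.τ₁⁻¹).prod (Measure.pi fun _ => gaussianReal 0 γ.τ₂⁻¹))
      = ∫⁻ b, ∫⁻ x, D.likelihood γ y (a, b, x) * F (a, b, x)
        ∂(Measure.pi fun _ => gaussianReal 0 γ.τ₂⁻¹) ∂(Measure.pi fun _ => gaussianReal 0 γ.τ₁⁻¹) :=
    fun a => lintegral_prod _ (hm.comp measurable_prodMk_left).aemeasurable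
  simp only [h1]
  have hm' : Measurable fun x : (ℝ × (Fin I₁ → ℝ)) × (Fin I₂ → ℝ) =>
      D.likelihood γ y (x.1.1, x.1.2, x.2) * F (x.1.1, x.1.2, x.2) := by
    have hre : Measurable fun x : (ℝ × (Fin I₁ → ℝ)) × (Fin I₂ → ℝ) =>
      ((x.1.1, x.1.2, x.2) : Param I₁ I₂) := by fun_prop
    exact hm.comp hre
  rw [lintegral_lintegral_swap (by
    exact (Measurable.lintegral_prod_right' hm').aemeasurable)]
  refine lintegral_congr fun b => ?_
  have h2 := hZ b (fun x => F (x.1, b, x.2)) (hF.comp (by fun_prop))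
  simp only [D.likelihood_eq₂]
  exact h2

theorem Design.lintegral_posterior (D : Design N I₁ I₂) (F : Param I₁ I₂ → ℝ≥0∞) :
    ∫⁻ θ, F θ ∂(D.posterior γ μpr τpr y)
      = ((prior I₁ I₂ γ μpr τpr).withDensity (D.likelihood γ y) Set.univ)⁻¹ *
        ∫⁻ θ, F θ ∂((prior I₁ I₂ γ μpr τpr).withDensity (D.likelihood γ y)) := by
  rw [posterior, ProbabilityTheory.cond, Measure.restrict_univ, lintegral_smul_measure, smul_eq_mul]

/-- The draw leaves `a²` unchanged and its noise has total mass one, so averaging over a second draw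
changes nothing; this is the criterion of `blockUpdate_ae_eq_noiseKernel`. -/
theorem Design.blockUpdate_ae_eq₁ (hτ : 0 < γ.τ) (hτ₁ : 0 < γ.τ₁) :
    ∀ᵐ θ ∂(D.posterior γ μpr τpr y),
      blockUpdate (D.posterior γ μpr τpr y) (fun θ : Param I₁ I₂ => θ.2.2)
        (measurable_snd.comp measurable_snd) θ
      = noiseKernel (blockNoise I₁) (D.draw₁ γ μpr τpr y) θ.2.2 := by
  obtain ⟨Z, hZ⟩ := lintegral_unnormalized₁ (D := D) (y := y) (μpr := μpr) (τpr := τpr) hτ hτ₁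
  have hd := D.measurable_draw₁ γ μpr τpr y
  have hX : Measurable fun θ : Param I₁ I₂ => θ.2.2 := measurable_snd.comp measurable_snd
  refine blockUpdate_ae_eq_noiseKernel (X := fun θ : Param I₁ I₂ => θ.2.2) hX hd fun F hF => ?_
  have hF1 : Measurable fun θ : Param I₁ I₂ => F (θ.2.2, θ) := hF.comp (hX.prodMk measurable_id)
  have hF2 : Measurable fun θ : Param I₁ I₂ =>
      ∫⁻ z, F (θ.2.2, D.draw₁ γ μpr τpr y (θ.2.2, z)) ∂(blockNoise I₁) := by
    refine Measurable.lintegral_prod_right' (f := fun x : Param I₁ I₂ × (ℝ × (Fin I₁ → ℝ)) =>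
      F (x.1.2.2, D.draw₁ γ μpr τpr y (x.1.2.2, x.2))) ?_
    have h1 : Measurable fun x : Param I₁ I₂ × (ℝ × (Fin I₁ → ℝ)) => (x.1.2.2, x.2) := by fun_prop
    exact hF.comp ((hX.comp measurable_fst).prodMk (hd.comp h1))
  rw [lintegral_posterior, lintegral_posterior, hZ _ hF1, hZ _ hF2]
  congr 1
  refine lintegral_congr fun b => ?_
  simp [Design.draw₁]

theorem Design.blockUpdate_ae_eq₂ (hτ : 0 < γ.τ) (hτ₂ : 0 < γ.τ₂) :
    ∀ᵐ θ ∂(D.posterior γ μpr τpr y),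
      blockUpdate (D.posterior γ μpr τpr y) (fun θ : Param I₁ I₂ => θ.2.1)
        (measurable_fst.comp measurable_snd) θ
      = noiseKernel (blockNoise I₂) (D.draw₂ γ μpr τpr y) θ.2.1 := by
  obtain ⟨Z, hZ⟩ := lintegral_unnormalized₂ (D := D) (y := y) (μpr := μpr) (τpr := τpr) hτ hτ₂
  have hd := D.measurable_draw₂ γ μpr τpr y
  have hX : Measurable fun θ : Param I₁ I₂ => θ.2.1 := measurable_fst.comp measurable_snd
  refine blockUpdate_ae_eq_noiseKernel (X := fun θ : Param I₁ I₂ => θ.2.1) hX hd fun F hF => ?_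
  have hF1 : Measurable fun θ : Param I₁ I₂ => F (θ.2.1, θ) := hF.comp (hX.prodMk measurable_id)
  have hF2 : Measurable fun θ : Param I₁ I₂ =>
      ∫⁻ z, F (θ.2.1, D.draw₂ γ μpr τpr y (θ.2.1, z)) ∂(blockNoise I₂) := by
    refine Measurable.lintegral_prod_right' (f := fun x : Param I₁ I₂ × (ℝ × (Fin I₂ → ℝ)) =>
      F (x.1.2.1, D.draw₂ γ μpr τpr y (x.1.2.1, x.2))) ?_
    have h1 : Measurable fun x : Param I₁ I₂ × (ℝ × (Fin I₂ → ℝ)) => (x.1.2.1, x.2) := by fun_prop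
    exact hF.comp ((hX.comp measurable_fst).prodMk (hd.comp h1))
  rw [lintegral_posterior, lintegral_posterior, hZ _ hF1, hZ _ hF2]
  congr 1
  refine lintegral_congr fun b => ?_
  simp [Design.draw₂]

theorem lintegral_globalPrior_le (μpr : ℝ) (τpr : ℝ≥0) : ∃ A : ℝ≥0, ∀ g : ℝ → ℝ≥0∞, Measurable g →
    ∫⁻ a, g a ∂(globalPrior μpr τpr) ≤ A * ∫⁻ a, g a := by
  obtain ⟨A, hA, hprior⟩ := globalPrior_eq_gaussDensity μpr τpr
  refine ⟨(A * Real.exp (τpr * μpr ^ 2 / 2)).toNNReal, fun g hg => ?_⟩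
  rw [hprior, gaussDensity, lintegral_withDensity_eq_lintegral_mul _ (by fun_prop) hg,
    ← lintegral_const_mul _ hg]
  refine lintegral_mono fun a => ?_
  rw [Pi.mul_apply]
  refine mul_le_mul_left (ENNReal.ofReal_le_ofReal ?_) _
  gcongr
  have : 0 ≤ (τpr : ℝ) * (a - μpr) ^ 2 := by positivity
  nlinarith

theorem gaussianPDF_le (m : ℝ) (v : ℝ≥0) (x : ℝ) :
    gaussianPDF m v x ≤ ENNReal.ofReal (√(2 * Real.pi * v))⁻¹ := by
  refine ENNReal.ofReal_le_ofReal ?_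
  refine mul_le_of_le_one_right (by positivity) (Real.exp_le_one_iff.2 ?_)
  rw [neg_div, neg_nonpos]
  positivity

theorem gaussianPDF_swap (m : ℝ) (v : ℝ≥0) (x : ℝ) : gaussianPDF m v x = gaussianPDF x v m := by
  simp only [gaussianPDF, gaussianPDFReal]
  congr 4
  ring

/-- One observation is kept as a Gaussian density in `a`, which integrates to one even under the
flat prior; the other `N - 1` factors are bounded by their maximum. -/
theorem Design.lintegral_likelihood_le (D : Design N I₁ I₂) (hτ : 0 < γ.τ) :
    ∃ C : ℝ≥0, ∀ x : (Fin I₁ → ℝ) × (Fin I₂ → ℝ),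
      ∫⁻ a, D.likelihood γ y (a, x) ∂(globalPrior μpr τpr) ≤ C := by
  obtain ⟨A, hA⟩ := lintegral_globalPrior_le μpr τpr
  set M : ℝ≥0 := (√(2 * Real.pi * (γ.τ⁻¹ : ℝ≥0)))⁻¹.toNNReal with hM
  refine ⟨A * M ^ (N - 1), fun x => ?_⟩
  let n₀ : Fin N := ⟨0, NeZero.pos N⟩
  have hL : Measurable fun a => D.likelihood γ y (a, x) :=
    (D.measurable_likelihood γ y).comp measurable_prodMk_right
  refine (hA _ hL).trans ?_
  push_cast
  gcongr
  have hle : ∀ a : ℝ, D.likelihood γ y (a, x)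
      ≤ (M : ℝ≥0∞) ^ (N - 1) *
        gaussianPDF (y n₀ - (x.1 (D.lev₁ n₀) + x.2 (D.lev₂ n₀))) γ.τ⁻¹ a := by
    intro a
    rw [likelihood, ← Finset.mul_prod_erase _ _ (Finset.mem_univ n₀), mul_comm]
    refine mul_le_mul' ?_ (le_of_eq ?_)
    · refine (Finset.prod_le_prod' fun n _ => gaussianPDF_le _ _ _).trans ?_
      rw [Finset.prod_const, Finset.card_erase_of_mem (Finset.mem_univ _), Finset.card_univ,
        Fintype.card_fin]
      rfl
    · rw [gaussianPDF_swap _ _ a, ← gaussianPDF_add_left, predictor, add_assoc]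
  refine (lintegral_mono hle).trans ?_
  rw [lintegral_const_mul _ (measurable_gaussianPDF _ _), lintegral_gaussianPDF_eq_one _ (by
    simpa using hτ.ne'), mul_one]

/-- The effects have, up to a constant, at most their Gaussian prior mass. Both properness of the
posterior and second moments of the effects follow from this domination. -/
theorem Design.lintegral_unnormalized_le (D : Design N I₁ I₂) (hτ : 0 < γ.τ) :
    ∃ C : ℝ≥0, ∀ H : (Fin I₁ → ℝ) × (Fin I₂ → ℝ) → ℝ≥0∞, Measurable H →
      ∫⁻ θ : Param I₁ I₂, H θ.2 ∂((prior I₁ I₂ γ μpr τpr).withDensity (D.likelihood γ y))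
        ≤ C * ∫⁻ x, H x ∂((Measure.pi fun _ => gaussianReal 0 γ.τ₁⁻¹).prod
          (Measure.pi fun _ => gaussianReal 0 γ.τ₂⁻¹)) := by
  obtain ⟨C, hC⟩ := D.lintegral_likelihood_le (γ := γ) (μpr := μpr) (τpr := τpr) (y := y) hτ
  refine ⟨C, fun H hH => ?_⟩
  have hH2 : Measurable fun θ : Param I₁ I₂ => H θ.2 := hH.comp measurable_snd
  have hL := D.measurable_likelihood γ y
  have hm : Measurable fun θ : Param I₁ I₂ => D.likelihood γ y θ * H θ.2 := hL.mul hH2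
  rw [D.lintegral_unnormalized hH2, prior, lintegral_prod_symm' _ hm,
    ← lintegral_const_mul _ hH]
  refine lintegral_mono fun x => ?_
  have hLx : Measurable fun a => D.likelihood γ y (a, x) := hL.comp measurable_prodMk_right
  dsimp only
  rw [lintegral_mul_const _ hLx]
  gcongr
  exact hC x

theorem globalPrior_ne_zero : globalPrior μpr τpr ≠ 0 := by
  rw [globalPrior]
  split_ifs
  · exact NeZero.ne volume
  · exact IsProbabilityMeasure.ne_zero _

theorem Design.likelihood_ne_zero (hτ : 0 < γ.τ) (θ : Param I₁ I₂) : D.likelihood γ y θ ≠ 0 :=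
  Finset.prod_ne_zero_iff.2 fun _ _ => (gaussianPDF_pos _ (by simpa using hτ.ne') _).ne'

theorem prior_absolutelyContinuous (D : Design N I₁ I₂) (hτ : 0 < γ.τ) :
    prior I₁ I₂ γ μpr τpr ≪ (prior I₁ I₂ γ μpr τpr).withDensity (D.likelihood γ y) :=
  withDensity_absolutelyContinuous' (D.measurable_likelihood γ y).aemeasurable
    (Filter.Eventually.of_forall fun θ => D.likelihood_ne_zero hτ θ)

theorem Design.unnormalized_univ_ne_top (D : Design N I₁ I₂) (hτ : 0 < γ.τ) :
    (prior I₁ I₂ γ μpr τpr).withDensity (D.likelihood γ y) Set.univ ≠ ∞ := by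
  obtain ⟨C, hC⟩ := D.lintegral_unnormalized_le (γ := γ) (μpr := μpr) (τpr := τpr) (y := y) hτ
  have h := hC (fun _ => 1) measurable_const
  simp only [lintegral_one, measure_univ, mul_one] at h
  exact ne_top_of_le_ne_top ENNReal.coe_ne_top h

theorem Design.isProbabilityMeasure_posterior (D : Design N I₁ I₂) (hτ : 0 < γ.τ) :
    IsProbabilityMeasure (D.posterior γ μpr τpr y) := by
  refine cond_isProbabilityMeasure_of_finite (fun h => ?_) (D.unnormalized_univ_ne_top hτ)
  have h1 := prior_absolutelyContinuous (y := y) (μpr := μpr) (τpr := τpr) D hτ h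
  rw [prior, ← Set.univ_prod_univ, Measure.prod_prod, mul_eq_zero, Measure.measure_univ_eq_zero] at h1
  rcases h1 with h1 | h1
  · exact globalPrior_ne_zero h1
  · rw [measure_univ] at h1
    exact one_ne_zero h1

/-- The likelihood never vanishes, so posterior-null sets are prior-null. Nondegeneracy of linear
statistics can thus be checked under the product Gaussian prior. -/
theorem Design.ae_pi_of_ae_posterior (D : Design N I₁ I₂) (hτ : 0 < γ.τ)
    {p : (Fin I₂ → ℝ) → Prop} (h : ∀ᵐ θ ∂(D.posterior γ μpr τpr y), p θ.2.2) :
    ∀ᵐ b ∂(Measure.pi fun _ : Fin I₂ => gaussianReal 0 γ.τ₂⁻¹), p b := by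
  have h1 : ∀ᵐ θ ∂(prior I₁ I₂ γ μpr τpr), p θ.2.2 := by
    refine (prior_absolutelyContinuous (y := y) D hτ).ae_le ?_
    rw [posterior, ProbabilityTheory.cond, Measure.restrict_univ, Measure.ae_ennreal_smul_measure_iff (by
      simpa using D.unnormalized_univ_ne_top hτ)] at h
    exact h
  have : (MeasureTheory.ae (globalPrior μpr τpr)).NeBot := ae_neBot.2 globalPrior_ne_zero
  obtain ⟨a, ha⟩ := (Measure.ae_ae_of_ae_prod h1).exists
  obtain ⟨x, hx⟩ := (Measure.ae_ae_of_ae_prod ha).exists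
  exact hx

theorem Design.memLp_effect₂ (D : Design N I₁ I₂) (hτ : 0 < γ.τ) (j : Fin I₂) :
    MemLp (fun θ : Param I₁ I₂ => θ.2.2 j) 2 (D.posterior γ μpr τpr y) := by
  have hm : Measurable fun θ : Param I₁ I₂ => θ.2.2 j := by fun_prop
  refine ⟨hm.aestronglyMeasurable, ?_⟩
  rw [eLpNorm_lt_top_iff_lintegral_rpow_enorm_lt_top (by norm_num) (by norm_num),
    lintegral_posterior]
  obtain ⟨C, hC⟩ := D.lintegral_unnormalized_le (γ := γ) (μpr := μpr) (τpr := τpr) (y := y) hτ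
  have h0 : (prior I₁ I₂ γ μpr τpr).withDensity (D.likelihood γ y) Set.univ ≠ 0 := by
    have := D.isProbabilityMeasure_posterior (γ := γ) (μpr := μpr) (τpr := τpr) (y := y) hτ
    intro h0
    have h1 : D.posterior γ μpr τpr y Set.univ = 1 := measure_univ
    rw [posterior, cond_apply MeasurableSet.univ, Set.univ_inter, h0, mul_zero] at h1
    exact zero_ne_one h1
  refine ENNReal.mul_lt_top (by simpa using pos_iff_ne_zero.2 h0) ((hC (fun x => ‖x.2 j‖ₑ ^ (2 : ℝ≥0∞).toReal)
    (by fun_prop)).trans_lt (ENNReal.mul_lt_top ENNReal.coe_lt_top ?_))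
  rw [lintegral_prod_symm' _ (by fun_prop)]
  simp only [lintegral_const, measure_univ, mul_one]
  have h1 : MemLp (fun x : Fin I₂ → ℝ => x j) 2 (Measure.pi fun _ => gaussianReal 0 γ.τ₂⁻¹) :=
    (memLp_id_gaussianReal' (μ := 0) (v := γ.τ₂⁻¹) 2 (by norm_num)).comp_measurePreserving
      (measurePreserving_eval _ j)
  exact (eLpNorm_lt_top_iff_lintegral_rpow_enorm_lt_top (by norm_num) (by norm_num)).1 h1.2

end Posterior

/-! ### Semantics of straight-line programs -/

section Exec

variable {R : Type} [DecidableEq R]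

theorem measurable_update_pair {ι : Type*} [DecidableEq ι] (d : ι) :
    Measurable fun x : (ι → ℝ) × ℝ => Function.update x.1 d x.2 := by
  refine measurable_pi_iff.2 fun r => ?_
  by_cases h : r = d
  · subst h; simpa using measurable_snd
  · have h' : Measurable fun x : (ι → ℝ) × ℝ => x.1 r := (measurable_pi_apply r).comp measurable_fst
    simpa [Function.update_of_ne h] using h'

theorem exec_append (p q : List (Instr R)) : exec (p ++ q) = exec q ∘ₖ exec p := by
  induction p with
  | nil => exact (Kernel.comp_id _).symm
  | cons i p ih =>
    change exec (p ++ q) ∘ₖ i.step = exec q ∘ₖ (exec p ∘ₖ i.step)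
    rw [ih, Kernel.comp_assoc]

theorem exec_assign (d : R) (g : (R → ℝ) → ℝ) (hg : Measurable g) (p : List (Instr R))
    (s : R → ℝ) : (exec p ∘ₖ assign d g hg) s = exec p (Function.update s d (g s)) := by
  rw [assign, Kernel.comp_deterministic_eq_comap, Kernel.comap_apply]

variable (p : List (Instr R)) (s : R → ℝ) (d a b : R)

theorem exec_const (c : ℝ) : exec (.const d c :: p) s = exec p (Function.update s d c) :=
  exec_assign d _ measurable_const p s

theorem exec_add : exec (.add d a b :: p) s = exec p (Function.update s d (s a + s b)) :=
  exec_assign d _ (by fun_prop) p s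

theorem exec_sub : exec (.sub d a b :: p) s = exec p (Function.update s d (s a - s b)) :=
  exec_assign d _ (by fun_prop) p s

theorem exec_mul : exec (.mul d a b :: p) s = exec p (Function.update s d (s a * s b)) :=
  exec_assign d _ (by fun_prop) p s

theorem exec_div : exec (.div d a b :: p) s = exec p (Function.update s d (s a / s b)) :=
  exec_assign d _ (by fun_prop) p s

theorem exec_sqrt : exec (.sqrt d a :: p) s = exec p (Function.update s d (√(s a))) :=
  exec_assign d _ (by fun_prop) p s

theorem lintegral_exec_gauss {F : (R → ℝ) → ℝ≥0∞} (hF : Measurable F) :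
    ∫⁻ w, F w ∂(exec (.gauss d :: p) s)
      = ∫⁻ x, ∫⁻ w, F w ∂(exec p (Function.update s d x)) ∂(gaussianReal 0 1) := by
  have h : (Instr.gauss d).step = noiseKernel (gaussianReal 0 1)
      (fun x : (R → ℝ) × ℝ => Function.update x.1 d x.2) := rfl
  change ∫⁻ w, F w ∂((exec p ∘ₖ (Instr.gauss d).step) s) = _
  rw [Kernel.lintegral_comp _ _ _ hF, h, lintegral_noiseKernel (measurable_update_pair d) _
    hF.lintegral_kernel]

theorem lintegral_exec_nil {F : (R → ℝ) → ℝ≥0∞} (hF : Measurable F) :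
    ∫⁻ w, F w ∂(exec [] s) = F s := by
  change ∫⁻ w, F w ∂(Kernel.id s) = _
  rw [Kernel.id_apply, lintegral_dirac' _ hF]

end Exec

/-! ### The program for one block update -/

section BlockProgram

/-- A product measure is unchanged when one coordinate is replaced by an independent copy. This
reconciles the fresh draws of a loop with a single integral over all coordinates. -/
theorem pi_resample {ι : Type*} [Fintype ι] [DecidableEq ι] (ν : Measure ℝ)
    [IsProbabilityMeasure ν] (i : ι) {H : (ι → ℝ) → ℝ≥0∞} (hH : Measurable H) :
    ∫⁻ x, ∫⁻ z, H (Function.update z i x) ∂(Measure.pi fun _ => ν) ∂ν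
      = ∫⁻ z, H z ∂(Measure.pi fun _ => ν) := by
  have hm : Measurable fun x : ℝ × (ι → ℝ) => Function.update x.2 i x.1 :=
    (measurable_update_pair i).comp measurable_swap
  have hmap : Measure.pi (fun _ : ι => ν)
      = (ν.prod (Measure.pi fun _ => ν)).map fun x => Function.update x.2 i x.1 := by
    refine Measure.pi_eq fun s hs => ?_
    rw [Measure.map_apply hm (MeasurableSet.univ_pi hs)]
    have hpre : (fun x : ℝ × (ι → ℝ) => Function.update x.2 i x.1) ⁻¹' Set.univ.pi s
        = s i ×ˢ Set.univ.pi (Function.update s i Set.univ) := by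
      ext x
      simp only [Set.mem_preimage, Set.mem_pi, Set.mem_univ, true_implies, Set.mem_prod]
      constructor
      · intro h
        refine ⟨by simpa using h i, fun k => ?_⟩
        by_cases hk : k = i
        · subst hk; simp
        · simpa [Function.update_of_ne hk] using h k
      · rintro ⟨h1, h2⟩ k
        by_cases hk : k = i
        · subst hk; simpa using h1
        · simpa [Function.update_of_ne hk] using h2 k
    rw [hpre, Measure.prod_prod, Measure.pi_pi, ← Finset.mul_prod_erase _ _ (Finset.mem_univ i),
      ← Finset.mul_prod_erase _ _ (Finset.mem_univ i)]
    rw [Function.update_self, measure_univ, one_mul]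
    congr 1
    refine Finset.prod_congr rfl fun k hk => ?_
    rw [Function.update_of_ne (Finset.ne_of_mem_erase hk)]
  conv_rhs => rw [hmap]
  have hHm : Measurable fun x : ℝ × (ι → ℝ) => H (Function.update x.2 i x.1) := hH.comp hm
  rw [lintegral_map hH hm, lintegral_prod _ hHm.aemeasurable]

variable {N I₁ I₂ : ℕ}

open Instr Reg

/-- Deterministic code is summarized by one final memory, valid for every continuation `q`, together
with the registers it leaves untouched. The next two lemmas have the same form. -/
theorem exec_reset (l : List (Fin I₁)) (s : Reg N I₁ I₂ → ℝ) :
    ∃ s' : Reg N I₁ I₂ → ℝ,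
      (∀ q, exec (l.flatMap (fun i => [const (sum₁ i) 0, const (cnt₁ i) 0]) ++ q) s = exec q s') ∧
      (∀ i, s' (sum₁ i) = if i ∈ l then 0 else s (sum₁ i)) ∧
      (∀ i, s' (cnt₁ i) = if i ∈ l then 0 else s (cnt₁ i)) ∧
      ∀ r, (∀ i, r ≠ sum₁ i) → (∀ i, r ≠ cnt₁ i) → s' r = s r := by
  induction l generalizing s with
  | nil => exact ⟨s, fun q => rfl, by simp, by simp, fun r _ _ => rfl⟩
  | cons k l ih =>
    obtain ⟨s', h1, h2, h3, h4⟩ := ih (Function.update (Function.update s (sum₁ k) 0) (cnt₁ k) 0)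
    refine ⟨s', fun q => ?_, fun i => ?_, fun i => ?_, fun r hr hr' => ?_⟩
    · rw [List.flatMap_cons, List.append_assoc, List.cons_append, List.cons_append,
        List.nil_append, exec_const, exec_const, h1]
    · rw [h2]
      by_cases hi : i = k <;> simp [hi]
    · rw [h3]
      by_cases hi : i = k <;> simp [hi]
    · rw [h4 r hr hr', Function.update_of_ne (hr' k), Function.update_of_ne (hr k)]

theorem exec_pass (lev : Fin N → Fin I₁) (lev' : Fin N → Fin I₂) (l : List (Fin N))
    (s : Reg N I₁ I₂ → ℝ) :
    ∃ s' : Reg N I₁ I₂ → ℝ,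
      (∀ q, exec (l.flatMap (fun n =>
        [sub v (data n) (a₂ (lev' n)),
         add (sum₁ (lev n)) (sum₁ (lev n)) v,
         add (cnt₁ (lev n)) (cnt₁ (lev n)) one]) ++ q) s = exec q s') ∧
      (∀ i, s' (sum₁ i) = s (sum₁ i)
        + (l.map fun n => if lev n = i then s (data n) - s (a₂ (lev' n)) else 0).sum) ∧
      (∀ i, s' (cnt₁ i) = s (cnt₁ i) + (l.map fun n => if lev n = i then s one else 0).sum) ∧
      ∀ r, (∀ i, r ≠ sum₁ i) → (∀ i, r ≠ cnt₁ i) → r ≠ v → s' r = s r := by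
  induction l generalizing s with
  | nil => exact ⟨s, fun q => rfl, by simp, by simp, fun r _ _ _ => rfl⟩
  | cons k l ih =>
    set s₁ := Function.update s v (s (data k) - s (a₂ (lev' k))) with hs₁
    set s₂ := Function.update s₁ (sum₁ (lev k)) (s₁ (sum₁ (lev k)) + s₁ v) with hs₂
    set s₃ := Function.update s₂ (cnt₁ (lev k)) (s₂ (cnt₁ (lev k)) + s₂ one) with hs₃
    obtain ⟨s', h1, h2, h3, h4⟩ := ih s₃
    refine ⟨s', fun q => ?_, fun i => ?_, fun i => ?_, fun r hr hr' hv => ?_⟩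
    · rw [List.flatMap_cons, List.append_assoc, List.cons_append, List.cons_append,
        List.cons_append, List.nil_append, exec_sub, exec_add, exec_add, h1]
    · rw [h2]
      by_cases hi : lev k = i
      · subst hi; simp [hs₁, hs₂, hs₃]; ring
      · simp [hs₁, hs₂, hs₃, hi, Ne.symm hi]
    · rw [h3]
      by_cases hi : lev k = i
      · subst hi; simp [hs₁, hs₂, hs₃]; ring
      · simp [hs₁, hs₂, hs₃, hi, Ne.symm hi]
    · rw [h4 r hr hr' hv, hs₃, Function.update_of_ne (hr' _), hs₂, Function.update_of_ne (hr _),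
        hs₁, Function.update_of_ne hv]

theorem exec_accumulate (l : List (Fin I₁)) (s : Reg N I₁ I₂ → ℝ) :
    ∃ s' : Reg N I₁ I₂ → ℝ,
      (∀ q, exec (l.flatMap (fun i =>
        [mul u (cnt₁ i) lik, add u u fac, div u fac u, mul u u lik,
         mul v u (sum₁ i), add lin lin v,
         mul v u (cnt₁ i), add prec prec v]) ++ q) s = exec q s') ∧
      s' lin = s lin + (l.map fun i => s fac / (s (cnt₁ i) * s lik + s fac) * s lik * s (sum₁ i)).sum ∧
      s' prec = s prec
        + (l.map fun i => s fac / (s (cnt₁ i) * s lik + s fac) * s lik * s (cnt₁ i)).sum ∧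
      ∀ r, r ≠ lin → r ≠ prec → r ≠ u → r ≠ v → s' r = s r := by
  induction l generalizing s with
  | nil => exact ⟨s, fun q => rfl, by simp, by simp, fun r _ _ _ _ => rfl⟩
  | cons k l ih =>
    set s₁ := Function.update s u (s (cnt₁ k) * s lik) with hs₁
    set s₂ := Function.update s₁ u (s₁ u + s₁ fac) with hs₂
    set s₃ := Function.update s₂ u (s₂ fac / s₂ u) with hs₃
    set s₄ := Function.update s₃ u (s₃ u * s₃ lik) with hs₄
    set s₅ := Function.update s₄ v (s₄ u * s₄ (sum₁ k)) with hs₅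
    set s₆ := Function.update s₅ lin (s₅ lin + s₅ v) with hs₆
    set s₇ := Function.update s₆ v (s₆ u * s₆ (cnt₁ k)) with hs₇
    set s₈ := Function.update s₇ prec (s₇ prec + s₇ v) with hs₈
    obtain ⟨s', h1, h2, h3, h4⟩ := ih s₈
    refine ⟨s', fun q => ?_, ?_, ?_, fun r hr hr' hu hv => ?_⟩
    · rw [List.flatMap_cons, List.append_assoc]
      simp only [List.cons_append, List.nil_append]
      rw [exec_mul, exec_add, exec_div, exec_mul, exec_mul, exec_add, exec_mul, exec_add, h1]
    · rw [h2]
      simp [hs₁, hs₂, hs₃, hs₄, hs₅, hs₆, hs₇, hs₈]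
      ring
    · rw [h3]
      simp [hs₁, hs₂, hs₃, hs₄, hs₅, hs₆, hs₇, hs₈]
      ring
    · rw [h4 r hr hr' hu hv]
      simp [hs₁, hs₂, hs₃, hs₄, hs₅, hs₆, hs₇, hs₈, hr, hr', hu, hv]

/-- The part of the memory that a block update reads and writes: data and parameters. -/
def view (s : Reg N I₁ I₂ → ℝ) : (Fin N → ℝ) × Param I₁ I₂ := (fun n => s (data n), readParam s)

theorem measurable_view : Measurable (view : (Reg N I₁ I₂ → ℝ) → _) := by
  unfold view readParam
  fun_prop

/-- Induction over the levels, integrating over noise for all of them although only those in `l` use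
theirs. `Nodup` ensures that an effect already drawn is not overwritten. -/
theorem lintegral_exec_effects (l : List (Fin I₁)) (hl : l.Nodup) (s : Reg N I₁ I₂ → ℝ)
    {G : (Fin N → ℝ) × Param I₁ I₂ → ℝ≥0∞} (hG : Measurable G) :
    ∫⁻ w, G (view w) ∂(exec (l.flatMap (fun i =>
      [mul u (cnt₁ i) lik, add u u fac,
       mul v (cnt₁ i) a₀, sub v (sum₁ i) v, mul v v lik, div v v u,
       gauss z, sqrt u u, div z z u, add (a₁ i) v z])) s)
    = ∫⁻ x, G (fun n => s (data n), s a₀, (fun i => if i ∈ l then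
        (s (sum₁ i) - s (cnt₁ i) * s a₀) * s lik / (s (cnt₁ i) * s lik + s fac)
          + x i / √(s (cnt₁ i) * s lik + s fac) else s (a₁ i)), fun j => s (a₂ j))
      ∂(Measure.pi fun _ => gaussianReal 0 1) := by
  have hGv : Measurable fun w : Reg N I₁ I₂ → ℝ => G (view w) := hG.comp measurable_view
  induction l generalizing s with
  | nil =>
    simp only [List.flatMap_nil, List.not_mem_nil, if_false]
    rw [lintegral_exec_nil _ hGv]
    simp [view, readParam]
  | cons k l ih =>
    have hk : k ∉ l := (List.nodup_cons.1 hl).1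
    set s₁ := Function.update s u (s (cnt₁ k) * s lik) with hs₁
    set s₂ := Function.update s₁ u (s₁ u + s₁ fac) with hs₂
    set s₃ := Function.update s₂ v (s₂ (cnt₁ k) * s₂ a₀) with hs₃
    set s₄ := Function.update s₃ v (s₃ (sum₁ k) - s₃ v) with hs₄
    set s₅ := Function.update s₄ v (s₄ v * s₄ lik) with hs₅
    set s₆ := Function.update s₅ v (s₅ v / s₅ u) with hs₆
    let t₁ : ℝ → Reg N I₁ I₂ → ℝ := fun x => Function.update s₆ z x
    let t₂ : ℝ → Reg N I₁ I₂ → ℝ := fun x => Function.update (t₁ x) u (√(t₁ x u))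
    let t₃ : ℝ → Reg N I₁ I₂ → ℝ := fun x => Function.update (t₂ x) z (t₂ x z / t₂ x u)
    let t₄ : ℝ → Reg N I₁ I₂ → ℝ := fun x => Function.update (t₃ x) (a₁ k) (t₃ x v + t₃ x z)
    have hrun : ∀ x w, w = t₄ x → (∀ n, w (data n) = s (data n)) ∧ w a₀ = s a₀ ∧
        w lik = s lik ∧ w fac = s fac ∧ (∀ i, w (sum₁ i) = s (sum₁ i)) ∧
        (∀ i, w (cnt₁ i) = s (cnt₁ i)) ∧ (∀ j, w (a₂ j) = s (a₂ j)) ∧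
        ∀ i, w (a₁ i) = if i = k then
          (s (sum₁ k) - s (cnt₁ k) * s a₀) * s lik / (s (cnt₁ k) * s lik + s fac)
          + x / √(s (cnt₁ k) * s lik + s fac) else s (a₁ i) := by
      rintro x w rfl
      refine ⟨?_, ?_, ?_, ?_, ?_, ?_, ?_, ?_⟩
      all_goals
        simp [t₄, t₃, t₂, t₁, hs₁, hs₂, hs₃, hs₄, hs₅, hs₆, Function.update_apply]
    rw [List.flatMap_cons]
    simp only [List.cons_append, List.nil_append]
    rw [exec_mul, exec_add, exec_mul, exec_sub, exec_mul, exec_div,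
      lintegral_exec_gauss _ _ _ hGv]
    -- Separates the noise of level `k` from the rest, to match it with the draw made by this pass
    -- of the loop.
    rw [← pi_resample (gaussianReal 0 1) k]
    · refine lintegral_congr fun x => ?_
      rw [exec_sqrt, exec_div, exec_add]
      obtain ⟨h1, h2, h3, h4, h5, h6, h7, h8⟩ := hrun x _ rfl
      refine (ih (List.nodup_cons.1 hl).2 (t₄ x)).trans (lintegral_congr fun x' => ?_)
      simp only [h1, h2, h3, h4, h5, h6, h7]
      congr 4
      funext i
      rw [h8]
      by_cases hi : i = k
      · subst hi; simp [hk]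
      · simp [hi]
    · refine hG.comp ?_
      refine measurable_const.prodMk (measurable_const.prodMk (Measurable.prodMk ?_ measurable_const))
      refine measurable_pi_iff.2 fun i => ?_
      split_ifs <;> fun_prop

/-- The initial scratch memory is irrelevant, since constants are reloaded and accumulators reset;
hence two blocks can be chained. The data stay in the view because the second block reads them. -/
theorem lintegral_exec_blockProgram₁ (lev : Fin N → Fin I₁) (lev' : Fin N → Fin I₂)
    (τ τk μpr τpr : ℝ) (s : Reg N I₁ I₂ → ℝ)
    {G : (Fin N → ℝ) × Param I₁ I₂ → ℝ≥0∞} (hG : Measurable G) :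
    ∫⁻ w, G (view w) ∂(exec (blockProgram lev lev' a₁ sum₁ cnt₁ a₂ τ τk μpr τpr) s)
    = ∫⁻ x, G (fun n => s (data n),
        (blockDraw lev τ τk μpr τpr (fun n => s (data n) - s (a₂ (lev' n))) x).1,
        (blockDraw lev τ τk μpr τpr (fun n => s (data n) - s (a₂ (lev' n))) x).2,
        fun j => s (a₂ j)) ∂(blockNoise I₁) := by
  have hGv : Measurable fun w : Reg N I₁ I₂ → ℝ => G (view w) := hG.comp measurable_view
  set s₁ := Function.update s lik τ with hs₁
  set s₂ := Function.update s₁ fac τk with hs₂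
  set s₃ := Function.update s₂ one 1 with hs₃
  set s₄ := Function.update s₃ prec τpr with hs₄
  set s₅ := Function.update s₄ lin μpr with hs₅
  set s₆ := Function.update s₅ lin (s₅ lin * s₅ prec) with hs₆
  obtain ⟨s', hex', hsum', hcnt', hr'⟩ := exec_reset (List.finRange I₁) s₆
  obtain ⟨w, hexw, hsumw, hcntw, hrw⟩ := exec_pass lev lev' (List.finRange N) s'
  obtain ⟨t, hext, hlint, hprect, hrt⟩ := exec_accumulate (List.finRange I₁) w
  have hw : ∀ r, (∀ i, r ≠ sum₁ i) → (∀ i, r ≠ cnt₁ i) → r ≠ v → w r = s₆ r :=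
    fun r h1 h2 h3 => (hrw r h1 h2 h3).trans (hr' r h1 h2)
  have e1 : w lik = τ := by rw [hw] <;> simp [hs₁, hs₂, hs₃, hs₄, hs₅, hs₆]
  have e2 : w fac = τk := by rw [hw] <;> simp [hs₁, hs₂, hs₃, hs₄, hs₅, hs₆]
  have e3 : w prec = τpr := by rw [hw] <;> simp [hs₁, hs₂, hs₃, hs₄, hs₅, hs₆]
  have e4 : w lin = μpr * τpr := by rw [hw] <;> simp [hs₁, hs₂, hs₃, hs₄, hs₅, hs₆]
  have e5 : ∀ n, s' (data n) = s (data n) := fun n => by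
    rw [hr'] <;> simp [hs₁, hs₂, hs₃, hs₄, hs₅, hs₆]
  have e6 : ∀ j, s' (a₂ j) = s (a₂ j) := fun j => by
    rw [hr'] <;> simp [hs₁, hs₂, hs₃, hs₄, hs₅, hs₆]
  have e7 : s' one = 1 := by
    rw [hr'] <;> simp [hs₁, hs₂, hs₃, hs₄, hs₅, hs₆]
  set r : Fin N → ℝ := fun n => s (data n) - s (a₂ (lev' n)) with hr
  have e8 : ∀ i, w (sum₁ i) = levelSum lev r i := fun i => by
    rw [hsumw, hsum', if_pos (List.mem_finRange i), zero_add, levelSum, ← List.sum_ofFn,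
      List.ofFn_eq_map]
    simp only [e5, e6, hr]
  have e9 : ∀ i, w (cnt₁ i) = levelCount lev i := fun i => by
    rw [hcntw, hcnt', if_pos (List.mem_finRange i), zero_add, levelCount, ← List.sum_ofFn,
      List.ofFn_eq_map]
    simp only [e7]
  have e10 : t lin = globalLin lev τ τk μpr τpr r := by
    rw [hlint, globalLin, ← List.sum_ofFn, List.ofFn_eq_map, e4]
    simp only [e1, e2, e8, e9, levelWeight, levelPrec]
  have e11 : t prec = globalPrec lev τ τk τpr := by
    rw [hprect, globalPrec, ← List.sum_ofFn, List.ofFn_eq_map, e3]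
    simp only [e1, e2, e9, levelWeight, levelPrec]
  have f1 : t lik = τ := by rw [hrt, e1] <;> simp
  have f2 : t fac = τk := by rw [hrt, e2] <;> simp
  have f3 : ∀ n, t (data n) = s (data n) := fun n => by
    rw [hrt, hrw, e5] <;> simp
  have f4 : ∀ j, t (a₂ j) = s (a₂ j) := fun n => by
    rw [hrt, hrw, e6] <;> simp
  have f5 : ∀ i, t (sum₁ i) = levelSum lev r i := fun i => by rw [hrt, e8] <;> simp
  have f6 : ∀ i, t (cnt₁ i) = levelCount lev i := fun i => by rw [hrt, e9] <;> simp
  rw [blockProgram]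
  simp only [List.append_assoc]
  simp only [List.cons_append, List.nil_append]
  rw [exec_const, exec_const, exec_const, exec_const, exec_const, exec_mul, hex', hexw, hext,
    lintegral_exec_gauss _ _ _ hGv]
  have hmeas : Measurable fun x : ℝ × (Fin I₁ → ℝ) => G (fun n => s (data n),
        (blockDraw lev τ τk μpr τpr r x).1, (blockDraw lev τ τk μpr τpr r x).2,
        fun j => s (a₂ j)) := by
    have h := measurable_blockDraw lev τ τk μpr τpr r
    exact hG.comp (measurable_const.prodMk (h.fst.prodMk (h.snd.prodMk measurable_const)))
  rw [blockNoise, lintegral_prod _ hmeas.aemeasurable]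
  refine lintegral_congr fun x => ?_
  rw [exec_sqrt, exec_div, exec_div, exec_add, lintegral_exec_effects _ (List.nodup_finRange I₁) _ hG]
  refine lintegral_congr fun x' => ?_
  simp [blockDraw, globalDraw, e10, e11, f1, f2, f3, f4, f5, f6]
  rfl

end BlockProgram

/-! ### Renaming registers -/

section Rename

variable {R S : Type} [DecidableEq R] [DecidableEq S]

/-- Rename the registers of an instruction. -/
def Instr.rename (e : R → S) : Instr R → Instr S
  | .const d c => .const (e d) c
  | .add d a b => .add (e d) (e a) (e b)
  | .sub d a b => .sub (e d) (e a) (e b)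
  | .mul d a b => .mul (e d) (e a) (e b)
  | .div d a b => .div (e d) (e a) (e b)
  | .sqrt d a => .sqrt (e d) (e a)
  | .gauss d => .gauss (e d)

/-- Execution commutes with a bijective renaming of registers, so the second factor's block inherits
the analysis of the first. -/
theorem lintegral_exec_rename (e : R ≃ S) (p : List (Instr R)) (s : S → ℝ)
    {F : (R → ℝ) → ℝ≥0∞} (hF : Measurable F) :
    ∫⁻ w, F (w ∘ e) ∂(exec (p.map (Instr.rename e)) s) = ∫⁻ w, F w ∂(exec p (s ∘ e)) := by
  have hFe : Measurable fun w : S → ℝ => F (w ∘ e) := by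
    refine hF.comp (measurable_pi_iff.2 fun r => ?_)
    exact measurable_pi_apply (e r)
  have hupd : ∀ (s : S → ℝ) (d : R) (x : ℝ),
      Function.update s (e d) x ∘ e = Function.update (s ∘ e) d x := fun s d x =>
    Function.update_comp_eq_of_injective _ e.injective _ _
  induction p generalizing s with
  | nil => rw [List.map_nil, lintegral_exec_nil _ hFe, lintegral_exec_nil _ hF]
  | cons i p ih =>
    rw [List.map_cons]
    cases i with
    | const d c => simp only [Instr.rename]; rw [exec_const, exec_const, ih, hupd]
    | add d a b => simp only [Instr.rename]; rw [exec_add, exec_add, ih, hupd]; rfl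
    | sub d a b => simp only [Instr.rename]; rw [exec_sub, exec_sub, ih, hupd]; rfl
    | mul d a b => simp only [Instr.rename]; rw [exec_mul, exec_mul, ih, hupd]; rfl
    | div d a b => simp only [Instr.rename]; rw [exec_div, exec_div, ih, hupd]; rfl
    | sqrt d a => simp only [Instr.rename]; rw [exec_sqrt, exec_sqrt, ih, hupd]; rfl
    | gauss d =>
      simp only [Instr.rename]
      rw [lintegral_exec_gauss _ _ _ hFe, lintegral_exec_gauss _ _ _ hF]
      refine lintegral_congr fun x => ?_
      rw [ih, hupd]

end Rename

/-! ### Symmetry between the two factors. -/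

section Swap

variable {N I₁ I₂ : ℕ}

open Instr Reg

/-- Exchange the roles of the two factors. -/
def Reg.swap : Reg N I₁ I₂ → Reg N I₂ I₁
  | data n => data n
  | a₀ => a₀
  | a₁ i => a₂ i
  | a₂ j => a₁ j
  | sum₁ i => sum₂ i
  | sum₂ j => sum₁ j
  | cnt₁ i => cnt₂ i
  | cnt₂ j => cnt₁ j
  | lik => lik
  | fac => fac
  | one => one
  | prec => prec
  | lin => lin
  | u => u
  | v => v
  | z => z

/-- Exchanging the factors as an equivalence. -/
def Reg.swapEquiv : Reg N I₁ I₂ ≃ Reg N I₂ I₁ where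
  toFun := Reg.swap
  invFun := Reg.swap
  left_inv r := by cases r <;> rfl
  right_inv r := by cases r <;> rfl

theorem blockProgram_swap (lev : Fin N → Fin I₂) (lev' : Fin N → Fin I₁) (τ τk μpr τpr : ℝ) :
    (blockProgram lev lev' (a₁ : _ → Reg N I₂ I₁) sum₁ cnt₁ a₂ τ τk μpr τpr).map
      (Instr.rename Reg.swapEquiv)
    = blockProgram lev lev' (a₂ : _ → Reg N I₁ I₂) sum₂ cnt₂ a₁ τ τk μpr τpr := by
  simp only [blockProgram, List.map_append, List.map_flatMap, List.map_cons, List.map_nil,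
    Instr.rename]
  rfl

theorem lintegral_exec_blockProgram₂ (lev : Fin N → Fin I₂) (lev' : Fin N → Fin I₁)
    (τ τk μpr τpr : ℝ) (s : Reg N I₁ I₂ → ℝ)
    {G : Param I₁ I₂ → ℝ≥0∞} (hG : Measurable G) :
    ∫⁻ w, G (readParam w) ∂(exec (blockProgram lev lev' a₂ sum₂ cnt₂ a₁ τ τk μpr τpr) s)
    = ∫⁻ x, G (
        (blockDraw lev τ τk μpr τpr (fun n => s (data n) - s (a₁ (lev' n))) x).1,
        (fun j => s (a₁ j)),
        (blockDraw lev τ τk μpr τpr (fun n => s (data n) - s (a₁ (lev' n))) x).2)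
        ∂(blockNoise I₂) := by
  rw [← blockProgram_swap]
  let G' : (Fin N → ℝ) × Param I₂ I₁ → ℝ≥0∞ := fun x => G (x.2.1, x.2.2.2, x.2.2.1)
  have hG' : Measurable G' := hG.comp (by fun_prop)
  exact (lintegral_exec_rename Reg.swapEquiv _ s (F := fun w => G' (view w))
    (hG'.comp measurable_view)).trans
    (lintegral_exec_blockProgram₁ lev lev' τ τk μpr τpr (s ∘ Reg.swapEquiv) hG')

end Swap

/-! ### The program for one iteration -/

section Iteration

variable {N I₁ I₂ : ℕ} {D : Design N I₁ I₂} {γ : Precisions} {μpr : ℝ} {τpr : ℝ≥0} {y : Fin N → ℝ}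

theorem Design.lintegral_iterationLaw (D : Design N I₁ I₂) (θ : Param I₁ I₂)
    {G : Param I₁ I₂ → ℝ≥0∞} (hG : Measurable G) :
    ∫⁻ w, G w ∂(D.iterationLaw γ μpr τpr y θ)
    = ∫⁻ x, ∫⁻ x', G (D.draw₂ γ μpr τpr y ((D.draw₁ γ μpr τpr y (θ.2.2, x)).2.1, x'))
        ∂(blockNoise I₂) ∂(blockNoise I₁) := by
  have hread : Measurable (readParam : (Reg N I₁ I₂ → ℝ) → _) := measurable_view.snd
  have hGr : Measurable fun w : Reg N I₁ I₂ → ℝ => G (readParam w) := hG.comp hread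
  rw [iterationLaw, lintegral_map hG hread, iteration, exec_append,
    Kernel.lintegral_comp _ _ _ hGr]
  simp_rw [lintegral_exec_blockProgram₂ _ _ _ _ _ _ _ hG]
  let H : (Fin N → ℝ) × Param I₁ I₂ → ℝ≥0∞ := fun q =>
    ∫⁻ x, G (D.draw₂ γ μpr τpr q.1 (q.2.2.1, x)) ∂(blockNoise I₂)
  have hH : Measurable H := by
    refine Measurable.lintegral_prod_right' (f := fun p : ((Fin N → ℝ) × Param I₁ I₂) ×
      (ℝ × (Fin I₂ → ℝ)) => G (D.draw₂ γ μpr τpr p.1.1 (p.1.2.2.1, p.2))) (hG.comp ?_)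
    have h : Measurable fun p : ((Fin N → ℝ) × Param I₁ I₂) × (ℝ × (Fin I₂ → ℝ)) =>
        ((fun n => p.1.1 n - p.1.2.2.1 (D.lev₁ n), p.2) : (Fin N → ℝ) × (ℝ × (Fin I₂ → ℝ))) := by
      fun_prop
    have h' := (measurable_blockDraw_uncurry D.lev₂ γ.τ γ.τ₂ μpr τpr).comp h
    exact h'.fst.prodMk (Measurable.prodMk (by fun_prop) h'.snd)
  exact lintegral_exec_blockProgram₁ D.lev₁ D.lev₂ γ.τ γ.τ₁ μpr τpr (loadMem y θ) hH

variable [NeZero N]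

/-- The second conditional law is known only for almost every state; invariance of the first update
makes this apply to almost every intermediate state. The null set is chosen before `G`, as equality
of measures requires. -/
theorem Design.lintegral_collapsedGibbs_ae (hτ : 0 < γ.τ) (hτ₁ : 0 < γ.τ₁) (hτ₂ : 0 < γ.τ₂) :
    ∀ᵐ θ ∂(D.posterior γ μpr τpr y), ∀ G : Param I₁ I₂ → ℝ≥0∞, Measurable G →
      ∫⁻ w, G w ∂(D.collapsedGibbs γ μpr τpr y θ)
      = ∫⁻ x, ∫⁻ x', G (D.draw₂ γ μpr τpr y ((D.draw₁ γ μpr τpr y (θ.2.2, x)).2.1, x'))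
        ∂(blockNoise I₂) ∂(blockNoise I₁) := by
  have h1 := blockUpdate_ae_eq₁ (D := D) (μpr := μpr) (τpr := τpr) (y := y) hτ hτ₁
  have h2 := blockUpdate_ae_eq₂ (D := D) (μpr := μpr) (τpr := τpr) (y := y) hτ hτ₂
  have h3 := ae_ae_of_invariant (invariant_blockUpdate (π := D.posterior γ μpr τpr y)
    (X := fun θ : Param I₁ I₂ => θ.2.2) (hX := measurable_snd.comp measurable_snd)) h2
  filter_upwards [h1, h3] with θ hθ hθ' G hG
  rw [collapsedGibbs, twoBlockGibbs, Kernel.lintegral_comp _ _ _ hG]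
  have hd₂ := D.measurable_draw₂ γ μpr τpr y
  calc _ = ∫⁻ w, ∫⁻ x', G (D.draw₂ γ μpr τpr y (w.2.1, x')) ∂(blockNoise I₂)
        ∂(blockUpdate (D.posterior γ μpr τpr y) (fun θ : Param I₁ I₂ => θ.2.2)
          (measurable_snd.comp measurable_snd) θ) := by
        refine lintegral_congr_ae ?_
        filter_upwards [hθ'] with w hw
        rw [hw, lintegral_noiseKernel hd₂ _ hG]
    _ = _ := by
        rw [hθ, lintegral_noiseKernel (D.measurable_draw₁ γ μpr τpr y)]
        refine Measurable.lintegral_prod_right' (f := fun p : Param I₁ I₂ × (ℝ × (Fin I₂ → ℝ)) =>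
          G (D.draw₂ γ μpr τpr y (p.1.2.1, p.2))) (hG.comp (hd₂.comp ?_))
        fun_prop

theorem Design.iterationLaw_ae_eq (hτ : 0 < γ.τ) (hτ₁ : 0 < γ.τ₁) (hτ₂ : 0 < γ.τ₂) :
    ∀ᵐ θ ∂(D.posterior γ μpr τpr y),
      D.iterationLaw γ μpr τpr y θ = D.collapsedGibbs γ μpr τpr y θ := by
  filter_upwards [lintegral_collapsedGibbs_ae hτ hτ₁ hτ₂] with θ hθ
  refine Measure.ext_of_lintegral _ fun G hG => ?_
  rw [hθ G hG, lintegral_iterationLaw D θ hG]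

/-- The state after one iteration, as a function of the current state and the noise. -/
def Design.iterate (D : Design N I₁ I₂) (γ : Precisions) (μpr : ℝ) (τpr : ℝ≥0) (y : Fin N → ℝ)
    (x : Param I₁ I₂ × ((ℝ × (Fin I₁ → ℝ)) × (ℝ × (Fin I₂ → ℝ)))) : Param I₁ I₂ :=
  D.draw₂ γ μpr τpr y ((D.draw₁ γ μpr τpr y (x.1.2.2, x.2.1)).2.1, x.2.2)

theorem Design.measurable_iterate : Measurable (D.iterate γ μpr τpr y) := by
  have h : Measurable fun x : Param I₁ I₂ × ((ℝ × (Fin I₁ → ℝ)) × (ℝ × (Fin I₂ → ℝ))) =>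
      D.draw₁ γ μpr τpr y (x.1.2.2, x.2.1) := (D.measurable_draw₁ γ μpr τpr y).comp (by fun_prop)
  exact (D.measurable_draw₂ γ μpr τpr y).comp (h.snd.fst.prodMk (by fun_prop))

/-- A random-map representation of the sampler: feeding the same noise to two states couples them.
-/
theorem Design.collapsedGibbs_ae_eq (hτ : 0 < γ.τ) (hτ₁ : 0 < γ.τ₁) (hτ₂ : 0 < γ.τ₂) :
    ∀ᵐ θ ∂(D.posterior γ μpr τpr y), D.collapsedGibbs γ μpr τpr y θ
      = noiseKernel ((blockNoise I₁).prod (blockNoise I₂)) (D.iterate γ μpr τpr y) θ := by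
  filter_upwards [lintegral_collapsedGibbs_ae hτ hτ₁ hτ₂] with θ hθ
  refine Measure.ext_of_lintegral _ fun G hG => ?_
  have hm := D.measurable_iterate (γ := γ) (μpr := μpr) (τpr := τpr) (y := y)
  have hGm : Measurable fun z => G (D.iterate γ μpr τpr y (θ, z)) :=
    hG.comp (hm.comp measurable_prodMk_left)
  rw [hθ G hG, lintegral_noiseKernel hm _ hG, lintegral_prod _ hGm.aemeasurable]
  rfl

end Iteration

/-! ### Response of a block update to a change of the residuals -/

section Response

variable {N I : ℕ} (lev : Fin N → Fin I)

theorem levelSum_sub (r r' : Fin N → ℝ) (i : Fin I) :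
    levelSum lev (r - r') i = levelSum lev r i - levelSum lev r' i := by
  simp only [levelSum, ← Finset.sum_sub_distrib]
  refine Finset.sum_congr rfl fun n _ => ?_
  split_ifs <;> simp

theorem sum_levelSum (r : Fin N → ℝ) : ∑ i, levelSum lev r i = ∑ n, r n := by
  simpa using (sum_mul_comp_level lev (fun _ => 1) r).symm

theorem abs_levelSum_le (r : Fin N → ℝ) (i : Fin I) : |levelSum lev r i| ≤ N * ‖r‖ := by
  have h : ∀ n ∈ Finset.univ, |if lev n = i then r n else 0| ≤ ‖r‖ := fun n _ => by
    split_ifs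
    · exact norm_le_pi_norm r n
    · simp
  refine (Finset.abs_sum_le_sum_abs _ _).trans ((Finset.sum_le_sum h).trans ?_)
  simp

/-- For fixed noise the draw is affine in the residuals. The constant is crude and depends on the
design, which is harmless: it enters only the prefactor of the decay, not the rate. -/
theorem exists_norm_blockDraw_sub_le (τ τk μpr τpr : ℝ) : ∃ M : ℝ, 0 ≤ M ∧
    ∀ (r r' : Fin N → ℝ) (z : ℝ × (Fin I → ℝ)),
      ‖blockDraw lev τ τk μpr τpr r z - blockDraw lev τ τk μpr τpr r' z‖ ≤ M * ‖r - r'‖ := by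
  set A : ℝ := (∑ i, |levelWeight lev τ τk i| * N) / |globalPrec lev τ τk τpr| with hA
  set B : ℝ := ∑ i, (N + |levelCount lev i| * A) * |τ| / |levelPrec lev τ τk i| with hB
  have hA0 : 0 ≤ A := by positivity
  have hB0 : 0 ≤ B := by positivity
  refine ⟨max A B, le_max_of_le_left hA0, fun r r' z => ?_⟩
  have hg : |globalDraw lev τ τk μpr τpr r z.1 - globalDraw lev τ τk μpr τpr r' z.1|
      ≤ A * ‖r - r'‖ := by
    have h1 : globalDraw lev τ τk μpr τpr r z.1 - globalDraw lev τ τk μpr τpr r' z.1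
        = (∑ i, levelWeight lev τ τk i * levelSum lev (r - r') i) / globalPrec lev τ τk τpr := by
      simp only [globalDraw, globalLin, levelSum_sub, mul_sub, Finset.sum_sub_distrib]
      ring
    rw [h1, abs_div, hA, div_mul_eq_mul_div]
    gcongr
    rw [Finset.sum_mul]
    refine (Finset.abs_sum_le_sum_abs _ _).trans (Finset.sum_le_sum fun i _ => ?_)
    rw [abs_mul, mul_assoc]
    gcongr
    exact abs_levelSum_le lev _ i
  refine max_le ?_ ?_
  · exact hg.trans (by gcongr; exact le_max_left _ _)
  · refine (pi_norm_le_iff_of_nonneg (by positivity)).2 fun i => ?_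
    refine le_trans (?_ : _ ≤ B * ‖r - r'‖) (by gcongr; exact le_max_right _ _)
    have h2 : (blockDraw lev τ τk μpr τpr r z).2 i - (blockDraw lev τ τk μpr τpr r' z).2 i
        = (levelSum lev (r - r') i - levelCount lev i *
          (globalDraw lev τ τk μpr τpr r z.1 - globalDraw lev τ τk μpr τpr r' z.1)) * τ
            / levelPrec lev τ τk i := by
      simp only [blockDraw, effectDraw, effectMean, levelSum_sub]
      ring
    change |(blockDraw lev τ τk μpr τpr r z).2 i - (blockDraw lev τ τk μpr τpr r' z).2 i| ≤ _
    rw [h2, abs_div, abs_mul]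
    refine le_trans ?_ (mul_le_mul_of_nonneg_right
      (Finset.single_le_sum (f := fun i => (N + |levelCount lev i| * A) * |τ|
        / |levelPrec lev τ τk i|) (fun i _ => by positivity) (Finset.mem_univ i)) (norm_nonneg _))
    rw [div_mul_eq_mul_div, mul_right_comm]
    gcongr
    refine (abs_sub _ _).trans ?_
    rw [abs_mul, add_mul, mul_assoc]
    gcongr
    exact abs_levelSum_le lev _ i

/-- Shrinkage factor of the effect of a level with `n` observations. -/
def shrinkage (n τ τk : ℝ) : ℝ := n * τ / (n * τ + τk)

/-- Share of the prior in the conditional precision of the global effect. -/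
def priorShare (N n τ τk τpr : ℝ) : ℝ := τpr / (τpr + τk / (n * τ + τk) * τ * N)

/-- The redrawn global effect absorbs the mean residual except for the prior's share; each level's
remaining mean is then shrunk. Equal counts make all weights equal, which gives this closed form. -/
theorem blockDraw_sub_apply [NeZero N] {τ τk τpr n : ℝ} (hτ : 0 < τ) (hτk : 0 < τk) (hτpr : 0 ≤ τpr)
    (hn : 0 < n) (hcount : ∀ i, levelCount lev i = n) (μpr : ℝ) (r r' : Fin N → ℝ)
    (z : ℝ × (Fin I → ℝ)) (i : Fin I) :
    (blockDraw lev τ τk μpr τpr r z).2 i - (blockDraw lev τ τk μpr τpr r' z).2 i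
      = shrinkage n τ τk * (levelSum lev (r - r') i / n
        - (1 - priorShare N n τ τk τpr) * ((∑ k, (r - r') k) / N)) := by
  have hN : (N : ℝ) ≠ 0 := Nat.cast_ne_zero.2 (NeZero.ne N)
  have hN' : (0 : ℝ) < N := Nat.cast_pos.2 (NeZero.pos N)
  have hW : ∀ i, levelWeight lev τ τk i = τk / (n * τ + τk) * τ := fun i => by
    rw [levelWeight, levelPrec, hcount]
  have hP : globalPrec lev τ τk τpr = τpr + τk / (n * τ + τk) * τ * N := by
    simp only [globalPrec, hW]
    rw [← Finset.mul_sum, sum_levelCount]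
  have hL : 0 < n * τ + τk := by positivity
  have hPpos : 0 < τpr + τk / (n * τ + τk) * τ * N := by positivity
  have h1 : globalDraw lev τ τk μpr τpr r z.1 - globalDraw lev τ τk μpr τpr r' z.1
      = τk / (n * τ + τk) * τ * (∑ k, (r - r') k) / (τpr + τk / (n * τ + τk) * τ * N) := by
    rw [← sum_levelSum lev (r - r')]
    simp only [globalDraw, globalLin, levelSum_sub, hW, hP, ← Finset.mul_sum,
      Finset.sum_sub_distrib]
    ring
  have h2 : (blockDraw lev τ τk μpr τpr r z).2 i - (blockDraw lev τ τk μpr τpr r' z).2 i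
      = (levelSum lev (r - r') i - n *
        (globalDraw lev τ τk μpr τpr r z.1 - globalDraw lev τ τk μpr τpr r' z.1)) * τ
          / (n * τ + τk) := by
    simp only [blockDraw, effectDraw, effectMean, levelSum_sub, levelPrec, hcount]
    ring
  have h3 : 1 - priorShare N n τ τk τpr
      = τk / (n * τ + τk) * τ * N / (τpr + τk / (n * τ + τk) * τ * N) := by
    rw [priorShare, eq_div_iff hPpos.ne', sub_mul, div_mul_cancel₀ _ hPpos.ne']
    ring
  rw [h2, h1, h3, shrinkage]
  generalize τpr + τk / (n * τ + τk) * τ * N = P at hPpos ⊢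
  generalize n * τ + τk = L at hL ⊢
  field_simp

end Response

/-! ### Contraction of the coupled collapsed Gibbs sampler -/

section Contraction

variable {N I₁ I₂ : ℕ} {D : Design N I₁ I₂} {γ : Precisions} {μpr : ℝ} {τpr : ℝ≥0} {y : Fin N → ℝ}

theorem Design.levelCount_lev₁ (D : Design N I₁ I₂) (i : Fin I₁) :
    levelCount D.lev₁ i = D.occ₁ i := by
  simp [levelCount, occ₁]

theorem Design.levelCount_lev₂ (D : Design N I₁ I₂) (j : Fin I₂) :
    levelCount D.lev₂ j = D.occ₂ j := by
  simp [levelCount, occ₂]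

theorem Design.levelSum_lev₁ (D : Design N I₁ I₂) (g : Fin I₂ → ℝ) (i : Fin I₁) :
    levelSum D.lev₁ (fun n => g (D.lev₂ n)) i = ∑ j, (D.cooc i j : ℝ) * g j := by
  simp only [levelSum, cooc, Nat.cast_sum, Finset.sum_mul]
  rw [Finset.sum_comm]
  refine Finset.sum_congr rfl fun n _ => ?_
  by_cases h : D.lev₁ n = i <;> simp [h]

theorem Design.levelSum_lev₂ (D : Design N I₁ I₂) (h : Fin I₁ → ℝ) (j : Fin I₂) :
    levelSum D.lev₂ (fun n => h (D.lev₁ n)) j = ∑ i, (D.cooc i j : ℝ) * h i := by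
  simp only [levelSum, cooc, Nat.cast_sum, Finset.sum_mul]
  rw [Finset.sum_comm]
  refine Finset.sum_congr rfl fun n _ => ?_
  by_cases h : D.lev₂ n = j <;> simp [h]

/-- The current `a⁰` and `a¹` are discarded by the first update, so the whole new state is
controlled by `a²` alone. -/
theorem Design.exists_norm_iterate_sub_le (D : Design N I₁ I₂) : ∃ M : ℝ, 0 ≤ M ∧ ∀ θ θ' ξ,
    ‖D.iterate γ μpr τpr y (θ, ξ) - D.iterate γ μpr τpr y (θ', ξ)‖ ≤ M * ‖θ.2.2 - θ'.2.2‖ := by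
  obtain ⟨M₁, hM₁, h₁⟩ := exists_norm_blockDraw_sub_le D.lev₁ γ.τ γ.τ₁ μpr τpr
  obtain ⟨M₂, hM₂, h₂⟩ := exists_norm_blockDraw_sub_le D.lev₂ γ.τ γ.τ₂ μpr τpr
  have hres : ∀ {J : ℕ} (lev : Fin N → Fin J) (b b' : Fin J → ℝ),
      ‖(fun n => y n - b (lev n)) - (fun n => y n - b' (lev n))‖ ≤ ‖b - b'‖ := by
    intro J lev b b'
    refine (pi_norm_le_iff_of_nonneg (norm_nonneg _)).2 fun n => ?_
    have h := norm_le_pi_norm (b - b') (lev n)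
    rw [Pi.sub_apply] at h ⊢
    rwa [sub_sub_sub_cancel_left, norm_sub_rev]
  refine ⟨max (M₂ * M₁) M₁, le_max_of_le_right hM₁, fun θ θ' ξ => ?_⟩
  have e₁ : ‖(D.draw₁ γ μpr τpr y (θ.2.2, ξ.1)).2.1 - (D.draw₁ γ μpr τpr y (θ'.2.2, ξ.1)).2.1‖
      ≤ M₁ * ‖θ.2.2 - θ'.2.2‖ :=
    (norm_snd_le (blockDraw D.lev₁ γ.τ γ.τ₁ μpr τpr (fun n => y n - θ.2.2 (D.lev₂ n)) ξ.1
        - blockDraw D.lev₁ γ.τ γ.τ₁ μpr τpr (fun n => y n - θ'.2.2 (D.lev₂ n)) ξ.1)).trans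
      ((h₁ _ _ _).trans (by gcongr; exact hres D.lev₂ _ _))
  set α := (D.draw₁ γ μpr τpr y (θ.2.2, ξ.1)).2.1 with hα
  set α' := (D.draw₁ γ μpr τpr y (θ'.2.2, ξ.1)).2.1 with hα'
  have e₂ : ‖blockDraw D.lev₂ γ.τ γ.τ₂ μpr τpr (fun n => y n - α (D.lev₁ n)) ξ.2
        - blockDraw D.lev₂ γ.τ γ.τ₂ μpr τpr (fun n => y n - α' (D.lev₁ n)) ξ.2‖
      ≤ M₂ * M₁ * ‖θ.2.2 - θ'.2.2‖ := by
    refine (h₂ _ _ _).trans ?_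
    rw [mul_assoc]
    gcongr
    exact (hres D.lev₁ _ _).trans e₁
  have e₃ : M₂ * M₁ * ‖θ.2.2 - θ'.2.2‖ ≤ max (M₂ * M₁) M₁ * ‖θ.2.2 - θ'.2.2‖ := by
    gcongr; exact le_max_left _ _
  refine max_le (((norm_fst_le _).trans e₂).trans e₃) (max_le ?_ (((norm_snd_le _).trans e₂).trans e₃))
  exact e₁.trans (by gcongr; exact le_max_right _ _)

variable [NeZero N] [NeZero I₁] [NeZero I₂]

/-- Effects enter the residuals with a minus sign, so each half-step reverses the sign of the
average; over a full iteration the two reversals cancel. -/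
theorem Design.Balanced.draw₁_sub (hB : D.Balanced) (hτ : 0 < γ.τ) (hτ₁ : 0 < γ.τ₁)
    (b b' : Fin I₂ → ℝ) (ξ : ℝ × (Fin I₁ → ℝ)) :
    (D.draw₁ γ μpr τpr y (b, ξ)).2.1 - (D.draw₁ γ μpr τpr y (b', ξ)).2.1
      = shrinkage (N / I₁) γ.τ γ.τ₁ • ((fun _ => (1 - priorShare N (N / I₁) γ.τ γ.τ₁ τpr) *
          ((∑ j, (b - b') j) / I₂)) - D.avg₁ (b - b')) := by
  have hN : (0 : ℝ) < N := Nat.cast_pos.2 (NeZero.pos N)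
  have hI : (0 : ℝ) < I₁ := Nat.cast_pos.2 (NeZero.pos I₁)
  ext i
  have h := blockDraw_sub_apply D.lev₁ (n := N / I₁) (NNReal.coe_pos.2 hτ)
    (NNReal.coe_pos.2 hτ₁) τpr.coe_nonneg (by positivity)
    (fun i => (D.levelCount_lev₁ i).trans (hB.1 i)) μpr
    (fun n => y n - b (D.lev₂ n)) (fun n => y n - b' (D.lev₂ n)) ξ i
  have hr : ((fun n => y n - b (D.lev₂ n)) - fun n => y n - b' (D.lev₂ n))
      = fun n => (b' - b) (D.lev₂ n) := by
    ext n; simp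
  have hs : ∑ n, (b' - b) (D.lev₂ n) = N / I₂ * ∑ j, (b' - b) j := by
    have := sum_mul_comp_level D.lev₂ (b' - b) fun _ => 1
    simp only [mul_one] at this
    rw [this, Finset.mul_sum]
    refine Finset.sum_congr rfl fun j _ => ?_
    rw [← hB.2 j, ← D.levelCount_lev₂, mul_comm]
    rfl
  rw [hr, hs, D.levelSum_lev₁, ← hB.1 i, ← avg₁_apply, hB.1 i] at h
  rw [Pi.sub_apply]
  refine h.trans ?_
  have hneg : b' - b = -(b - b') := (neg_sub b b').symm
  rw [hneg, map_neg]
  simp only [Pi.smul_apply, Pi.sub_apply, Pi.neg_apply, Finset.sum_neg_distrib, smul_eq_mul]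
  field_simp
  ring

theorem Design.Balanced.draw₂_sub (hB : D.Balanced) (hτ : 0 < γ.τ) (hτ₂ : 0 < γ.τ₂)
    (b b' : Fin I₁ → ℝ) (ξ : ℝ × (Fin I₂ → ℝ)) :
    (D.draw₂ γ μpr τpr y (b, ξ)).2.2 - (D.draw₂ γ μpr τpr y (b', ξ)).2.2
      = shrinkage (N / I₂) γ.τ γ.τ₂ • ((fun _ => (1 - priorShare N (N / I₂) γ.τ γ.τ₂ τpr) *
          ((∑ j, (b - b') j) / I₁)) - D.avg₂ (b - b')) := by
  have hN : (0 : ℝ) < N := Nat.cast_pos.2 (NeZero.pos N)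
  have hI : (0 : ℝ) < I₂ := Nat.cast_pos.2 (NeZero.pos I₂)
  ext i
  have h := blockDraw_sub_apply D.lev₂ (n := N / I₂) (NNReal.coe_pos.2 hτ)
    (NNReal.coe_pos.2 hτ₂) τpr.coe_nonneg (by positivity)
    (fun i => (D.levelCount_lev₂ i).trans (hB.2 i)) μpr
    (fun n => y n - b (D.lev₁ n)) (fun n => y n - b' (D.lev₁ n)) ξ i
  have hr : ((fun n => y n - b (D.lev₁ n)) - fun n => y n - b' (D.lev₁ n))
      = fun n => (b' - b) (D.lev₁ n) := by
    ext n; simp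
  have hs : ∑ n, (b' - b) (D.lev₁ n) = N / I₁ * ∑ j, (b' - b) j := by
    have := sum_mul_comp_level D.lev₁ (b' - b) fun _ => 1
    simp only [mul_one] at this
    rw [this, Finset.mul_sum]
    refine Finset.sum_congr rfl fun j _ => ?_
    rw [← hB.1 j, ← D.levelCount_lev₁, mul_comm]
    rfl
  rw [hr, hs, D.levelSum_lev₂, ← hB.2 i, ← avg₂_apply, hB.2 i] at h
  rw [Pi.sub_apply]
  refine h.trans ?_
  have hneg : b' - b = -(b - b') := (neg_sub b b').symm
  rw [hneg, map_neg]
  simp only [Pi.smul_apply, Pi.sub_apply, Pi.neg_apply, Finset.sum_neg_distrib, smul_eq_mul]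
  field_simp
  ring

/-- Contraction factor of the collapsed Gibbs sampler on centered effects, relative to the
auxiliary sampler. -/
def Design.centeredFactor (_ : Design N I₁ I₂) (γ : Precisions) : ℝ :=
  shrinkage (N / I₁) γ.τ γ.τ₁ * shrinkage (N / I₂) γ.τ γ.τ₂

/-- Contraction factor of the collapsed Gibbs sampler on constant effects. -/
def Design.constFactor (D : Design N I₁ I₂) (γ : Precisions) (τpr : ℝ≥0) : ℝ :=
  D.centeredFactor γ *
    (priorShare N (N / I₁) γ.τ γ.τ₁ τpr * priorShare N (N / I₂) γ.τ γ.τ₂ τpr)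

/-- Averages preserve means, so constants and centered vectors evolve separately: the former are
damped by shrinkage and prior shares, the latter by shrinkage and the alternating averages. -/
theorem Design.Balanced.iterate_sub (hB : D.Balanced) (hτ : 0 < γ.τ) (hτ₁ : 0 < γ.τ₁)
    (hτ₂ : 0 < γ.τ₂) (θ θ' : Param I₁ I₂) (ξ : (ℝ × (Fin I₁ → ℝ)) × (ℝ × (Fin I₂ → ℝ)))
    (j : Fin I₂) :
    (D.iterate γ μpr τpr y (θ, ξ)).2.2 j - (D.iterate γ μpr τpr y (θ', ξ)).2.2 j
      = D.centeredFactor γ * (D.avg₂ (D.avg₁ (θ.2.2 - θ'.2.2)) j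
          - (∑ k, (θ.2.2 - θ'.2.2) k) / I₂)
        + D.constFactor γ τpr * ((∑ k, (θ.2.2 - θ'.2.2) k) / I₂) := by
  have hI : (I₁ : ℝ) ≠ 0 := Nat.cast_ne_zero.2 (NeZero.ne I₁)
  have h₂ := congrFun (hB.draw₂_sub (μpr := μpr) (τpr := τpr) (y := y) hτ hτ₂
    (D.draw₁ γ μpr τpr y (θ.2.2, ξ.1)).2.1 (D.draw₁ γ μpr τpr y (θ'.2.2, ξ.1)).2.1 ξ.2) j
  rw [hB.draw₁_sub hτ hτ₁] at h₂
  refine h₂.trans ?_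
  set δ := θ.2.2 - θ'.2.2 with hδ
  set m := (∑ k, δ k) / I₂ with hm
  set t₁ := priorShare N (N / I₁) γ.τ γ.τ₁ τpr with ht₁
  set t₂ := priorShare N (N / I₂) γ.τ γ.τ₂ τpr with ht₂
  rw [constFactor, centeredFactor]
  set x₁ := shrinkage (N / I₁) γ.τ γ.τ₁
  set x₂ := shrinkage (N / I₂) γ.τ γ.τ₂
  -- After the first half-step only the prior share `t₁` of the mean is left, with reversed sign.
  have hmean : (∑ k, (x₁ • ((fun _ => (1 - t₁) * m) - D.avg₁ δ) : Fin I₁ → ℝ) k) / I₁ = -(x₁ * t₁ * m) := by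
    have h := hB.sum_avg₁ δ
    rw [← hm, div_eq_iff hI] at h
    simp only [Pi.smul_apply, Pi.sub_apply, smul_eq_mul, ← Finset.mul_sum, Finset.sum_sub_distrib, h]
    simp
    field_simp
    ring
  rw [hmean, map_smul, map_sub, hB.avg₂_const]
  simp only [Pi.smul_apply, Pi.sub_apply, smul_eq_mul]
  rw [← ht₁, ← ht₂]
  ring

end Contraction

/-! ### Convergence of noise-driven chains by coupling -/

section Coupling

variable {Ω S : Type*} [MeasurableSpace Ω] [MeasurableSpace S] {ν : Measure S}
  [IsProbabilityMeasure ν] {Φ : Ω × S → Ω}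

theorem integrable_of_abs_le {μ : Measure Ω} [IsFiniteMeasure μ] {f : Ω → ℝ} (hf : Measurable f)
    {B : ℝ} (hB : ∀ x, |f x| ≤ B) : Integrable f μ :=
  Integrable.of_bound hf.aestronglyMeasurable B (Filter.Eventually.of_forall hB)

theorem abs_integral_le_of_abs_le {Ω : Type*} [MeasurableSpace Ω] {μ : Measure Ω}
    [IsProbabilityMeasure μ] {f : Ω → ℝ} {B : ℝ} (hB : ∀ x, |f x| ≤ B) : |∫ x, f x ∂μ| ≤ B := by
  have h : ∀ᵐ x ∂μ, ‖f x‖ ≤ B := Filter.Eventually.of_forall hB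
  simpa using norm_integral_le_of_norm_le_const h

/-- Synchronous coupling. The function is required to be Lipschitz for `d` only after one step,
because `d` will ignore `a⁰` and `a¹`; hence the exponent `t` for `t + 1` steps. -/
theorem abs_integral_pow_sub_le (hΦ : Measurable Φ) {d : Ω → Ω → ℝ} {ρ M : ℝ≥0}
    {f : Ω → ℝ} (hf : Measurable f) {B : ℝ} (hB : ∀ x, |f x| ≤ B)
    (hfd : ∀ x x' z, |f (Φ (x, z)) - f (Φ (x', z))| ≤ M * d x x')
    (hd : ∀ x x' z, d (Φ (x, z)) (Φ (x', z)) ≤ ρ * d x x') (t : ℕ) (x x' : Ω) :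
    |∫ w, f w ∂((noiseKernel ν Φ ^ (t + 1)) x) - ∫ w, f w ∂((noiseKernel ν Φ ^ (t + 1)) x')|
      ≤ M * ρ ^ t * d x x' := by
  have := isMarkovKernel_noiseKernel (ν := ν) hΦ
  set g : ℕ → Ω → ℝ := fun t x => ∫ w, f w ∂((noiseKernel ν Φ ^ t) x) with hg
  have hgm : ∀ t, Measurable (g t) := fun t =>
    (hf.stronglyMeasurable.integral_kernel (κ := noiseKernel ν Φ ^ t)).measurable
  have hgB : ∀ t x, |g t x| ≤ B := fun t x => abs_integral_le_of_abs_le hB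
  have hsucc : ∀ t x, g (t + 1) x = ∫ z, g t (Φ (x, z)) ∂ν := fun t x => by
    rw [hg]
    simp only
    rw [pow_succ]
    change ∫ w, f w ∂(((noiseKernel ν Φ ^ t) ∘ₖ noiseKernel ν Φ) x) = _
    rw [Kernel.integral_comp (integrable_of_abs_le hf hB)]
    exact integral_noiseKernel hΦ x (hgm t)
  have hfInt : ∀ t x, Integrable (fun z => g t (Φ (x, z))) ν := fun t x =>
    Integrable.of_bound ((hgm t).comp (hΦ.comp measurable_prodMk_left)).aestronglyMeasurable B
      (Filter.Eventually.of_forall fun z => hgB t _)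
  have hstep : ∀ t x x' c, (∀ z, |g t (Φ (x, z)) - g t (Φ (x', z))| ≤ c) →
      |g (t + 1) x - g (t + 1) x'| ≤ c := fun t x x' c hc => by
    rw [hsucc, hsucc, ← integral_sub (hfInt t x) (hfInt t x')]
    exact abs_integral_le_of_abs_le hc
  change |g (t + 1) x - g (t + 1) x'| ≤ _
  induction t generalizing x x' with
  | zero =>
    refine hstep 0 x x' _ fun z => ?_
    have h0 : ∀ x, g 0 x = f x := fun x => by
      change ∫ w, f w ∂(Kernel.id x) = _
      rw [Kernel.id_apply, integral_dirac' _ _ hf.stronglyMeasurable]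
    rw [h0, h0, pow_zero, mul_one]
    exact hfd x x' z
  | succ t ih =>
    refine hstep (t + 1) x x' _ fun z => (ih _ _).trans ?_
    rw [pow_succ, mul_assoc, mul_assoc, mul_assoc]
    gcongr
    exact hd x x' z

/-- The second starting state is averaged over the stationary law, and a square-integrable `h`
dominating the distance turns the pointwise bound into an L² one. -/
theorem exists_eLpNorm_pow_sub_le (hΦ : Measurable Φ) {π : Measure Ω} [IsProbabilityMeasure π]
    (hπ : (noiseKernel ν Φ).Invariant π) {d : Ω → Ω → ℝ} {h : Ω → ℝ} (hh : MemLp h 2 π)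
    (hdh : ∀ x x', d x x' ≤ h x + h x') {ρ M r : ℝ≥0} (hr : 0 < r) (hρr : ρ ≤ r)
    {f : Ω → ℝ} (hf : Measurable f) {B : ℝ} (hB : ∀ x, |f x| ≤ B)
    (hfd : ∀ x x' z, |f (Φ (x, z)) - f (Φ (x', z))| ≤ M * d x x')
    (hd : ∀ x x' z, d (Φ (x, z)) (Φ (x', z)) ≤ ρ * d x x') :
    ∃ C : ℝ≥0, ∀ t : ℕ, eLpNorm (fun x => (∫ w, f w ∂((noiseKernel ν Φ ^ t) x)) - ∫ w, f w ∂π) 2 π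
      ≤ C * (r : ℝ≥0∞) ^ t := by
  have := isMarkovKernel_noiseKernel (ν := ν) hΦ
  have hh1 : Integrable h π := hh.integrable (by norm_num)
  have hfInt : ∀ {μ : Measure Ω} [IsFiniteMeasure μ], Integrable f μ := integrable_of_abs_le hf hB
  set g : ℕ → Ω → ℝ := fun t x => ∫ w, f w ∂((noiseKernel ν Φ ^ t) x) with hg
  have hgm : ∀ t, Measurable (g t) := fun t =>
    (hf.stronglyMeasurable.integral_kernel (κ := noiseKernel ν Φ ^ t)).measurable
  have hgB : ∀ t x, |g t x| ≤ B := fun t x => abs_integral_le_of_abs_le hB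
  have hmean : ∀ t, ∫ w, f w ∂π = ∫ x, g t x ∂π := fun t => by
    have hinv := invariant_pow hπ t
    nth_rewrite 1 [← hinv.def]
    have := Kernel.integral_comp (κ := Kernel.const Unit π) (η := noiseKernel ν Φ ^ t) (a := ())
      (f := f) (by rw [← Measure.comp_eq_comp_const_apply, hinv.def]; exact hfInt)
    rwa [← Measure.comp_eq_comp_const_apply, Kernel.const_apply] at this
  set H : Ω → ℝ := fun x => h x + ∫ x', h x' ∂π with hH
  have hH2 : MemLp H 2 π := hh.add (memLp_const _)
  have hpt : ∀ t x, |g (t + 1) x - ∫ w, f w ∂π| ≤ M * ρ ^ t * H x := fun t x => by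
    have h1 : g (t + 1) x - ∫ w, f w ∂π = ∫ x', (g (t + 1) x - g (t + 1) x') ∂π := by
      rw [integral_sub (integrable_const _) (integrable_of_abs_le (hgm _) (hgB _)),
        integral_const, probReal_univ, one_smul, hmean (t + 1)]
    have h2 : M * ρ ^ t * H x = ∫ x', (M * ρ ^ t * (h x + h x') : ℝ) ∂π := by
      rw [integral_const_mul, integral_add (integrable_const _) hh1, integral_const,
        probReal_univ, one_smul]
    rw [h1, h2]
    have h3 : Integrable (fun x' => (M * ρ ^ t * (h x + h x') : ℝ)) π :=
      ((integrable_const _).add hh1).const_mul _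
    have h4 : ∀ x', ‖g (t + 1) x - g (t + 1) x'‖ ≤ M * ρ ^ t * (h x + h x') := fun x' =>
      (abs_integral_pow_sub_le hΦ hf hB hfd hd t x x').trans
        (mul_le_mul_of_nonneg_left (hdh x x') (by positivity))
    exact norm_integral_le_of_norm_le h3 (Filter.Eventually.of_forall h4)
  have hr' : (r : ℝ) ≠ 0 := by exact_mod_cast hr.ne'
  set H₀ := (eLpNorm H 2 π).toNNReal with hH₀
  have hH₀' : (H₀ : ℝ≥0∞) = eLpNorm H 2 π := ENNReal.coe_toNNReal hH2.eLpNorm_ne_top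
  have hF : MemLp (fun x => g 0 x - ∫ w, f w ∂π) 2 π :=
    (MemLp.of_bound (hgm 0).aestronglyMeasurable B (Filter.Eventually.of_forall (hgB 0))).sub
      (memLp_const _)
  set F₀ := (eLpNorm (fun x => g 0 x - ∫ w, f w ∂π) 2 π).toNNReal with hF₀
  have hF₀' : (F₀ : ℝ≥0∞) = eLpNorm (fun x => g 0 x - ∫ w, f w ∂π) 2 π :=
    ENNReal.coe_toNNReal hF.eLpNorm_ne_top
  refine ⟨F₀ + M / r * H₀, fun t => ?_⟩
  change eLpNorm (fun x => g t x - ∫ w, f w ∂π) 2 π ≤ _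
  cases t with
  | zero =>
    rw [pow_zero, mul_one, ← hF₀']
    exact ENNReal.coe_le_coe.2 le_self_add
  | succ t =>
    have hb : eLpNorm (fun x => g (t + 1) x - ∫ w, f w ∂π) 2 π
        ≤ (M * ρ ^ t : ℝ≥0) • eLpNorm H 2 π := by
      refine eLpNorm_le_nnreal_smul_eLpNorm_of_ae_le_mul
        (Filter.Eventually.of_forall fun x => ?_) 2
      rw [← NNReal.coe_le_coe]
      push_cast
      refine (hpt t x).trans ?_
      gcongr
      exact le_abs_self _
    refine hb.trans ?_
    rw [← hH₀', ENNReal.smul_def, smul_eq_mul]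
    norm_cast
    rw [add_mul, pow_succ]
    refine le_add_left ?_
    rw [show M / r * H₀ * (r ^ t * r) = M * r ^ t * H₀ * (r / r) by ring, div_self hr.ne', mul_one]
    gcongr

end Coupling

/-! ### Two-sided bounds on the convergence rate of the collapsed sampler. -/

section Rates

variable {N I₁ I₂ : ℕ} [NeZero N] [NeZero I₁] [NeZero I₂] {D : Design N I₁ I₂} {γ : Precisions}
  {μpr : ℝ} {τpr : ℝ≥0} {y : Fin N → ℝ}

theorem Design.centeredFactor_nonneg (D : Design N I₁ I₂) : 0 ≤ D.centeredFactor γ := by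
  unfold centeredFactor shrinkage
  positivity

theorem Design.constFactor_nonneg (D : Design N I₁ I₂) : 0 ≤ D.constFactor γ τpr := by
  have := D.centeredFactor_nonneg (γ := γ)
  unfold constFactor priorShare
  positivity

/-- Pythagoras: the centered and constant parts stay orthogonal under the map, and each contracts by
at most `ρ`. -/
theorem Design.Balanced.sum_sq_iterate_sub_le (hB : D.Balanced) (hτ : 0 < γ.τ) (hτ₁ : 0 < γ.τ₁)
    (hτ₂ : 0 < γ.τ₂) {l : ℝ≥0} (hl : ∀ g : Fin I₂ → ℝ, ∑ j, g j = 0 →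
      ∑ j, D.avg₂ (D.avg₁ g) j ^ 2 ≤ (l : ℝ) ^ 2 * ∑ j, g j ^ 2) {ρ : ℝ}
    (hρ : D.centeredFactor γ * l ≤ ρ) (hρ' : D.constFactor γ τpr ≤ ρ) (θ θ' : Param I₁ I₂)
    (ξ : (ℝ × (Fin I₁ → ℝ)) × (ℝ × (Fin I₂ → ℝ))) :
    ∑ j, ((D.iterate γ μpr τpr y (θ, ξ)).2.2 j - (D.iterate γ μpr τpr y (θ', ξ)).2.2 j) ^ 2
      ≤ ρ ^ 2 * ∑ j, (θ.2.2 j - θ'.2.2 j) ^ 2 := by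
  simp only [hB.iterate_sub hτ hτ₁ hτ₂, ← Pi.sub_apply]
  set δ := θ.2.2 - θ'.2.2 with hδ
  set m := (∑ k, δ k) / I₂ with hm
  have hI : (I₂ : ℝ) ≠ 0 := Nat.cast_ne_zero.2 (NeZero.ne I₂)
  have hsum : ∑ k, δ k = I₂ * m := by rw [hm]; field_simp
  have hs := D.centeredFactor_nonneg (γ := γ)
  have hk := D.constFactor_nonneg (γ := γ) (τpr := τpr)
  set s := D.centeredFactor γ
  set k := D.constFactor γ τpr
  have hc : ∑ j, (δ - fun _ => m : Fin I₂ → ℝ) j = 0 := by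
    simp [Finset.sum_sub_distrib, hsum]
  have h1 := hl _ hc
  have h2 : ∀ j, D.avg₂ (D.avg₁ (δ - fun _ => m)) j = D.avg₂ (D.avg₁ δ) j - m := fun j => by
    rw [map_sub, map_sub, hB.avg₁_const, hB.avg₂_const, Pi.sub_apply]
  have h3 : ∑ j, (δ - fun _ => m : Fin I₂ → ℝ) j ^ 2 = ∑ j, δ j ^ 2 - I₂ * m ^ 2 := by
    have : ∀ j, (δ - fun _ => m : Fin I₂ → ℝ) j ^ 2 = δ j ^ 2 - 2 * m * δ j + m ^ 2 := fun j => by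
      rw [Pi.sub_apply]; ring
    simp only [this, Finset.sum_add_distrib, Finset.sum_sub_distrib, ← Finset.mul_sum, hsum]
    simp
    ring
  have h4 : ∑ j, (D.avg₂ (D.avg₁ δ) j - m) = 0 := by
    rw [Finset.sum_sub_distrib, hB.sum_avg_avg, hsum]
    simp
  have h5 : ∑ j, (s * (D.avg₂ (D.avg₁ δ) j - m) + k * m) ^ 2
      = s ^ 2 * ∑ j, (D.avg₂ (D.avg₁ δ) j - m) ^ 2 + k ^ 2 * (I₂ * m ^ 2) := by
    have : ∀ j, (s * (D.avg₂ (D.avg₁ δ) j - m) + k * m) ^ 2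
        = s ^ 2 * (D.avg₂ (D.avg₁ δ) j - m) ^ 2 + 2 * s * k * m * (D.avg₂ (D.avg₁ δ) j - m)
          + k ^ 2 * m ^ 2 := fun j => by ring
    simp only [this, Finset.sum_add_distrib, ← Finset.mul_sum, h4]
    simp
  simp only [h2] at h1
  rw [h5]
  have h6 : 0 ≤ ∑ j, (δ - fun _ => m : Fin I₂ → ℝ) j ^ 2 := Finset.sum_nonneg fun j _ => sq_nonneg _
  calc _ ≤ s ^ 2 * ((l : ℝ) ^ 2 * ∑ j, (δ - fun _ => m : Fin I₂ → ℝ) j ^ 2) + k ^ 2 * (I₂ * m ^ 2) := by gcongr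
    _ = (s * l) ^ 2 * ∑ j, (δ - fun _ => m : Fin I₂ → ℝ) j ^ 2 + k ^ 2 * (I₂ * m ^ 2) := by ring
    _ ≤ ρ ^ 2 * ∑ j, (δ - fun _ => m : Fin I₂ → ℝ) j ^ 2 + ρ ^ 2 * (I₂ * m ^ 2) := by gcongr
    _ = _ := by rw [h3]; ring

/-- Euclidean distance of the second factor's effects. -/
def effectDist (θ θ' : Param I₁ I₂) : ℝ := √(∑ j, (θ.2.2 j - θ'.2.2 j) ^ 2)

theorem norm_sub_le_effectDist (θ θ' : Param I₁ I₂) : ‖θ.2.2 - θ'.2.2‖ ≤ effectDist θ θ' := by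
  refine (pi_norm_le_iff_of_nonneg (Real.sqrt_nonneg _)).2 fun j => ?_
  refine Real.abs_le_sqrt ?_
  exact Finset.single_le_sum (f := fun j => (θ.2.2 j - θ'.2.2 j) ^ 2)
    (fun i _ => sq_nonneg _) (Finset.mem_univ j)

theorem effectDist_le (θ θ' : Param I₁ I₂) :
    effectDist θ θ' ≤ (∑ j, |θ.2.2 j|) + ∑ j, |θ'.2.2 j| := by
  rw [effectDist, Real.sqrt_le_left (by positivity), ← Finset.sum_add_distrib]
  refine le_trans ?_ (Finset.sum_sq_le_sq_sum_of_nonneg fun j _ => by positivity)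
  refine Finset.sum_le_sum fun j _ => sq_le_sq' ?_ ?_
  · have := neg_abs_le (θ.2.2 j)
    have := le_abs_self (θ'.2.2 j)
    linarith
  · have := le_abs_self (θ.2.2 j)
    have := neg_abs_le (θ'.2.2 j)
    linarith

/-- Compactly supported C¹ functions are dense in L², bounded and Lipschitz, hence suited to the
coupling; the two-block structure extends the rate to all of L². -/
theorem Design.Balanced.l2Rate_collapsedGibbs_le (hB : D.Balanced) (hτ : 0 < γ.τ) (hτ₁ : 0 < γ.τ₁)
    (hτ₂ : 0 < γ.τ₂) {l : ℝ≥0} (hl : ∀ g : Fin I₂ → ℝ, ∑ j, g j = 0 →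
      ∑ j, D.avg₂ (D.avg₁ g) j ^ 2 ≤ (l : ℝ) ^ 2 * ∑ j, g j ^ 2) {ρ : ℝ≥0}
    (hρ : D.centeredFactor γ * l ≤ ρ) (hρ' : D.constFactor γ τpr ≤ ρ) :
    l2Rate (D.collapsedGibbs γ μpr τpr y) (D.posterior γ μpr τpr y) ≤ ρ := by
  have hprob := D.isProbabilityMeasure_posterior (μpr := μpr) (τpr := τpr) (y := y) hτ
  set π := D.posterior γ μpr τpr y with hπ
  have hΦ := D.measurable_iterate (γ := γ) (μpr := μpr) (τpr := τpr) (y := y)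
  have hae := collapsedGibbs_ae_eq (D := D) (μpr := μpr) (τpr := τpr) (y := y) hτ hτ₁ hτ₂
  have hinvP : (D.collapsedGibbs γ μpr τpr y).Invariant π := invariant_twoBlockGibbs
  have hinv := invariant_congr hinvP hae
  obtain ⟨M, hM, hMlip⟩ := D.exists_norm_iterate_sub_le (γ := γ) (μpr := μpr) (τpr := τpr) (y := y)
  have hh : MemLp (fun θ : Param I₁ I₂ => ∑ j, |θ.2.2 j|) 2 π :=
    memLp_finsetSum _ fun j _ => (D.memLp_effect₂ hτ j).norm
  -- A rate `r` slightly above `ρ` is used because `ρ` may be zero, while the preceding estimates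
  -- require a positive rate.
  refine le_of_forall_gt fun R hR => ?_
  obtain ⟨r, hρr, hrR⟩ := ENNReal.lt_iff_exists_nnreal_btwn.1 hR
  have hρr' : ρ < r := by exact_mod_cast hρr
  have hr : 0 < r := lt_of_le_of_lt (zero_le : 0 ≤ ρ) hρr'
  refine lt_of_le_of_lt ?_ hrR
  refine l2Rate_twoBlockGibbs_le hr
    {f : Param I₁ I₂ → ℝ | HasCompactSupport f ∧ ContDiff ℝ 1 f} ?_ ?_ ?_
  · rintro f ⟨hf, hf'⟩
    exact hf'.continuous.memLp_of_hasCompactSupport hf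
  · intro f hf ε hε
    obtain ⟨g, hg, hg', hfg⟩ := hf.exist_eLpNorm_sub_le (by norm_num) (by norm_num) hε
    exact ⟨g, ⟨hg, hg'.of_le (by exact_mod_cast le_top)⟩, hfg⟩
  · rintro f ⟨hf, hf'⟩
    obtain ⟨L, hL⟩ := hf'.lipschitzWith_of_hasCompactSupport hf one_ne_zero
    obtain ⟨B, hfB⟩ := hf.exists_bound_of_continuous hf'.continuous
    have hfd : ∀ θ θ' ξ, |f (D.iterate γ μpr τpr y (θ, ξ)) - f (D.iterate γ μpr τpr y (θ', ξ))|
        ≤ (L * M.toNNReal : ℝ≥0) * effectDist θ θ' := fun θ θ' ξ => by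
      have h := hL.dist_le_mul (D.iterate γ μpr τpr y (θ, ξ)) (D.iterate γ μpr τpr y (θ', ξ))
      rw [dist_eq_norm, dist_eq_norm] at h
      refine h.trans ?_
      rw [NNReal.coe_mul, Real.coe_toNNReal _ hM, mul_assoc]
      gcongr
      exact (hMlip θ θ' ξ).trans (by gcongr; exact norm_sub_le_effectDist θ θ')
    have hd : ∀ θ θ' ξ, effectDist (D.iterate γ μpr τpr y (θ, ξ)) (D.iterate γ μpr τpr y (θ', ξ))
        ≤ ρ * effectDist θ θ' := fun θ θ' ξ => by
      have h := hB.sum_sq_iterate_sub_le (μpr := μpr) (y := y) hτ hτ₁ hτ₂ hl hρ hρ' θ θ' ξ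
      unfold effectDist
      rw [← Real.sqrt_sq ρ.coe_nonneg, ← Real.sqrt_mul (sq_nonneg _)]
      exact Real.sqrt_le_sqrt h
    obtain ⟨C, hC⟩ := exists_eLpNorm_pow_sub_le hΦ hinv hh effectDist_le hr hρr'.le
      hf'.continuous.measurable hfB hfd hd
    refine ⟨C, fun t => le_trans (le_of_eq ?_) (hC t)⟩
    refine eLpNorm_congr_ae ?_
    filter_upwards [pow_ae_eq hinvP hae t] with θ hθ
    rw [← hθ]
    rfl

/-- The linear form has variance `v ∑ gⱼ²`, which is positive. -/
theorem not_ae_eq_const_of_pi_gaussian {v : ℝ≥0} (hv : v ≠ 0) {g : Fin I₂ → ℝ} (hg : g ≠ 0) (c : ℝ) :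
    ¬ ∀ᵐ b ∂(Measure.pi fun _ : Fin I₂ => gaussianReal 0 v), ∑ j, g j * b j = c := by
  intro h
  have hvar := variance_sum_pi (μ := fun _ : Fin I₂ => gaussianReal 0 v)
    (X := fun j x => g j * x) fun j => (memLp_id_gaussianReal 2).const_mul (g j)
  have h0 : Var[∑ j, fun b : Fin I₂ → ℝ => g j * b j; Measure.pi fun _ => gaussianReal 0 v] = 0 := by
    have : (∑ j, fun b : Fin I₂ → ℝ => g j * b j)
        =ᵐ[Measure.pi fun _ : Fin I₂ => gaussianReal 0 v] fun _ => c := by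
      filter_upwards [h] with b hb
      simpa using hb
    rw [variance_congr this]
    simp [variance, evariance]
  rw [h0] at hvar
  simp only [variance_const_mul _ (fun x : ℝ => x), variance_fun_id_gaussianReal] at hvar
  obtain ⟨j, hj⟩ := Function.ne_iff.1 hg
  have hv' : (0 : ℝ) < v := by exact_mod_cast pos_iff_ne_zero.2 hv
  have h1 := (Finset.sum_eq_zero_iff_of_nonneg fun j _ => by positivity).1 hvar.symm j
    (Finset.mem_univ j)
  have hj' : g j ≠ 0 := hj
  have : 0 < g j ^ 2 * (v : ℝ) := by positivity
  exact this.ne' h1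

/-- Pairing `a²` with the eigenvector gives a statistic whose conditional mean is affine in its
current value. The eigenvector has sum zero, so the constant direction does not contribute. -/
theorem Design.Balanced.le_l2Rate_collapsedGibbs (hB : D.Balanced) (hτ : 0 < γ.τ) (hτ₁ : 0 < γ.τ₁)
    (hτ₂ : 0 < γ.τ₂) {l : ℝ≥0} (hl : l = 0 ∨ ∃ g : Fin I₂ → ℝ, g ≠ 0 ∧ ∑ j, g j = 0 ∧
      D.avg₂ (D.avg₁ g) = (l : ℝ) • g) :
    ENNReal.ofReal (D.centeredFactor γ * l)
      ≤ l2Rate (D.collapsedGibbs γ μpr τpr y) (D.posterior γ μpr τpr y) := by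
  rcases hl with rfl | ⟨g, hg, hg0, hgl⟩
  · simp
  have hprob := D.isProbabilityMeasure_posterior (μpr := μpr) (τpr := τpr) (y := y) hτ
  have hN : (N : ℝ) ≠ 0 := Nat.cast_ne_zero.2 (NeZero.ne N)
  have hI : (I₂ : ℝ) ≠ 0 := Nat.cast_ne_zero.2 (NeZero.ne I₂)
  set π := D.posterior γ μpr τpr y with hπ
  have hΦ := D.measurable_iterate (γ := γ) (μpr := μpr) (τpr := τpr) (y := y)
  have hae := collapsedGibbs_ae_eq (D := D) (μpr := μpr) (τpr := τpr) (y := y) hτ hτ₁ hτ₂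
  have hinvP : (D.collapsedGibbs γ μpr τpr y).Invariant π := invariant_twoBlockGibbs
  have hinv := invariant_congr hinvP hae
  have := isMarkovKernel_noiseKernel (ν := (blockNoise I₁).prod (blockNoise I₂)) hΦ
  set f : Param I₁ I₂ → ℝ := fun θ => ∑ j, g j * θ.2.2 j with hf
  have hfm : Measurable f := by fun_prop
  have hf2 : MemLp f 2 π := memLp_finsetSum _ fun j _ => (D.memLp_effect₂ hτ j).const_mul (g j)
  have hfInt := integrable_of_invariant hinv (hf2.integrable (by norm_num))
  -- By symmetry of the alternating averages, `g` is also a left eigenvector.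
  have hadj : ∀ δ : Fin I₂ → ℝ, ∑ j, g j * D.avg₂ (D.avg₁ δ) j = l * ∑ j, g j * δ j := fun δ => by
    have h1 := hB.sum_avg_avg_mul g δ
    have h2 := hB.sum_avg_avg_mul δ g
    rw [hgl] at h2
    have h3 : ∑ i, D.avg₁ g i * D.avg₁ δ i = ∑ i, D.avg₁ δ i * D.avg₁ g i :=
      Finset.sum_congr rfl fun i _ => mul_comm _ _
    rw [h3, ← h2] at h1
    rw [mul_left_cancel₀ (div_ne_zero hN hI) h1, Finset.mul_sum]
    refine Finset.sum_congr rfl fun j _ => ?_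
    rw [Pi.smul_apply, smul_eq_mul]
    ring
  have hdiff : ∀ θ θ' ξ, f (D.iterate γ μpr τpr y (θ, ξ))
      = f (D.iterate γ μpr τpr y (θ', ξ)) + D.centeredFactor γ * l * (f θ - f θ') := by
    intro θ θ' ξ
    rw [← sub_eq_iff_eq_add']
    simp only [hf, ← Finset.sum_sub_distrib, ← mul_sub, hB.iterate_sub hτ hτ₁ hτ₂]
    simp only [mul_add, mul_sub, Finset.sum_add_distrib, Finset.sum_sub_distrib, ← Finset.sum_mul,
      hg0, zero_mul, add_zero, sub_zero]
    have : ∀ j, g j * (D.centeredFactor γ * D.avg₂ (D.avg₁ (θ.2.2 - θ'.2.2)) j)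
        = D.centeredFactor γ * (g j * D.avg₂ (D.avg₁ (θ.2.2 - θ'.2.2)) j) := fun j => by ring
    simp only [this, ← Finset.mul_sum, hadj, Pi.sub_apply, mul_sub, Finset.sum_sub_distrib]
    ring
  -- Any state with an integrable image serves as reference. The images of other states differ from
  -- its image by a deterministic constant, so the affine formula holds everywhere.
  obtain ⟨θ₀, hθ₀⟩ := hfInt.exists
  have hK : ∀ θ, ∫ w, f w ∂(noiseKernel ((blockNoise I₁).prod (blockNoise I₂))
      (D.iterate γ μpr τpr y) θ) = (D.centeredFactor γ * l).toNNReal * f θ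
        + (∫ w, f w ∂(noiseKernel ((blockNoise I₁).prod (blockNoise I₂))
            (D.iterate γ μpr τpr y) θ₀) - D.centeredFactor γ * l * f θ₀) := fun θ => by
    have hm : Measurable fun ξ => D.iterate γ μpr τpr y (θ₀, ξ) := hΦ.comp measurable_prodMk_left
    rw [noiseKernel_apply hΦ, integrable_map_measure hfm.aestronglyMeasurable hm.aemeasurable] at hθ₀
    rw [integral_noiseKernel hΦ _ hfm, integral_noiseKernel hΦ _ hfm]
    simp only [hdiff θ θ₀]
    have hθ₀' : Integrable (fun ξ => f (D.iterate γ μpr τpr y (θ₀, ξ)))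
      ((blockNoise I₁).prod (blockNoise I₂)) := hθ₀
    rw [integral_add hθ₀' (integrable_const _), integral_const, probReal_univ, one_smul,
      Real.coe_toNNReal _ (mul_nonneg D.centeredFactor_nonneg l.coe_nonneg)]
    ring
  have h := le_l2Rate_of_affine hinv hf2 (Filter.Eventually.of_forall hK) fun hc =>
    not_ae_eq_const_of_pi_gaussian (inv_ne_zero hτ₂.ne') hg _
      (D.ae_pi_of_ae_posterior (p := fun b => ∑ j, g j * b j = ∫ z, f z ∂π) hτ hc)
  rw [l2Rate_congr hinvP hae]
  exact h

end Rates

/-! ### Relaxation times and cost -/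

section Bounds

variable {N I₁ I₂ : ℕ}

theorem steps_blockProgram {I J : ℕ} (lev : Fin N → Fin I) (lev' : Fin N → Fin J)
    (a sum cnt : Fin I → Reg N I₁ I₂) (b : Fin J → Reg N I₁ I₂) (τ τk μpr τpr : ℝ) :
    steps (blockProgram lev lev' a sum cnt b τ τk μpr τpr) = 11 + 20 * I + 3 * N := by
  simp [steps, blockProgram, List.length_flatMap]
  ring

theorem Design.steps_iteration (D : Design N I₁ I₂) (γ : Precisions) (μpr : ℝ) (τpr : ℝ≥0) :
    steps (D.iteration γ μpr τpr) = 22 + 20 * (I₁ + I₂) + 6 * N := by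
  have h : steps (D.iteration γ μpr τpr)
      = steps (blockProgram D.lev₁ D.lev₂ Reg.a₁ Reg.sum₁ Reg.cnt₁ Reg.a₂ γ.τ γ.τ₁ μpr τpr :
          List (Instr (Reg N I₁ I₂)))
        + steps (blockProgram D.lev₂ D.lev₁ Reg.a₂ Reg.sum₂ Reg.cnt₂ Reg.a₁ γ.τ γ.τ₂ μpr τpr :
          List (Instr (Reg N I₁ I₂))) :=
    List.length_append
  rw [h, steps_blockProgram, steps_blockProgram]
  ring

theorem one_sub_shrinkage_le {n τ τk : ℝ} (hn : 0 < n) (hτ : 0 < τ) (hτk : 0 < τk) :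
    1 - shrinkage n τ τk ≤ τk / τ * n⁻¹ := by
  have h : 0 < n * τ + τk := by positivity
  have e : 1 - shrinkage n τ τk = τk / (n * τ + τk) := by
    rw [shrinkage, eq_div_iff h.ne', sub_mul, div_mul_cancel₀ _ h.ne']
    ring
  rw [e, ← div_eq_mul_inv, div_div]
  gcongr
  linarith [mul_comm n τ]

theorem le_one_sub_shrinkage {n τ τk : ℝ} (hn : 1 ≤ n) (hτ : 0 < τ) (hτk : 0 < τk) :
    τk / (τ + τk) * n⁻¹ ≤ 1 - shrinkage n τ τk := by
  have hn0 : 0 < n := by linarith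
  have h : 0 < n * τ + τk := by positivity
  have e : 1 - shrinkage n τ τk = τk / (n * τ + τk) := by
    rw [shrinkage, eq_div_iff h.ne', sub_mul, div_mul_cancel₀ _ h.ne']
    ring
  rw [e, ← div_eq_mul_inv, div_div]
  gcongr
  nlinarith

theorem shrinkage_nonneg {n τ τk : ℝ} (hn : 0 ≤ n) (hτ : 0 ≤ τ) (hτk : 0 ≤ τk) :
    0 ≤ shrinkage n τ τk := by
  unfold shrinkage
  positivity

theorem shrinkage_le_one {n τ τk : ℝ} (hn : 0 ≤ n) (hτ : 0 ≤ τ) (hτk : 0 ≤ τk) :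
    shrinkage n τ τk ≤ 1 :=
  div_le_one_of_le₀ (by linarith) (by positivity)

theorem priorShare_nonneg {N n τ τk τpr : ℝ} (hN : 0 ≤ N) (hn : 0 ≤ n) (hτ : 0 ≤ τ) (hτk : 0 ≤ τk)
    (hτpr : 0 ≤ τpr) : 0 ≤ priorShare N n τ τk τpr := by
  unfold priorShare
  positivity

/-- Since `1 ≤ n ≤ N`, one has `nτ + τk ≤ N(τ + τk)`: the data contribute to the precision of the
global effect at least what a single observation would, whatever the design. -/
theorem priorShare_le {N n τ τk τpr : ℝ} (hn : 1 ≤ n) (hnN : n ≤ N) (hτ : 0 < τ) (hτk : 0 < τk)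
    (hτpr : 0 ≤ τpr) : priorShare N n τ τk τpr ≤ τpr / (τpr + τk * τ / (τ + τk)) := by
  have hn0 : 0 < n := by linarith
  have h1 : τk * τ / (τ + τk) ≤ τk / (n * τ + τk) * τ * N := by
    rw [div_mul_eq_mul_div, div_mul_eq_mul_div, div_le_div_iff₀ (by positivity) (by positivity),
      mul_assoc (τk * τ)]
    gcongr
    nlinarith
  unfold priorShare
  gcongr

variable [NeZero N] [NeZero I₁] [NeZero I₂] {D : Design N I₁ I₂} {γ : Precisions}
  {μpr : ℝ} {τpr : ℝ≥0} {y : Fin N → ℝ}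

/-- `N / I₁` is an actual count, hence an integer, and it is positive. -/
theorem Design.Balanced.one_le_div₁ (hB : D.Balanced) : (1 : ℝ) ≤ N / I₁ := by
  have hN : (0 : ℝ) < N := Nat.cast_pos.2 (NeZero.pos N)
  have hI : (0 : ℝ) < I₁ := Nat.cast_pos.2 (NeZero.pos I₁)
  have h : (0 : ℝ) < D.occ₁ 0 := by rw [hB.1]; positivity
  rw [← hB.1 0]
  exact_mod_cast Nat.cast_pos.1 h

theorem Design.Balanced.one_le_div₂ (hB : D.Balanced) : (1 : ℝ) ≤ N / I₂ := by
  have hN : (0 : ℝ) < N := Nat.cast_pos.2 (NeZero.pos N)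
  have hI : (0 : ℝ) < I₂ := Nat.cast_pos.2 (NeZero.pos I₂)
  have h : (0 : ℝ) < D.occ₂ 0 := by rw [hB.2]; positivity
  rw [← hB.2 0]
  exact_mod_cast Nat.cast_pos.1 h

theorem coe_nbar : (nbar N I₁ I₂ : ℝ≥0∞) = (ENNReal.ofReal ((I₁ + I₂) / (2 * N)))⁻¹ := by
  have hN : (0 : ℝ) < N := Nat.cast_pos.2 (NeZero.pos N)
  have hI : (0 : ℝ) < I₁ := Nat.cast_pos.2 (NeZero.pos I₁)
  have hI' : (0 : ℝ) ≤ I₂ := Nat.cast_nonneg _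
  rw [← ENNReal.ofReal_inv_of_pos (by positivity), inv_div, ← ENNReal.ofReal_coe_nnreal]
  simp [nbar]

/-- A minimum of reciprocals is the reciprocal of a maximum, so relaxation times can be compared
through real-valued gaps; `l = 1` gives an infinite `Taux` consistently. -/
theorem Design.min_nbar_Taux (D : Design N I₁ I₂) {l : ℝ≥0}
    (hl : l2Rate D.auxGibbs D.auxTarget = l) :
    min (nbar N I₁ I₂ : ℝ≥0∞) D.Taux
      = (ENNReal.ofReal (max (((I₁ : ℝ) + I₂) / (2 * N)) (1 - l)))⁻¹ := by
  have h1 : D.Taux = (ENNReal.ofReal (1 - l))⁻¹ := by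
    rw [Taux, relaxationTime, hl, ENNReal.ofReal_sub _ l.coe_nonneg, ENNReal.ofReal_one,
      ENNReal.ofReal_coe_nnreal]
  rw [h1, coe_nbar, ENNReal.ofReal_max]
  rcases le_total (ENNReal.ofReal ((I₁ + I₂) / (2 * N))) (ENNReal.ofReal (1 - l)) with h | h
  · rw [max_eq_right h, min_eq_right (ENNReal.inv_le_inv.2 h)]
  · rw [max_eq_left h, min_eq_left (ENNReal.inv_le_inv.2 h)]

theorem Design.Balanced.le_Tcgs (hB : D.Balanced) (hτ : 0 < γ.τ) (hτ₁ : 0 < γ.τ₁)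
    (hτ₂ : 0 < γ.τ₂) {l : ℝ≥0} (hl : l = 0 ∨ ∃ g : Fin I₂ → ℝ, g ≠ 0 ∧ ∑ j, g j = 0 ∧
      D.avg₂ (D.avg₁ g) = (l : ℝ) • g) :
    (ENNReal.ofReal (1 - D.centeredFactor γ * l))⁻¹ ≤ D.Tcgs γ μpr τpr y := by
  rw [Tcgs, relaxationTime, ENNReal.inv_le_inv,
    ENNReal.ofReal_sub _ (mul_nonneg D.centeredFactor_nonneg l.coe_nonneg), ENNReal.ofReal_one]
  exact tsub_le_tsub_left (hB.le_l2Rate_collapsedGibbs hτ hτ₁ hτ₂ hl) 1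

theorem Design.Balanced.Tcgs_le (hB : D.Balanced) (hτ : 0 < γ.τ) (hτ₁ : 0 < γ.τ₁)
    (hτ₂ : 0 < γ.τ₂) {l : ℝ≥0} (hl : ∀ g : Fin I₂ → ℝ, ∑ j, g j = 0 →
      ∑ j, D.avg₂ (D.avg₁ g) j ^ 2 ≤ (l : ℝ) ^ 2 * ∑ j, g j ^ 2) {x : ℝ}
    (hx : x ≤ 1 - D.centeredFactor γ * l) (hx' : x ≤ 1 - D.constFactor γ τpr) :
    D.Tcgs γ μpr τpr y ≤ (ENNReal.ofReal x)⁻¹ := by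
  have h0 : 0 ≤ 1 - x := by linarith [D.constFactor_nonneg (γ := γ) (τpr := τpr)]
  have h := hB.l2Rate_collapsedGibbs_le (μpr := μpr) (τpr := τpr) (y := y) hτ hτ₁ hτ₂ hl
    (ρ := (1 - x).toNNReal) (by rw [Real.coe_toNNReal _ h0]; linarith)
    (by rw [Real.coe_toNNReal _ h0]; linarith)
  rw [Tcgs, relaxationTime, ENNReal.inv_le_inv]
  calc ENNReal.ofReal x = 1 - ENNReal.ofReal (1 - x) := by
        rw [← ENNReal.ofReal_one, ← ENNReal.ofReal_sub _ h0, sub_sub_cancel]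
    _ ≤ _ := tsub_le_tsub_left h 1

/-- Constant of the lower bound. -/
def lowerConst (γ : Precisions) : ℝ := 1 / (2 * (γ.τ₁ / γ.τ + γ.τ₂ / γ.τ) + 1)

/-- Constant of the upper bound. -/
def upperConst (γ : Precisions) : ℝ :=
  1 / (γ.τ₁ / (γ.τ + γ.τ₁) * (γ.τ₂ / (γ.τ + γ.τ₂)))
    + (1 + γ.τ₁ * γ.τ / (γ.τ + γ.τ₁)) / (γ.τ₁ * γ.τ / (γ.τ + γ.τ₁))

theorem lowerConst_pos (γ : Precisions) : 0 < lowerConst γ := by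
  unfold lowerConst
  positivity

theorem upperConst_pos (hτ : 0 < γ.τ) (hτ₁ : 0 < γ.τ₁) (hτ₂ : 0 < γ.τ₂) : 0 < upperConst γ := by
  have h : (0 : ℝ) < γ.τ := hτ
  have h1 : (0 : ℝ) < γ.τ₁ := hτ₁
  have h2 : (0 : ℝ) < γ.τ₂ := hτ₂
  unfold upperConst
  positivity

/-- For numbers in `[0, 1]`, `1 - x₁x₂l` is at most `(1 - x₁) + (1 - x₂) + (1 - l)`, and each term
is a multiple of the maximum. The multiples add up to the denominator of `lowerConst`. -/
theorem Design.Balanced.one_sub_centeredFactor_mul_le (hB : D.Balanced) (hτ : 0 < γ.τ)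
    (hτ₁ : 0 < γ.τ₁) (hτ₂ : 0 < γ.τ₂) {l : ℝ≥0} (hl : l ≤ 1) :
    lowerConst γ * (1 - D.centeredFactor γ * l) ≤ max (((I₁ : ℝ) + I₂) / (2 * N)) (1 - l) := by
  have h : (0 : ℝ) < γ.τ := hτ
  have h1 : (0 : ℝ) < γ.τ₁ := hτ₁
  have h2 : (0 : ℝ) < γ.τ₂ := hτ₂
  have hl' : (l : ℝ) ≤ 1 := hl
  have hl0 := l.coe_nonneg
  have hn1 := hB.one_le_div₁
  have hn2 := hB.one_le_div₂
  have hN : (0 : ℝ) < N := Nat.cast_pos.2 (NeZero.pos N)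
  have hx1 := one_sub_shrinkage_le (by linarith : (0 : ℝ) < N / I₁) h h1
  have hx2 := one_sub_shrinkage_le (by linarith : (0 : ℝ) < N / I₂) h h2
  have hx1' := shrinkage_le_one (by linarith : (0 : ℝ) ≤ N / I₁) h.le h1.le
  have hx2' := shrinkage_le_one (by linarith : (0 : ℝ) ≤ N / I₂) h.le h2.le
  have hx1n := shrinkage_nonneg (by linarith : (0 : ℝ) ≤ N / I₁) h.le h1.le
  have hx2n := shrinkage_nonneg (by linarith : (0 : ℝ) ≤ N / I₂) h.le h2.le
  rw [lowerConst, one_div_mul_eq_div, div_le_iff₀ (by positivity), centeredFactor]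
  rw [inv_div] at hx1 hx2
  set x₁ := shrinkage (N / I₁) γ.τ γ.τ₁
  set x₂ := shrinkage (N / I₂) γ.τ γ.τ₂
  set q := max (((I₁ : ℝ) + I₂) / (2 * N)) (1 - l)
  have hq1 : ((I₁ : ℝ) + I₂) / (2 * N) ≤ q := le_max_left _ _
  have hq2 : 1 - (l : ℝ) ≤ q := le_max_right _ _
  have hu1 : (I₁ : ℝ) / N ≤ 2 * q := by
    refine le_trans ?_ (mul_le_mul_of_nonneg_left hq1 zero_le_two)
    rw [← mul_div_assoc, mul_div_mul_left _ _ two_ne_zero]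
    gcongr
    linarith [(Nat.cast_nonneg I₂ : (0 : ℝ) ≤ I₂)]
  have hu2 : (I₂ : ℝ) / N ≤ 2 * q := by
    refine le_trans ?_ (mul_le_mul_of_nonneg_left hq1 zero_le_two)
    rw [← mul_div_assoc, mul_div_mul_left _ _ two_ne_zero]
    gcongr
    linarith [(Nat.cast_nonneg I₁ : (0 : ℝ) ≤ I₁)]
  have hs1 : 1 - x₁ ≤ γ.τ₁ / γ.τ * (2 * q) := hx1.trans (by gcongr)
  have hs2 : 1 - x₂ ≤ γ.τ₂ / γ.τ * (2 * q) := hx2.trans (by gcongr)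
  have hprod : 1 - x₁ * x₂ ≤ (1 - x₁) + (1 - x₂) := by nlinarith
  have hs0 : 0 ≤ x₁ * x₂ := mul_nonneg hx1n hx2n
  have hs1' : x₁ * x₂ ≤ 1 := mul_le_one₀ hx1' hx2n hx2'
  have : 1 - x₁ * x₂ * l ≤ (1 - x₁ * x₂) + (1 - l) := by nlinarith
  linarith

/-- The product `x₁x₂l` is at most each of its factors, so the gap dominates `1 - l` as well as the
average of `1 - x₁` and `1 - x₂`, which is of order `(I₁ + I₂) / (2N)`. -/
theorem Design.Balanced.le_one_sub_centeredFactor_mul (hB : D.Balanced) (hτ : 0 < γ.τ)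
    (hτ₁ : 0 < γ.τ₁) (hτ₂ : 0 < γ.τ₂) {l : ℝ≥0} (hl : l ≤ 1) :
    γ.τ₁ / (γ.τ + γ.τ₁) * (γ.τ₂ / (γ.τ + γ.τ₂)) * max (((I₁ : ℝ) + I₂) / (2 * N)) (1 - l)
      ≤ 1 - D.centeredFactor γ * l := by
  have h : (0 : ℝ) < γ.τ := hτ
  have h1 : (0 : ℝ) < γ.τ₁ := hτ₁
  have h2 : (0 : ℝ) < γ.τ₂ := hτ₂
  have hl' : (l : ℝ) ≤ 1 := hl
  have hl0 := l.coe_nonneg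
  have hn1 := hB.one_le_div₁
  have hn2 := hB.one_le_div₂
  have hN : (0 : ℝ) < N := Nat.cast_pos.2 (NeZero.pos N)
  have hx1 := le_one_sub_shrinkage hn1 h h1
  have hx2 := le_one_sub_shrinkage hn2 h h2
  have hx1' := shrinkage_le_one (by linarith : (0 : ℝ) ≤ N / I₁) h.le h1.le
  have hx2' := shrinkage_le_one (by linarith : (0 : ℝ) ≤ N / I₂) h.le h2.le
  have hx1n := shrinkage_nonneg (by linarith : (0 : ℝ) ≤ N / I₁) h.le h1.le
  have hx2n := shrinkage_nonneg (by linarith : (0 : ℝ) ≤ N / I₂) h.le h2.le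
  rw [centeredFactor]
  rw [inv_div] at hx1 hx2
  set x₁ := shrinkage (N / I₁) γ.τ γ.τ₁
  set x₂ := shrinkage (N / I₂) γ.τ γ.τ₂
  set b₁ : ℝ := γ.τ₁ / (γ.τ + γ.τ₁) with hb₁
  set b₂ : ℝ := γ.τ₂ / (γ.τ + γ.τ₂) with hb₂
  have hb1 : 0 ≤ b₁ := by positivity
  have hb2 : 0 ≤ b₂ := by positivity
  have hb1' : b₁ ≤ 1 := div_le_one_of_le₀ (by linarith) (by positivity)
  have hb2' : b₂ ≤ 1 := div_le_one_of_le₀ (by linarith) (by positivity)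
  have hs0 : 0 ≤ x₁ * x₂ := mul_nonneg hx1n hx2n
  have hs1' : x₁ * x₂ ≤ 1 := mul_le_one₀ hx1' hx2n hx2'
  rw [mul_max_of_nonneg _ _ (mul_nonneg hb1 hb2)]
  refine max_le ?_ ?_
  · have e1 : b₁ * b₂ * (I₁ / N) ≤ 1 - x₁ := by
      refine le_trans ?_ hx1
      gcongr
      exact mul_le_of_le_one_right hb1 hb2'
    have e2 : b₁ * b₂ * (I₂ / N) ≤ 1 - x₂ := by
      refine le_trans ?_ hx2
      gcongr
      exact mul_le_of_le_one_left hb2 hb1'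
    have e3 : b₁ * b₂ * ((I₁ + I₂) / (2 * N))
        = (b₁ * b₂ * (I₁ / N) + b₁ * b₂ * (I₂ / N)) / 2 := by
      field_simp
    have e4 : x₁ * x₂ ≤ x₁ := mul_le_of_le_one_right hx1n hx2'
    have e5 : x₁ * x₂ ≤ x₂ := mul_le_of_le_one_left hx2n hx1'
    have e6 : x₁ * x₂ * l ≤ x₁ * x₂ := mul_le_of_le_one_right hs0 hl'
    rw [e3]
    linarith
  · have e1 : b₁ * b₂ * (1 - l) ≤ 1 - l :=
      mul_le_of_le_one_left (by linarith) (mul_le_one₀ hb1' hb2 hb2')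
    have e2 : x₁ * x₂ * l ≤ l := mul_le_of_le_one_left hl0 hs1'
    linarith

/-- Keeping one prior share and bounding the other factors by one is enough for a gap that depends
only on the precisions. -/
theorem Design.Balanced.constFactor_le (hB : D.Balanced) (hτ : 0 < γ.τ) (hτ₁ : 0 < γ.τ₁)
    (hτ₂ : 0 < γ.τ₂) :
    D.constFactor γ τpr ≤ τpr / (τpr + γ.τ₁ * γ.τ / (γ.τ + γ.τ₁)) := by
  have h : (0 : ℝ) < γ.τ := hτ
  have h1 : (0 : ℝ) < γ.τ₁ := hτ₁
  have h2 : (0 : ℝ) < γ.τ₂ := hτ₂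
  have hn1 := hB.one_le_div₁
  have hn2 := hB.one_le_div₂
  have hN : (0 : ℝ) < N := Nat.cast_pos.2 (NeZero.pos N)
  have hle : ∀ {I : ℕ} [NeZero I], (N : ℝ) / I ≤ N := fun {I} _ =>
    div_le_self hN.le (by exact_mod_cast NeZero.pos I)
  have hx1' := shrinkage_le_one (by linarith : (0 : ℝ) ≤ N / I₁) h.le h1.le
  have hx2' := shrinkage_le_one (by linarith : (0 : ℝ) ≤ N / I₂) h.le h2.le
  have hx2n := shrinkage_nonneg (by linarith : (0 : ℝ) ≤ N / I₂) h.le h2.le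
  have ht1 := priorShare_nonneg hN.le (by linarith : (0 : ℝ) ≤ N / I₁) h.le h1.le τpr.coe_nonneg
  have ht2 := priorShare_nonneg hN.le (by linarith : (0 : ℝ) ≤ N / I₂) h.le h2.le τpr.coe_nonneg
  have ht2' : priorShare N (N / I₂) γ.τ γ.τ₂ τpr ≤ 1 :=
    (priorShare_le hn2 hle h h2 τpr.coe_nonneg).trans
      (div_le_one_of_le₀ (le_add_of_nonneg_right (by positivity)) (by positivity))
  refine le_trans ?_ (priorShare_le hn1 hle h h1 τpr.coe_nonneg)
  exact (mul_le_of_le_one_left (mul_nonneg ht1 ht2) (mul_le_one₀ hx1' hx2n hx2')).trans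
    (mul_le_of_le_one_right ht1 ht2')

theorem Design.Balanced.le_Tcgs_of_second_eigenvalue (hB : D.Balanced) (hτ : 0 < γ.τ)
    (hτ₁ : 0 < γ.τ₁) (hτ₂ : 0 < γ.τ₂) :
    ENNReal.ofReal (lowerConst γ) * min (nbar N I₁ I₂ : ℝ≥0∞) D.Taux ≤ D.Tcgs γ μpr τpr y := by
  obtain ⟨l, hl1, hl, hl'⟩ := hB.exists_second_eigenvalue
  refine le_trans ?_ (hB.le_Tcgs hτ hτ₁ hτ₂ hl')
  have h := hB.one_sub_centeredFactor_mul_le hτ hτ₁ hτ₂ hl1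
  have hN : (0 : ℝ) < N := Nat.cast_pos.2 (NeZero.pos N)
  have hI : (0 : ℝ) < I₁ := Nat.cast_pos.2 (NeZero.pos I₁)
  have hq : 0 < max (((I₁ : ℝ) + I₂) / (2 * N)) (1 - l) := lt_max_of_lt_left (by positivity)
  rw [D.min_nbar_Taux (hB.l2Rate_auxGibbs hl hl'), ENNReal.le_inv_iff_mul_le, mul_right_comm,
    ← ENNReal.ofReal_mul (lowerConst_pos γ).le, ← ENNReal.ofReal_inv_of_pos hq,
    ← ENNReal.ofReal_mul' (by positivity), ENNReal.ofReal_le_one, ← div_eq_mul_inv]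
  exact div_le_one_of_le₀ h hq.le

theorem Design.Balanced.Tcgs_le_of_second_eigenvalue (hB : D.Balanced) (hτ : 0 < γ.τ)
    (hτ₁ : 0 < γ.τ₁) (hτ₂ : 0 < γ.τ₂) :
    D.Tcgs γ μpr τpr y
      ≤ ENNReal.ofReal (upperConst γ) * (1 + τpr) * min (nbar N I₁ I₂ : ℝ≥0∞) D.Taux := by
  obtain ⟨l, hl1, hl, hl'⟩ := hB.exists_second_eigenvalue
  have h : (0 : ℝ) < γ.τ := hτ
  have h1 : (0 : ℝ) < γ.τ₁ := hτ₁
  have h2 : (0 : ℝ) < γ.τ₂ := hτ₂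
  have hN : (0 : ℝ) < N := Nat.cast_pos.2 (NeZero.pos N)
  have hI : (0 : ℝ) < I₁ := Nat.cast_pos.2 (NeZero.pos I₁)
  have hq : 0 < max (((I₁ : ℝ) + I₂) / (2 * N)) (1 - l) := lt_max_of_lt_left (by positivity)
  -- Needed for the constant direction, whose gap is bounded below independently of the design and
  -- so is compared with `q` through `q ≤ 1`.
  have hq1 : max (((I₁ : ℝ) + I₂) / (2 * N)) (1 - l) ≤ 1 := by
    refine max_le ?_ (by linarith [l.coe_nonneg])
    have hn1 := hB.one_le_div₁
    have hn2 := hB.one_le_div₂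
    rw [le_div_iff₀ (Nat.cast_pos.2 (NeZero.pos _))] at hn1 hn2
    exact div_le_one_of_le₀ (by linarith) (by positivity)
  have hC := upperConst_pos hτ hτ₁ hτ₂
  have e1 := hB.le_one_sub_centeredFactor_mul hτ hτ₁ hτ₂ hl1
  have e2 := hB.constFactor_le (τpr := τpr) hτ hτ₁ hτ₂
  have hK : ∀ q : ℝ, ENNReal.ofReal (upperConst γ) * (1 + τpr) * (ENNReal.ofReal q)⁻¹
      = (ENNReal.ofReal (q / (upperConst γ * (1 + τpr))))⁻¹ := fun q => by
    have hp : 0 < upperConst γ * (1 + τpr) := by positivity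
    rw [ENNReal.ofReal_div_of_pos hp, ENNReal.inv_div (Or.inl ENNReal.ofReal_ne_top)
      (Or.inl (by simpa using hp)), ENNReal.ofReal_mul hC.le, ENNReal.ofReal_add zero_le_one
      τpr.coe_nonneg, ENNReal.ofReal_one, ENNReal.ofReal_coe_nnreal, div_eq_mul_inv]
  rw [D.min_nbar_Taux (hB.l2Rate_auxGibbs hl hl'), hK]
  set q := max (((I₁ : ℝ) + I₂) / (2 * N)) (1 - l)
  set b : ℝ := γ.τ₁ / (γ.τ + γ.τ₁) * (γ.τ₂ / (γ.τ + γ.τ₂)) with hb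
  set δ : ℝ := γ.τ₁ * γ.τ / (γ.τ + γ.τ₁) with hδ
  have hb0 : 0 < b := by positivity
  have hδ0 : 0 < δ := by positivity
  have hCb : 1 / b ≤ upperConst γ := le_add_of_nonneg_right (by positivity)
  have hCδ : (1 + δ) / δ ≤ upperConst γ := le_add_of_nonneg_left (by positivity)
  have ht := τpr.coe_nonneg
  refine hB.Tcgs_le hτ hτ₁ hτ₂ hl ?_ ?_
  · refine le_trans ?_ e1
    rw [div_le_iff₀ (by positivity)]
    have hbC : 1 ≤ b * upperConst γ := by
      rw [div_le_iff₀ hb0] at hCb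
      linarith
    calc q = q * 1 * 1 := by ring
      _ ≤ q * (b * upperConst γ) * (1 + τpr) := by gcongr; linarith
      _ = _ := by ring
  · have e3 : 1 - (τpr : ℝ) / (τpr + δ) = δ / (τpr + δ) := by
      field_simp
      ring
    have hCδ' : 1 + δ ≤ upperConst γ * δ := by rwa [div_le_iff₀ hδ0] at hCδ
    -- The second summand of `upperConst` is chosen for this: `τpr + δ ≤ (1 + δ)(1 + τpr)`.
    have e4 : 1 / (upperConst γ * (1 + τpr)) ≤ δ / (τpr + δ) := by
      rw [div_le_div_iff₀ (by positivity) (by positivity)]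
      nlinarith
    have e5 : q / (upperConst γ * (1 + τpr)) ≤ 1 / (upperConst γ * (1 + τpr)) := by gcongr
    linarith

end Bounds

end CrossedEffects

end

/-! ### Assembly of the relaxation time and cost bounds. -/

theorem mainTheorem1 (γ : Precisions) (hτ : 0 < γ.τ) (hτ₁ : 0 < γ.τ₁) (hτ₂ : 0 < γ.τ₂) :
    ∃ c C : ℝ≥0, 0 < c ∧ 0 < C ∧
      ∀ (N I₁ I₂ : ℕ) [NeZero N] [NeZero I₁] [NeZero I₂] (D : Design N I₁ I₂), D.Balanced →
      ∀ (μpr : ℝ) (τpr : ℝ≥0) (y : Fin N → ℝ),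
        -- the posterior is a probability measure, and the program samples the updates exactly
        IsProbabilityMeasure (D.posterior γ μpr τpr y) ∧
        (∀ᵐ θ ∂(D.posterior γ μpr τpr y),
          D.iterationLaw γ μpr τpr y θ = D.collapsedGibbs γ μpr τpr y θ) ∧
        -- relaxation time
        c * min (nbar N I₁ I₂ : ℝ≥0∞) D.Taux ≤ D.Tcgs γ μpr τpr y ∧
        D.Tcgs γ μpr τpr y ≤ C * (1 + τpr) * min (nbar N I₁ I₂ : ℝ≥0∞) D.Taux ∧
        -- cost
        c * ((2 * N + (I₁ + I₂)) * min (nbar N I₁ I₂ : ℝ≥0∞) D.Taux) ≤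
          D.costGibbs γ μpr τpr y ∧
        D.costGibbs γ μpr τpr y ≤
          C * (1 + τpr) * ((2 * N + (I₁ + I₂)) * min (nbar N I₁ I₂ : ℝ≥0∞) D.Taux) := by
  have hC := upperConst_pos hτ hτ₁ hτ₂
  -- The factor 20 serves the cost bound only: an iteration takes `22 + 20p + 6N` steps, with `p =
  -- I₁ + I₂`, which is at most `20(2N + p)` once `N ≥ 1`.
  refine ⟨(lowerConst γ).toNNReal, 20 * (upperConst γ).toNNReal,
    Real.toNNReal_pos.2 (lowerConst_pos γ), by simpa using hC, ?_⟩
  intro N I₁ I₂ _ _ _ D hB μpr τpr y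
  have hlow : ((lowerConst γ).toNNReal : ℝ≥0∞) * min (nbar N I₁ I₂ : ℝ≥0∞) D.Taux
      ≤ D.Tcgs γ μpr τpr y := hB.le_Tcgs_of_second_eigenvalue hτ hτ₁ hτ₂
  have hup : D.Tcgs γ μpr τpr y ≤ ((upperConst γ).toNNReal : ℝ≥0∞) * (1 + τpr)
      * min (nbar N I₁ I₂ : ℝ≥0∞) D.Taux := hB.Tcgs_le_of_second_eigenvalue hτ hτ₁ hτ₂
  have hN : 1 ≤ N := NeZero.pos N
  have hsteps : (2 * N + (I₁ + I₂) : ℝ≥0∞) ≤ steps (D.iteration γ μpr τpr) := by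
    rw [D.steps_iteration]
    norm_cast
    omega
  have hsteps' : (steps (D.iteration γ μpr τpr) : ℝ≥0∞) ≤ 20 * (2 * N + (I₁ + I₂)) := by
    rw [D.steps_iteration]
    norm_cast
    omega
  set m := min (nbar N I₁ I₂ : ℝ≥0∞) D.Taux
  set n : ℝ≥0∞ := 2 * N + (I₁ + I₂)
  refine ⟨D.isProbabilityMeasure_posterior hτ, Design.iterationLaw_ae_eq hτ hτ₁ hτ₂, hlow, ?_, ?_, ?_⟩
  · refine hup.trans ?_
    rw [ENNReal.coe_mul]
    gcongr
    exact le_mul_of_one_le_left zero_le (by norm_num)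
  · calc _ = n * (((lowerConst γ).toNNReal : ℝ≥0∞) * m) := by ring
      _ ≤ _ := mul_le_mul' hsteps hlow
  · calc D.costGibbs γ μpr τpr y
        ≤ 20 * n * (((upperConst γ).toNNReal : ℝ≥0∞) * (1 + τpr) * m) := mul_le_mul' hsteps' hup
      _ = _ := by
        rw [ENNReal.coe_mul]
        push_cast
        ring
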